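/- Consider the equations $f(x)u_t=(g(x)e^{nu}u_x)_x+h(x)e^{mu}$ with smooth real functions $f,g,h$ of $x$, constants $n,m$ and $fgn\neq0$, each considered on a connected open domain of $(t,x,u)$ whose sections by $t=\mathrm{const}$, by $x=\mathrm{const}$ and by $(t,x)=\mathrm{const}$ are connected (for instance, a convex open set). Consider the subclass singled out by the conditions $m=0$ and $(h/f)_x=0$. A generalized extended equivalence transformation of the subclass is an invertible transformation of the arbitrary elements and the variables which maps each equation of the subclass to an equation of the subclass (where the new arbitrary elements may depend on the old ones in an arbitrary, possibly nonlocal, way) and which, for each value of the arbitrary elements, acts on the variables $(t,x,u)$ by an invertible smooth point transformation with nonvanishing Jacobian (possibly depending on the arbitrary elements) of the domain of the old equation onto that of the new one, transforming the old equation into the new one as manifolds in the second-order jet space. The generalized extended equivalence transformations of the subclass form a group. This group consists of the transformations which, for each value of the arbitrary elements, are of the form \[ \tilde t=T(t),\quad \tilde x=\varphi(x),\quad \tilde u=\delta_3u+\psi(t,x),\qquad \tilde f=\frac{\delta_0}{\varphi_x}\Psi f,\quad \tilde g=\delta_0\varphi_x\Psi^2g,\quad \tilde n=\frac n{\delta_3},\quad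 \tilde h=\tilde\alpha\tilde f,\quad \tilde m=0, \] where $\alpha=h/f$ and $\tilde\alpha=\tilde h/\tilde f$ are constants, the smooth function $T$ with $T_t\neq0$ is defined by \[ \begin{array}{ll} \alpha\tilde\alpha\ne0\colon\ \dfrac{e^{\tilde n\tilde\alpha T}-1}{\tilde n\tilde\alpha}=\delta_1\dfrac{e^{n\alpha t}-1}{n\alpha}+\delta_2, &\alpha=0,\ \tilde\alpha\ne0\colon\ \dfrac{e^{\tilde n\tilde\alpha T}-1}{\tilde n\tilde\alpha}=\delta_1t+\delta_2,\\[2ex] \alpha\ne0,\ \tilde\alpha=0\colon\ T=\delta_1\dfrac{e^{n\alpha t}-1}{n\alpha}+\delta_2, &\alpha=\tilde\alpha=0\colon\ T=\delta_1t+\delta_2, \end{array} \] $\varphi$ is a smooth function of $x$ with $\varphi_x\neq0$, \[ \psi(t,x)=-\frac{\delta_3}{n}\ln|T_t(t)\Psi(x)|,\qquad \Psi(x)=\delta_4\int\frac{dx}{g(x)}+\delta_5,\qquad T_t\Psi>0, \] and $\delta_0,\dots,\delta_5$ are constants with $\delta_0\delta_1\delta_3\neq0$ and $(\delta_4,\delta_5)\neq(0,0)$;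 the parameters $\delta_j$, $\tilde\alpha$ and $\varphi$ may depend on the arbitrary elements. Conversely, for every equation of the subclass, any values of these parameters for which the above formulas and inequalities make sense on the domain of the equation are realized by an element of the group. In particular, the group contains transformations that are not affine in $t$. -/

import Mathlib

open Filter Topology
open scoped ContDiff

/-- An equation `f(x) u_t = (g(x) e^{n u} u_x)_x + h(x) e^{m u}` with `f g n ≠ 0`, together with
the domain of the variables `(t, x, u)` on which it is considered.  The domain is an arbitrary
connected open set whose sections by `t = const`, by `x = const` and by `(t, x) = const` are
connected; e.g. any non-empty convex open set, in particular any box, and the whole space.  The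
coefficients are smooth functions on the range of `x`; they are extended by zero outside
of it, so that different values of this type are different equations. -/
structure RDEquation where
  /-- the domain of `(t, x, u)` -/
  dom : Set (ℝ × ℝ × ℝ)
  isOpen_dom : IsOpen dom
  isConnected_dom : IsConnected dom
  section_t : ∀ t, IsPreconnected {p ∈ dom | p.1 = t}
  section_x : ∀ x, IsPreconnected {p ∈ dom | p.2.1 = x}
  section_tx : ∀ t x, IsPreconnected {p ∈ dom | p.1 = t ∧ p.2.1 = x}
  f : ℝ → ℝ
  g : ℝ → ℝ
  h : ℝ → ℝ
  n : ℝ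
  m : ℝ
  smooth_f : ContDiffOn ℝ ∞ f ((fun p : ℝ × ℝ × ℝ => p.2.1) '' dom)
  smooth_g : ContDiffOn ℝ ∞ g ((fun p : ℝ × ℝ × ℝ => p.2.1) '' dom)
  smooth_h : ContDiffOn ℝ ∞ h ((fun p : ℝ × ℝ × ℝ => p.2.1) '' dom)
  f_ne_zero : ∀ x ∈ (fun p : ℝ × ℝ × ℝ => p.2.1) '' dom, f x ≠ 0
  g_ne_zero : ∀ x ∈ (fun p : ℝ × ℝ × ℝ => p.2.1) '' dom, g x ≠ 0
  n_ne_zero : n ≠ 0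
  zero_outside : ∀ x ∉ (fun p : ℝ × ℝ × ℝ => p.2.1) '' dom, f x = 0 ∧ g x = 0 ∧ h x = 0

namespace RDEquation

/-- The range of the variable `t`. -/
def tRange (E : RDEquation) : Set ℝ := (fun p : ℝ × ℝ × ℝ => p.1) '' E.dom

/-- The range of the variable `x`. -/
def xRange (E : RDEquation) : Set ℝ := (fun p : ℝ × ℝ × ℝ => p.2.1) '' E.dom

/-- The function `u` of `q = (t, x)` satisfies the equation at the single point `q`;
this only depends on the 2-jet of `u` at `q`. -/
def SatisfiedAt (E : RDEquation) (u : ℝ × ℝ → ℝ) (q : ℝ × ℝ) : Prop :=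
  E.f q.2 * deriv (fun t => u (t, q.2)) q.1 =
    deriv (fun x => E.g x * Real.exp (E.n * u (q.1, x)) * deriv (fun y => u (q.1, y)) x) q.2
      + E.h q.2 * Real.exp (E.m * u q)

/-- The subclass singled out by the conditions `m = 0` and `(h / f)_x = 0`. -/
def InSubclass (E : RDEquation) : Prop :=
  E.m = 0 ∧ ∀ x ∈ E.xRange, deriv (fun y => E.h y / E.f y) x = 0

/-- The map `F(t, x, u) = (T, X, U)` is an (invertible) point transformation of the domain of `E`
onto the domain of `E'`. -/
def IsPointTransformation (F : ℝ × ℝ × ℝ → ℝ × ℝ × ℝ) (E E' : RDEquation) : Prop :=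
  ContDiffOn ℝ ∞ F E.dom ∧ Set.BijOn F E.dom E'.dom ∧
    ∀ p ∈ E.dom, (fderiv ℝ F p).det ≠ 0

/-- The map `F(t, x, u) = (T, X, U)` transforms the equation `E` into `E'` as manifolds in the
second-order jet space.  Jets are represented by germs of functions: if `F` maps the graph of `u`
near the point `p` of this graph into the graph of `v`, i.e.
`v(T(t, x, u(t, x)), X(t, x, u(t, x))) = U(t, x, u(t, x))` for `(t, x)` near `(p.1, p.2.1)`,
then the 2-jet of `u` at `p` satisfies `E` if and only if the 2-jet of `v` at `F p`
satisfies `E'`. -/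
def Transforms (F : ℝ × ℝ × ℝ → ℝ × ℝ × ℝ) (E E' : RDEquation) : Prop :=
  ∀ p ∈ E.dom, ∀ u v : ℝ × ℝ → ℝ,
    ContDiffAt ℝ ∞ u (p.1, p.2.1) → ContDiffAt ℝ ∞ v ((F p).1, (F p).2.1) →
    u (p.1, p.2.1) = p.2.2 →
    (∀ᶠ q in 𝓝 (p.1, p.2.1),
      v ((F (q.1, q.2, u q)).1, (F (q.1, q.2, u q)).2.1) = (F (q.1, q.2, u q)).2.2) →
    (E.SatisfiedAt u (p.1, p.2.1) ↔ E'.SatisfiedAt v ((F p).1, (F p).2.1))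

end RDEquation

/-- The equations of the subclass `m = 0`, `(h / f)_x = 0`. -/
abbrev RDSubclass : Type := {E : RDEquation // E.InSubclass}

/-- The space of all pairs consisting of an equation of the subclass (i.e. of a value of the
arbitrary elements) and of a point `(t, x, u)` of its domain. -/
abbrev RDTotal : Type := Σ E : RDSubclass, E.1.dom

/-- The transformation `Φ` maps the points over the equation `E` to the points over the
equation `E'`, by the map `F` of the variables `(t, x, u)`. -/
def RDTotal.ActsBy (Φ : Equiv.Perm RDTotal) (E E' : RDSubclass)
    (F : ℝ × ℝ × ℝ → ℝ × ℝ × ℝ) : Prop :=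
  ∀ p : E.1.dom, (Φ ⟨E, p⟩).1 = E' ∧ ((Φ ⟨E, p⟩).2 : ℝ × ℝ × ℝ) = F p

/-- Generalized extended equivalence transformations of the subclass: invertible
transformations of arbitrary elements and variables in which the new arbitrary elements are
determined by the old ones (`e`, in a possibly nonlocal way), and which, for each
value of the arbitrary elements, act on `(t, x, u)` by a point transformation (possibly
depending on the arbitrary elements) transforming the old equation into the new one. -/
def IsGenExtEquivTransformation (Φ : Equiv.Perm RDTotal) : Prop :=
  ∃ e : Equiv.Perm RDSubclass, ∀ E : RDSubclass, ∃ F : ℝ × ℝ × ℝ → ℝ × ℝ × ℝ,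
    RDTotal.ActsBy Φ E (e E) F ∧
    RDEquation.IsPointTransformation F E.1 (e E).1 ∧
    RDEquation.Transforms F E.1 (e E).1

/-- `(e^{n α t} - 1) / (n α)` for `α ≠ 0`, and `t` for `α = 0`. -/
noncomputable def expTime (n α t : ℝ) : ℝ :=
  if α = 0 then t else (Real.exp (n * α * t) - 1) / (n * α)

/-- The parameters of a transformation: the constants `δ₀, …, δ₅`, the values `α` and `α'` of the
ratio `h / f` in the old and in the new equation, the functions `T` of `t` and `φ` of `x`, and the
antiderivative `G = ∫ dx / g(x)`. -/
structure RDParams where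
  δ₀ : ℝ
  δ₁ : ℝ
  δ₂ : ℝ
  δ₃ : ℝ
  δ₄ : ℝ
  δ₅ : ℝ
  α : ℝ
  α' : ℝ
  T : ℝ → ℝ
  φ : ℝ → ℝ
  G : ℝ → ℝ

namespace RDParams

/-- `Ψ(x) = δ₄ ∫ dx / g(x) + δ₅`. -/
def Ψ (P : RDParams) (x : ℝ) : ℝ := P.δ₄ * P.G x + P.δ₅

/-- `ψ(t, x) = - (δ₃ / n) ln |T_t(t) Ψ(x)|`. -/
noncomputable def ψ (P : RDParams) (n t x : ℝ) : ℝ :=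
  -(P.δ₃ / n) * Real.log |deriv P.T t * P.Ψ x|

/-- The transformation of variables `(t, x, u) ↦ (T(t), φ(x), δ₃ u + ψ(t, x))`. -/
noncomputable def map (P : RDParams) (n : ℝ) (p : ℝ × ℝ × ℝ) : ℝ × ℝ × ℝ :=
  (P.T p.1, P.φ p.2.1, P.δ₃ * p.2.2 + P.ψ n p.1 p.2.1)

/-- The constraints on the parameters of a transformation of the equation `E`. -/
structure Admissible (P : RDParams) (E : RDEquation) : Prop where
  const_ne_zero : P.δ₀ * P.δ₁ * P.δ₃ ≠ 0
  pair_ne_zero : (P.δ₄, P.δ₅) ≠ (0, 0)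
  ratio : ∀ x ∈ E.xRange, E.h x / E.f x = P.α
  antideriv : ∀ x ∈ E.xRange, HasDerivAt P.G (1 / E.g x) x
  smooth_φ : ContDiffOn ℝ ∞ P.φ E.xRange
  φ_x_ne_zero : ∀ x ∈ E.xRange, deriv P.φ x ≠ 0
  smooth_T : ContDiffOn ℝ ∞ P.T E.tRange
  T_t_ne_zero : ∀ t ∈ E.tRange, deriv P.T t ≠ 0
  T_eq : ∀ t ∈ E.tRange,
    expTime (E.n / P.δ₃) P.α' (P.T t) = P.δ₁ * expTime E.n P.α t + P.δ₂
  sign : ∀ t ∈ E.tRange, ∀ x ∈ E.xRange, 0 < deriv P.T t * P.Ψ x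

/-- The arbitrary elements of `E'` are obtained from those of `E` by the transformation. -/
structure Target (P : RDParams) (E E' : RDEquation) : Prop where
  f_eq : ∀ x ∈ E.xRange, E'.f (P.φ x) = P.δ₀ / deriv P.φ x * P.Ψ x * E.f x
  g_eq : ∀ x ∈ E.xRange, E'.g (P.φ x) = P.δ₀ * deriv P.φ x * P.Ψ x ^ 2 * E.g x
  n_eq : E'.n = E.n / P.δ₃
  ratio : ∀ x ∈ E'.xRange, E'.h x / E'.f x = P.α'

end RDParams

/-! Necessity. Let `F = (T, X, U)` carry one equation of the subclass to another. At a point, take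
the graph of a quadratic polynomial whose 2-jet solves the old equation; if its image is a graph,
the image jet solves the new one (`exists_image_jet`). Neither equation contains `u_tt`, so changing
`u_tt` must not change the image jet's `v_xx`; this forces `T_x = T_u = 0` (`fderiv_time_eq_zero`).
Varying `u_xx` next compares the leading coefficients. The resulting identity holds for almost all
slopes `u_x`, while one side does not involve the slope, so `X_u = 0` (`fderiv_space_eq_zero`). The
same identity then determines how `U` depends on `u`: `U = (n / n') u + ψ(t, x)`. Splitting what
remains in `u_x` and in `e^{nu}` gives `X_t = 0` and three determining equations
(`determining_equations`).

These are integrated in `exists_params`. With `Ψ = f g' / (f' g φ_x²)`, primes marking the new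
coefficients at `φ(x)`, the leading identity reads `T_t Ψ = e^{-n'ψ}`. The other equations say that
`g' / (φ_x g Ψ²)` and `g Ψ_x` are constant, and that `T_tt = T_t (nα - n'α' T_t)`. The constants are
`δ₀` and `δ₄`; `δ₅` comes from integrating `Ψ_x`, and the equation for `T` has first integrals `δ₁`
and `δ₂`.

Sufficiency is a jet computation (`RDParams.Admissible.transforms`): the residual of the new
equation is a nonvanishing multiple of that of the old one. The group property rests on the
classification: since the base map is `(T(t), φ(x))`, images of graphs are graphs, so
transformations of equations can be composed and inverted. Any admissible transformation of a single
equation extends to a group element by swapping it with its target and fixing every other equation.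
-/

/-! ### Local inverses of smooth maps. -/

section LocalInverse

variable {V : Type*} [NormedAddCommGroup V] [NormedSpace ℝ V] [FiniteDimensional ℝ V]

theorem ContinuousLinearMap.det_ne_zero_iff_injective (f : V →L[ℝ] V) :
    f.det ≠ 0 ↔ Function.Injective f := by
  constructor
  · intro h
    exact ((f : V →ₗ[ℝ] V).equivOfDetNeZero h).injective
  · intro h h0
    have h1 := LinearMap.bot_lt_ker_of_det_eq_zero (f := (f : V →ₗ[ℝ] V)) h0
    have h2 : LinearMap.ker (f : V →ₗ[ℝ] V) = ⊥ := LinearMap.ker_eq_bot.2 h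
    rw [h2] at h1
    exact lt_irrefl _ h1

/-- The inverse function theorem in germ form. The last clause lets statements that hold near `q` be
transported to statements near `A q`. -/
theorem ContDiffAt.exists_localInverse {A : V → V} {q : V} (hA : ContDiffAt ℝ ∞ A q)
    (hinj : Function.Injective (fderiv ℝ A q)) :
    ∃ B : V → V, ContDiffAt ℝ ∞ B (A q) ∧ B (A q) = q ∧ (∀ᶠ r in 𝓝 q, B (A r) = r) ∧
      (∀ᶠ y in 𝓝 (A q), A (B y) = y) ∧ map A (𝓝 q) = 𝓝 (A q) := by
  have : CompleteSpace V := FiniteDimensional.complete ℝ V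
  let e : V ≃L[ℝ] V :=
    (LinearEquiv.ofInjectiveEndo (fderiv ℝ A q : V →ₗ[ℝ] V) hinj).toContinuousLinearEquiv
  have he : HasFDerivAt A (e : V →L[ℝ] V) q := by
    have h1 : (e : V →L[ℝ] V) = fderiv ℝ A q := by
      ext v
      rfl
    rw [h1]
    exact (hA.differentiableAt (by simp)).hasFDerivAt
  have hs := hA.hasStrictFDerivAt' he (by simp)
  exact ⟨hA.localInverse he (by simp), hA.to_localInverse he (by simp),
    hs.localInverse_apply_image, hs.eventually_left_inverse, hs.eventually_right_inverse,
    hs.map_nhds_eq_of_equiv⟩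

theorem Set.InjOn.isOpen_image_contDiffOn_invFunOn [Nonempty V] {A : V → V} {s : Set V}
    (hinj : Set.InjOn A s) (hs : IsOpen s) (hA : ContDiffOn ℝ ∞ A s)
    (hd : ∀ p ∈ s, Function.Injective (fderiv ℝ A p)) :
    IsOpen (A '' s) ∧ ContDiffOn ℝ ∞ (Function.invFunOn A s) (A '' s) := by
  constructor
  · rw [isOpen_iff_mem_nhds]
    rintro _ ⟨p, hp, rfl⟩
    obtain ⟨B, -, -, -, -, h⟩ :=
      (hA.contDiffAt (hs.mem_nhds hp)).exists_localInverse (hd p hp)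
    rw [← h]
    exact image_mem_map (hs.mem_nhds hp)
  · rintro _ ⟨p, hp, rfl⟩
    obtain ⟨B, hB, hBp, h1, h2, h⟩ :=
      (hA.contDiffAt (hs.mem_nhds hp)).exists_localInverse (hd p hp)
    refine (hB.congr_of_eventuallyEq ?_).contDiffWithinAt
    rw [← h]
    refine eventually_map.2 ?_
    filter_upwards [h1, hs.mem_nhds hp] with r hr hrs
    rw [hr, hinj.leftInvOn_invFunOn hrs]

end LocalInverse

/-- A function given by `B` in the coordinates `A` on the plane is locally smooth. -/
theorem ContDiffAt.exists_graph {A : ℝ × ℝ → ℝ × ℝ} {B : ℝ × ℝ → ℝ} {q : ℝ × ℝ}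
    (hA : ContDiffAt ℝ ∞ A q) (hinj : Function.Injective (fderiv ℝ A q))
    (hB : ContDiffAt ℝ ∞ B q) :
    ∃ v : ℝ × ℝ → ℝ, ContDiffAt ℝ ∞ v (A q) ∧ ∀ᶠ r in 𝓝 q, v (A r) = B r := by
  obtain ⟨C, hC, hCq, h1, -, -⟩ := hA.exists_localInverse hinj
  refine ⟨B ∘ C, ContDiffAt.comp _ (hCq.symm ▸ hB) hC, ?_⟩
  filter_upwards [h1] with r hr
  simp [hr]

/-! ### Functions constant along the fibres of a projection. -/

section Descend

variable {V W : Type*} [NormedAddCommGroup V] [NormedSpace ℝ V]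
  [NormedAddCommGroup W] [NormedSpace ℝ W]

/-- Inside a ball, the segment joining two points of a fibre stays in that fibre, because `π` is
linear, and the derivative of `S` along it vanishes. So `S` is locally constant on the fibre, and
connectedness makes it constant. -/
theorem eq_of_preconnected_fiber {S : V → ℝ} {s : Set V} (hs : IsOpen s)
    (hS : ContDiffOn ℝ ∞ S s) (π : V →L[ℝ] W)
    (hd : ∀ p ∈ s, ∀ v, π v = 0 → fderiv ℝ S p v = 0)
    (hc : ∀ w, IsPreconnected {p ∈ s | π p = w})
    {p q : V} (hp : p ∈ s) (hq : q ∈ s) (hpq : π p = π q) : S p = S q := by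
  refine (hc (π q)).induction₂ (fun x y => S x = S y) ?_ (fun _ _ _ _ _ _ h1 h2 => h1.trans h2)
    (fun _ _ _ _ h => h.symm) ⟨hp, hpq⟩ ⟨hq, rfl⟩
  rintro x ⟨hx, hxw⟩
  obtain ⟨ε, hε, hb⟩ := Metric.isOpen_iff.1 hs x hx
  filter_upwards [self_mem_nhdsWithin, mem_nhdsWithin_of_mem_nhds (Metric.ball_mem_nhds x hε)]
    with y hy hyb
  have hdiff : ∀ z ∈ Metric.ball x ε, DifferentiableAt ℝ S z := fun z hz =>
    (hS.contDiffAt (hs.mem_nhds (hb hz))).differentiableAt (by simp)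
  have hline : ∀ τ ∈ Set.Icc (0 : ℝ) 1, x + τ • (y - x) ∈ Metric.ball x ε := by
    intro τ hτ
    exact (convex_ball x ε).add_smul_sub_mem (Metric.mem_ball_self hε) hyb hτ
  have hder : ∀ τ ∈ Set.Icc (0 : ℝ) 1,
      HasDerivAt (fun τ : ℝ => S (x + τ • (y - x))) 0 τ := by
    intro τ hτ
    have h1 : HasDerivAt (fun τ : ℝ => x + τ • (y - x)) (y - x) τ := by
      simpa using ((hasDerivAt_id τ).smul_const (y - x)).const_add x
    have h2 := (hdiff _ (hline τ hτ)).hasFDerivAt.comp_hasDerivAt τ h1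
    rwa [hd _ (hb (hline τ hτ)) (y - x) (by rw [map_sub, hxw, hy.2, sub_self])] at h2
  have := constant_of_has_deriv_right_zero (f := fun τ : ℝ => S (x + τ • (y - x))) (a := 0) (b := 1)
    (fun τ hτ => (hder τ hτ).continuousAt.continuousWithinAt)
    (fun τ hτ => (hder τ ⟨hτ.1, hτ.2.le⟩).hasDerivWithinAt) 1 (by simp)
  simpa using this.symm

/-- A smooth function which is constant on the fibers of a split linear surjection is a smooth
function on the image. -/
theorem exists_descend {S : V → ℝ} {s : Set V} (hs : IsOpen s)
    (hS : ContDiffOn ℝ ∞ S s) (π : V →L[ℝ] W) (σ : W →L[ℝ] V) (hσ : ∀ w, π (σ w) = w)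
    (hc : ∀ p ∈ s, ∀ q ∈ s, π p = π q → S p = S q) :
    ∃ S₀ : W → ℝ, ContDiffOn ℝ ∞ S₀ (π '' s) ∧ ∀ p ∈ s, S p = S₀ (π p) := by
  classical
  have key : ∃ S₀ : W → ℝ, ∀ p ∈ s, S p = S₀ (π p) := by
    refine ⟨fun w => if h : ∃ p ∈ s, π p = w then S h.choose else 0, fun p hp => ?_⟩
    have h : ∃ p' ∈ s, π p' = π p := ⟨p, hp, rfl⟩
    simp only [dif_pos h]
    exact hc _ hp _ h.choose_spec.1 h.choose_spec.2.symm
  obtain ⟨S₀, h₀⟩ := key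
  refine ⟨S₀, ?_, h₀⟩
  rintro _ ⟨p, hp, rfl⟩
  -- Near `π p` the chosen `S₀` agrees with `S` on the affine section of `π` through `p`, which
  -- gives smoothness regardless of the choices.
  have hl : ContDiff ℝ ∞ (fun w : W => p + σ (w - π p)) := by fun_prop
  have hlp : p + σ (π p - π p) = p := by simp
  refine ContDiffAt.contDiffWithinAt (ContDiffAt.congr_of_eventuallyEq
    (f := fun w => S (p + σ (w - π p))) ?_ ?_)
  · refine ContDiffAt.comp (g := S) (π p) ?_ hl.contDiffAt
    rw [hlp]
    exact hS.contDiffAt (hs.mem_nhds hp)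
  · have : ∀ᶠ w in 𝓝 (π p), p + σ (w - π p) ∈ s := by
      refine hl.continuous.continuousAt.eventually_mem ?_
      rw [hlp]
      exact hs.mem_nhds hp
    filter_upwards [this] with w hw
    rw [h₀ _ hw, map_add, hσ]
    simp

end Descend

/-! ### Functions of one variable on connected sets. -/

/-- A continuous function without zeros has a constant sign on a preconnected set. -/
theorem IsPreconnected.mul_pos_of_ne_zero {X : Type*} [TopologicalSpace X] {s : Set X}
    (hs : IsPreconnected s)
    {f : X → ℝ} (hf : ContinuousOn f s) (h0 : ∀ x ∈ s, f x ≠ 0) {x y : X} (hx : x ∈ s)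
    (hy : y ∈ s) : 0 < f x * f y := by
  by_contra hneg
  have hlt : f x * f y < 0 := lt_of_le_of_ne (not_lt.1 hneg) (mul_ne_zero (h0 x hx) (h0 y hy))
  have hz : ∃ z ∈ s, f z = 0 := by
    rcases mul_neg_iff.1 hlt with ⟨h1, h2⟩ | ⟨h1, h2⟩
    · exact hs.intermediate_value hy hx hf ⟨h2.le, h1.le⟩
    · exact hs.intermediate_value hx hy hf ⟨h1.le, h2.le⟩
  obtain ⟨z, hz, hz0⟩ := hz
  exact h0 z hz hz0

theorem IsPreconnected.injOn_of_deriv_ne_zero {s : Set ℝ} (hs : IsPreconnected s)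
    {f : ℝ → ℝ} (hf : ContDiffOn ℝ ∞ f s) (h0 : ∀ x ∈ s, deriv f x ≠ 0) :
    Set.InjOn f s := by
  have hoc : s.OrdConnected := hs.ordConnected
  have key : ∀ x ∈ s, ∀ y ∈ s, x < y → f x ≠ f y := by
    intro x hx y hy hxy h
    have hsub : Set.Icc x y ⊆ s := hoc.out hx hy
    obtain ⟨c, hc, hc0⟩ := exists_deriv_eq_zero hxy (hf.continuousOn.mono hsub) h
    exact h0 c (hsub ⟨hc.1.le, hc.2.le⟩) hc0
  intro x hx y hy h
  rcases lt_trichotomy x y with h1 | h1 | h1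
  · exact absurd h (key x hx y hy h1)
  · exact h1
  · exact absurd h.symm (key y hy x hx h1)

theorem IsPreconnected.exists_eq_const_of_hasDerivAt_zero {s : Set ℝ} (hs : IsPreconnected s)
    (ho : IsOpen s) {f : ℝ → ℝ} (hf : ∀ x ∈ s, HasDerivAt f 0 x) :
    ∃ c, ∀ x ∈ s, f x = c :=
  ho.exists_is_const_of_deriv_eq_zero hs
    (fun x hx => (hf x hx).differentiableAt.differentiableWithinAt) (fun x hx => (hf x hx).deriv)

theorem IsPreconnected.exists_antideriv {s : Set ℝ} (hs : IsPreconnected s) (ho : IsOpen s)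
    {f : ℝ → ℝ} (hf : ContinuousOn f s) : ∃ G : ℝ → ℝ, ∀ x ∈ s, HasDerivAt G (f x) x := by
  rcases s.eq_empty_or_nonempty with rfl | ⟨a, ha⟩
  · exact ⟨0, by simp⟩
  have hoc : s.OrdConnected := hs.ordConnected
  refine ⟨fun x => ∫ y in a..x, f y, fun x hx => ?_⟩
  refine intervalIntegral.integral_hasDerivAt_right ?_ ?_ (hf.continuousAt (ho.mem_nhds hx))
  · exact (hf.mono (hoc.uIcc_subset ha hx)).intervalIntegrable
  · exact hf.stronglyMeasurableAtFilter ho x hx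

/-! ### Second-order jets and their transformation. -/

section Jets

/-- The partial derivative `u_t`. -/
noncomputable def jetT (u : ℝ × ℝ → ℝ) (q : ℝ × ℝ) : ℝ := deriv (fun t => u (t, q.2)) q.1

/-- The partial derivative `u_x`. -/
noncomputable def jetX (u : ℝ × ℝ → ℝ) (q : ℝ × ℝ) : ℝ := deriv (fun x => u (q.1, x)) q.2

/-- The partial derivative `u_xx`. -/
noncomputable def jetXX (u : ℝ × ℝ → ℝ) (q : ℝ × ℝ) : ℝ :=
  deriv (deriv fun x => u (q.1, x)) q.2

theorem ContDiffAt.hasDerivAt' {f : ℝ → ℝ} {x : ℝ} (hf : ContDiffAt ℝ ∞ f x) :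
    HasDerivAt f (deriv f x) x :=
  (hf.differentiableAt (by simp)).hasDerivAt

theorem ContDiffAt.deriv_infty {f : ℝ → ℝ} {x : ℝ} (hf : ContDiffAt ℝ ∞ f x) :
    ContDiffAt ℝ ∞ (deriv f) x := by
  have h : ContDiffAt ℝ (∞ : WithTop ℕ∞) (fderiv ℝ f) x := hf.fderiv_right (by simp)
  exact h.clm_apply contDiffAt_const

theorem ContDiffAt.eventually_infty {V W : Type*} [NormedAddCommGroup V] [NormedSpace ℝ V]
    [NormedAddCommGroup W] [NormedSpace ℝ W]
    {f : V → W} {x : V} (hf : ContDiffAt ℝ ∞ f x) :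
    ∀ᶠ y in 𝓝 x, DifferentiableAt ℝ f y := by
  have h := (hf.of_le (m := 1) (by exact_mod_cast le_top)).eventually (by simp)
  filter_upwards [h] with y hy using hy.differentiableAt (by simp)

/-- The second derivative of a function along a curve. -/
theorem deriv_deriv_comp_curve {V W : Type*} [NormedAddCommGroup V] [NormedSpace ℝ V]
    [NormedAddCommGroup W] [NormedSpace ℝ W] {S : V → W} {γ γ' : ℝ → V} {γ'' : V} {τ : ℝ} (hS : ContDiffAt ℝ ∞ S (γ τ))
    (hγ : ∀ᶠ s in 𝓝 τ, HasDerivAt γ (γ' s) s) (hγ' : HasDerivAt γ' γ'' τ) :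
    HasDerivAt (fun s => S (γ s)) (fderiv ℝ S (γ τ) (γ' τ)) τ ∧
    deriv (deriv fun s => S (γ s)) τ =
      fderiv ℝ (fderiv ℝ S) (γ τ) (γ' τ) (γ' τ) + fderiv ℝ S (γ τ) γ'' := by
  have h1 : ∀ᶠ s in 𝓝 τ, HasDerivAt (fun s => S (γ s)) (fderiv ℝ S (γ s) (γ' s)) s := by
    filter_upwards [hγ, hγ.self_of_nhds.continuousAt.eventually hS.eventually_infty] with s hs hs'
    exact hs'.hasFDerivAt.comp_hasDerivAt s hs
  refine ⟨h1.self_of_nhds, ?_⟩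
  have h2 : deriv (fun s => S (γ s)) =ᶠ[𝓝 τ] fun s => fderiv ℝ S (γ s) (γ' s) := by
    filter_upwards [h1] with s hs using hs.deriv
  rw [h2.deriv_eq]
  have h3 : ContDiffAt ℝ (∞ : WithTop ℕ∞) (fderiv ℝ S) (γ τ) := hS.fderiv_right (by simp)
  have h4 : HasDerivAt (fun s => fderiv ℝ S (γ s)) (fderiv ℝ (fderiv ℝ S) (γ τ) (γ' τ)) τ :=
    (h3.differentiableAt (by simp)).hasFDerivAt.comp_hasDerivAt τ hγ.self_of_nhds
  exact (h4.clm_apply hγ').deriv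

variable {u v X U : ℝ × ℝ → ℝ} {T : ℝ → ℝ} {q : ℝ × ℝ}

theorem ContDiffAt.line_x {n : WithTop ℕ∞} (hu : ContDiffAt ℝ n u q) :
    ContDiffAt ℝ n (fun x => u (q.1, x)) q.2 :=
  ContDiffAt.comp (g := u) (f := fun x => (q.1, x)) q.2 hu (by fun_prop)

theorem ContDiffAt.line_t {n : WithTop ℕ∞} (hu : ContDiffAt ℝ n u q) :
    ContDiffAt ℝ n (fun t => u (t, q.2)) q.1 :=
  ContDiffAt.comp (g := u) (f := fun t => (t, q.2)) q.1 hu (by fun_prop)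

theorem Filter.Eventually.line_x {p : ℝ × ℝ → Prop} (h : ∀ᶠ r in 𝓝 q, p r) :
    ∀ᶠ x in 𝓝 q.2, p (q.1, x) :=
  (show ContinuousAt (fun x => (q.1, x)) q.2 by fun_prop).eventually h

theorem Filter.Eventually.line_t {p : ℝ × ℝ → Prop} (h : ∀ᶠ r in 𝓝 q, p r) :
    ∀ᶠ t in 𝓝 q.1, p (t, q.2) :=
  (show ContinuousAt (fun t => (t, q.2)) q.1 by fun_prop).eventually h

theorem fderiv_apply_eq_jets (hu : ContDiffAt ℝ ∞ u q) (e : ℝ × ℝ) :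
    fderiv ℝ u q e = jetT u q * e.1 + jetX u q * e.2 := by
  have hd := (hu.differentiableAt (by simp)).hasFDerivAt
  have h1 : HasDerivAt (fun t => u (t, q.2)) (fderiv ℝ u q (1, 0)) q.1 :=
    HasFDerivAt.comp_hasDerivAt (l := u) (f := fun t => (t, q.2)) q.1 hd
      ((hasDerivAt_id q.1).prodMk (hasDerivAt_const q.1 q.2))
  have h2 : HasDerivAt (fun x => u (q.1, x)) (fderiv ℝ u q (0, 1)) q.2 :=
    HasFDerivAt.comp_hasDerivAt (l := u) (f := fun x => (q.1, x)) q.2 hd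
      ((hasDerivAt_const q.2 q.1).prodMk (hasDerivAt_id q.2))
  rw [jetT, jetX, h1.deriv, h2.deriv]
  have he : e = e.1 • ((1 : ℝ), (0 : ℝ)) + e.2 • ((0 : ℝ), (1 : ℝ)) := by ext <;> simp
  conv_lhs => rw [he]
  simp only [map_add, map_smul, smul_eq_mul]
  ring

/-- The transformation of 2-jets under `t ↦ T(t)`, `(t, x) ↦ X(t, x)`. -/
theorem jets_of_comp_eq (hT : ContDiffAt ℝ ∞ T q.1) (hX : ContDiffAt ℝ ∞ X q)
    (hv : ContDiffAt ℝ ∞ v (T q.1, X q))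
    (h : ∀ᶠ r in 𝓝 q, v (T r.1, X r) = U r) :
    jetT v (T q.1, X q) * deriv T q.1 + jetX v (T q.1, X q) * jetT X q = jetT U q ∧
    jetX v (T q.1, X q) * jetX X q = jetX U q ∧
    jetXX v (T q.1, X q) * jetX X q ^ 2 + jetX v (T q.1, X q) * jetXX X q = jetXX U q := by
  refine ⟨?_, ?_, ?_⟩
  · have h1 : HasDerivAt (fun t => v (T t, X (t, q.2)))
        (fderiv ℝ v (T q.1, X q) (deriv T q.1, jetT X q)) q.1 :=
      HasFDerivAt.comp_hasDerivAt (l := v) (f := fun t => (T t, X (t, q.2))) q.1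
        (hv.differentiableAt (by simp)).hasFDerivAt
        (hT.hasDerivAt'.prodMk hX.line_t.hasDerivAt')
    have h2 : (fun t => v (T t, X (t, q.2))) =ᶠ[𝓝 q.1] fun t => U (t, q.2) := h.line_t
    rw [show jetT U q = _ from h2.deriv_eq.symm, h1.deriv, fderiv_apply_eq_jets hv]
  · have hc := deriv_deriv_comp_curve (S := fun y => v (T q.1, y)) (γ := fun x => X (q.1, x))
      (γ' := deriv fun x => X (q.1, x)) (τ := q.2) hv.line_x ?_ hX.line_x.deriv_infty.hasDerivAt'
    · have h2 : (fun x => v (T q.1, X (q.1, x))) =ᶠ[𝓝 q.2] fun x => U (q.1, x) := h.line_x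
      rw [show jetX U q = _ from h2.deriv_eq.symm, hc.1.deriv, fderiv_eq_smul_deriv, smul_eq_mul]
      exact mul_comm _ _
    · filter_upwards [hX.line_x.eventually_infty] with x hx using hx.hasDerivAt
  · have hc := deriv_deriv_comp_curve (S := fun y => v (T q.1, y)) (γ := fun x => X (q.1, x))
      (γ' := deriv fun x => X (q.1, x)) (τ := q.2) hv.line_x ?_ hX.line_x.deriv_infty.hasDerivAt'
    · have h2 : (fun x => v (T q.1, X (q.1, x))) =ᶠ[𝓝 q.2] fun x => U (q.1, x) := h.line_x
      have h4 : ∀ d : ℝ, fderiv ℝ (fderiv ℝ (fun y => v (T q.1, y))) (X q) d d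
          = jetXX v (T q.1, X q) * d ^ 2 := by
        intro d
        have h5 : HasDerivAt (deriv fun y => v (T q.1, y)) (jetXX v (T q.1, X q)) (X q) :=
          ContDiffAt.hasDerivAt' (ContDiffAt.deriv_infty hv.line_x)
        have h6 : ContDiffAt ℝ (∞ : WithTop ℕ∞) (fderiv ℝ (fun y => v (T q.1, y))) (X q) :=
          ContDiffAt.fderiv_right hv.line_x (by simp)
        have h7 := (h6.differentiableAt (by simp)).hasFDerivAt.clm_apply
          (hasFDerivAt_const (1 : ℝ) (X q))
        have h8 := h5.hasFDerivAt.unique h7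
        have h9 : fderiv ℝ (fderiv ℝ (fun y => v (T q.1, y))) (X q) 1 1 = jetXX v (T q.1, X q) := by
          simpa using (congrArg (fun L : ℝ →L[ℝ] ℝ => L 1) h8).symm
        generalize fderiv ℝ (fderiv ℝ (fun y => v (T q.1, y))) (X q) = D at h9
        have h10 : D d = d • D 1 := by rw [← map_smul]; simp
        have h11 : D 1 d = d • D 1 1 := by rw [← map_smul]; simp
        rw [h10, smul_apply, h11, h9, smul_eq_mul, smul_eq_mul]
        ring
      rw [show jetXX U q = _ from h2.deriv.deriv_eq.symm]
      refine Eq.trans ?_ hc.2.symm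
      refine Eq.trans ?_ (congrArg₂ (· + ·) (h4 (jetX X q)).symm (fderiv_eq_smul_deriv _).symm)
      rw [smul_eq_mul, mul_comm (deriv (deriv fun x => X (q.1, x)) q.2)]
      rfl
    · filter_upwards [hX.line_x.eventually_infty] with x hx using hx.hasDerivAt

/-- The jets of `δ u + ψ`. -/
theorem jets_const_mul_add {ψ : ℝ × ℝ → ℝ} (δ : ℝ) (hu : ContDiffAt ℝ ∞ u q)
    (hψ : ContDiffAt ℝ ∞ ψ q) :
    jetT (fun r => δ * u r + ψ r) q = δ * jetT u q + jetT ψ q ∧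
    jetX (fun r => δ * u r + ψ r) q = δ * jetX u q + jetX ψ q ∧
    jetXX (fun r => δ * u r + ψ r) q = δ * jetXX u q + jetXX ψ q := by
  refine ⟨((hu.line_t.hasDerivAt'.const_mul δ).add hψ.line_t.hasDerivAt').deriv,
    ((hu.line_x.hasDerivAt'.const_mul δ).add hψ.line_x.hasDerivAt').deriv, ?_⟩
  have h : deriv (fun x => δ * u (q.1, x) + ψ (q.1, x)) =ᶠ[𝓝 q.2]
      fun x => δ * deriv (fun x => u (q.1, x)) x + deriv (fun x => ψ (q.1, x)) x := by
    filter_upwards [hψ.line_x.eventually_infty, hu.line_x.eventually_infty] with x hx hx'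
    exact ((hx'.hasDerivAt.const_mul δ).add hx.hasDerivAt).deriv
  exact h.deriv_eq.trans ((hu.line_x.deriv_infty.hasDerivAt'.const_mul δ).add
    hψ.line_x.deriv_infty.hasDerivAt').deriv

theorem Filter.EventuallyEq.jets (h : u =ᶠ[𝓝 q] v) :
    jetT u q = jetT v q ∧ jetX u q = jetX v q ∧ jetXX u q = jetXX v q :=
  ⟨EventuallyEq.deriv_eq h.line_t, EventuallyEq.deriv_eq h.line_x,
    EventuallyEq.deriv_eq (EventuallyEq.deriv h.line_x)⟩

/-- The map `(t, x) ↦ (T(t), X(t, x))` is a local diffeomorphism if `T_t X_x ≠ 0`. -/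
theorem injective_fderiv_triangular (hT : ContDiffAt ℝ ∞ T q.1) (hX : ContDiffAt ℝ ∞ X q)
    (hT0 : deriv T q.1 ≠ 0) (hX0 : jetX X q ≠ 0) :
    ContDiffAt ℝ ∞ (fun r : ℝ × ℝ => (T r.1, X r)) q ∧
      Function.Injective (fderiv ℝ (fun r : ℝ × ℝ => (T r.1, X r)) q) := by
  have hT' : ContDiffAt ℝ ∞ (fun r : ℝ × ℝ => T r.1) q :=
    ContDiffAt.comp (g := T) q hT contDiffAt_fst
  refine ⟨hT'.prodMk hX, ?_⟩
  have hAd : ∀ e, fderiv ℝ (fun r : ℝ × ℝ => (T r.1, X r)) q e =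
      (deriv T q.1 * e.1, jetT X q * e.1 + jetX X q * e.2) := by
    intro e
    have h1 : HasFDerivAt (fun r : ℝ × ℝ => T r.1) _ q :=
      hT.hasDerivAt'.hasFDerivAt.comp q hasFDerivAt_fst
    have h2 := h1.prodMk (hX.differentiableAt (by simp)).hasFDerivAt
    rw [h2.fderiv]
    refine Prod.ext ?_ ?_
    · simp [mul_comm]
    · simp [fderiv_apply_eq_jets hX]
  refine (injective_iff_map_eq_zero _).2 fun e he => ?_
  rw [hAd] at he
  have h1 := congrArg Prod.fst he
  have h2 := congrArg Prod.snd he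
  simp only [Prod.fst_zero, Prod.snd_zero] at h1 h2
  have h3 := (mul_eq_zero.1 h1).resolve_left hT0
  rw [h3, mul_zero, zero_add] at h2
  exact Prod.ext h3 ((mul_eq_zero.1 h2).resolve_left hX0)

end Jets

/-! ### The equation as an algebraic condition on 2-jets. -/

namespace RDEquation

theorem isOpen_tRange (E : RDEquation) : IsOpen E.tRange :=
  isOpenMap_fst _ E.isOpen_dom

theorem isOpen_xRange (E : RDEquation) : IsOpen E.xRange := by
  have h := isOpenMap_fst _ (isOpenMap_snd _ E.isOpen_dom)
  rwa [Set.image_image] at h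

theorem isPreconnected_tRange (E : RDEquation) : IsPreconnected E.tRange :=
  E.isConnected_dom.isPreconnected.image _ continuous_fst.continuousOn

theorem isPreconnected_xRange (E : RDEquation) : IsPreconnected E.xRange :=
  E.isConnected_dom.isPreconnected.image _ (continuous_fst.comp continuous_snd).continuousOn

theorem contDiffAt_f (E : RDEquation) {x : ℝ} (hx : x ∈ E.xRange) : ContDiffAt ℝ ∞ E.f x :=
  E.smooth_f.contDiffAt (E.isOpen_xRange.mem_nhds hx)

theorem contDiffAt_g (E : RDEquation) {x : ℝ} (hx : x ∈ E.xRange) : ContDiffAt ℝ ∞ E.g x :=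
  E.smooth_g.contDiffAt (E.isOpen_xRange.mem_nhds hx)

theorem contDiffAt_h (E : RDEquation) {x : ℝ} (hx : x ∈ E.xRange) : ContDiffAt ℝ ∞ E.h x :=
  E.smooth_h.contDiffAt (E.isOpen_xRange.mem_nhds hx)

/-- Expanding the divergence and using `m = 0` makes the equation affine in `u_t` and `u_xx`, with
no other second derivative; everything later is algebra on this form. -/
theorem satisfiedAt_iff (E : RDEquation) {u : ℝ × ℝ → ℝ} {q : ℝ × ℝ} (hq : q.2 ∈ E.xRange)
    (hm : E.m = 0) (hu : ContDiffAt ℝ ∞ u q) :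
    E.SatisfiedAt u q ↔ E.f q.2 * jetT u q =
      Real.exp (E.n * u q) * (E.g q.2 * (jetXX u q + E.n * jetX u q ^ 2)
        + deriv E.g q.2 * jetX u q) + E.h q.2 := by
  have h1 := (E.contDiffAt_g hq).hasDerivAt'
  have h2 : HasDerivAt (fun x => u (q.1, x)) (jetX u q) q.2 := hu.line_x.hasDerivAt'
  have h3 : HasDerivAt (deriv fun x => u (q.1, x)) (jetXX u q) q.2 :=
    hu.line_x.deriv_infty.hasDerivAt'
  have h4 := ((h1.mul (h2.const_mul E.n).exp).mul h3).deriv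
  have h5 : deriv (fun x => E.g x * Real.exp (E.n * u (q.1, x)) * deriv (fun y => u (q.1, y)) x) q.2
      = Real.exp (E.n * u q) * (E.g q.2 * (jetXX u q + E.n * jetX u q ^ 2)
        + deriv E.g q.2 * jetX u q) := by
    refine Eq.trans h4 ?_
    simp only [Pi.mul_apply]
    change _ * jetX u q + _ = _
    ring
  unfold SatisfiedAt
  rw [h5, hm]
  simp [jetT]

end RDEquation

/-! ### Quadratic test functions with a prescribed 2-jet. -/

section QuadraticGraph

/-- The quadratic function whose graph passes through `p` with the derivatives
`u_t = a`, `u_x = b`, `u_tt = k`, `u_tx = 0`, `u_xx = c`. -/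
noncomputable def quadraticGraph (p : ℝ × ℝ × ℝ) (a b k c : ℝ) (r : ℝ × ℝ) : ℝ :=
  p.2.2 + a * (r.1 - p.1) + b * (r.2 - p.2.1) + k / 2 * (r.1 - p.1) ^ 2 +
    c / 2 * (r.2 - p.2.1) ^ 2

variable (p : ℝ × ℝ × ℝ) (a b k c : ℝ)

theorem contDiff_quadraticGraph {n : WithTop ℕ∞} : ContDiff ℝ n (quadraticGraph p a b k c) := by
  unfold quadraticGraph
  fun_prop

@[simp]
theorem quadraticGraph_self : quadraticGraph p a b k c (p.1, p.2.1) = p.2.2 := by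
  simp [quadraticGraph]

@[simp]
theorem jetT_quadraticGraph : jetT (quadraticGraph p a b k c) (p.1, p.2.1) = a := by
  have h : HasDerivAt (fun t => quadraticGraph p a b k c (t, p.2.1)) (a * 1 + k / 2 *
      (2 * (p.1 - p.1) ^ 1 * 1)) p.1 := by
    have h0 : HasDerivAt (fun t : ℝ => t - p.1) 1 p.1 := (hasDerivAt_id p.1).sub_const p.1
    exact ((((h0.const_mul a).const_add p.2.2).add_const (b * (p.2.1 - p.2.1))).add
      ((h0.pow 2).const_mul (k / 2))).add_const (c / 2 * (p.2.1 - p.2.1) ^ 2)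
  rw [jetT, h.deriv]
  simp

theorem deriv_quadraticGraph : deriv (fun x => quadraticGraph p a b k c (p.1, x)) =
    fun x => b + c * (x - p.2.1) := by
  ext x
  have h : HasDerivAt (fun x => quadraticGraph p a b k c (p.1, x)) (b * 1 + c / 2 *
      (2 * (x - p.2.1) ^ 1 * 1)) x := by
    have h0 : HasDerivAt (fun x : ℝ => x - p.2.1) 1 x := (hasDerivAt_id x).sub_const p.2.1
    exact (((h0.const_mul b).const_add (p.2.2 + a * (p.1 - p.1))).add_const
      (k / 2 * (p.1 - p.1) ^ 2)).add ((h0.pow 2).const_mul (c / 2))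
  rw [h.deriv]
  ring

@[simp]
theorem jetX_quadraticGraph : jetX (quadraticGraph p a b k c) (p.1, p.2.1) = b := by
  rw [jetX, deriv_quadraticGraph]
  simp

@[simp]
theorem jetXX_quadraticGraph : jetXX (quadraticGraph p a b k c) (p.1, p.2.1) = c := by
  rw [jetXX, deriv_quadraticGraph]
  have h : HasDerivAt (fun x : ℝ => b + c * (x - p.2.1)) (c * 1) p.2.1 :=
    (((hasDerivAt_id p.2.1).sub_const p.2.1).const_mul c).const_add b
  rw [h.deriv, mul_one]

theorem hasFDerivAt_quadraticGraph_prod :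
    HasFDerivAt (fun r : ℝ × ℝ => (r.1, r.2, quadraticGraph p a b k c r))
      ((ContinuousLinearMap.fst ℝ ℝ ℝ).prod ((ContinuousLinearMap.snd ℝ ℝ ℝ).prod
        (a • ContinuousLinearMap.fst ℝ ℝ ℝ + b • ContinuousLinearMap.snd ℝ ℝ ℝ)))
      (p.1, p.2.1) := by
  refine hasFDerivAt_fst.prodMk (hasFDerivAt_snd.prodMk ?_)
  have h := (((contDiff_quadraticGraph p a b k c (n := ∞)).contDiffAt
    (x := (p.1, p.2.1))).differentiableAt (by simp)).hasFDerivAt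
  convert h using 1
  ext <;> simp [fderiv_apply_eq_jets (contDiff_quadraticGraph p a b k c).contDiffAt]

end QuadraticGraph

theorem fderiv_fderiv_eq_jetXX {v : ℝ × ℝ → ℝ} {q : ℝ × ℝ} (hv : ContDiffAt ℝ ∞ v q) :
    fderiv ℝ (fderiv ℝ v) q (0, 1) (0, 1) = jetXX v q := by
  have h := (deriv_deriv_comp_curve (S := v) (γ := fun x => (q.1, x))
    (γ' := fun _ => ((0 : ℝ), (1 : ℝ))) (γ'' := 0) (τ := q.2) hv
    (Eventually.of_forall fun x => (hasDerivAt_const x q.1).prodMk (hasDerivAt_id x))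
    (hasDerivAt_const _ _)).2
  rw [map_zero, add_zero] at h
  exact h.symm

/-! ### Image jets: the dependence of the new `t` and `x` on the old variables. -/

/-- The projection `(t, x, u) ↦ (t, x)`. -/
def baseProj : ℝ × ℝ × ℝ →L[ℝ] ℝ × ℝ :=
  (ContinuousLinearMap.fst ℝ ℝ (ℝ × ℝ)).prod
    ((ContinuousLinearMap.fst ℝ ℝ ℝ).comp (ContinuousLinearMap.snd ℝ ℝ (ℝ × ℝ)))

@[simp]
theorem baseProj_apply (p : ℝ × ℝ × ℝ) : baseProj p = (p.1, p.2.1) := rfl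

namespace RDEquation

/-- The 2-jet of the image of the graph of a solution under a transformation: its first
derivatives are `ℓ` and its second derivative with respect to the new `x` is `w`. -/
theorem exists_image_jet {F : ℝ × ℝ × ℝ → ℝ × ℝ × ℝ} {E E' : RDEquation} (hm : E.m = 0)
    (hm' : E'.m = 0) (hF : IsPointTransformation F E E') (hTr : Transforms F E E')
    {p : ℝ × ℝ × ℝ} (hp : p ∈ E.dom) {a b c : ℝ} (k : ℝ)
    (hsol : E.f p.2.1 * a = Real.exp (E.n * p.2.2) * (E.g p.2.1 * (c + E.n * b ^ 2) +
      deriv E.g p.2.1 * b) + E.h p.2.1)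
    (hJ : ∀ e : ℝ × ℝ, baseProj (fderiv ℝ F p (e.1, e.2, a * e.1 + b * e.2)) = 0 → e = 0) :
    ∃ (ℓ : ℝ × ℝ →L[ℝ] ℝ) (w : ℝ),
      (∀ e : ℝ × ℝ, ℓ (baseProj (fderiv ℝ F p (e.1, e.2, a * e.1 + b * e.2))) =
        (fderiv ℝ F p (e.1, e.2, a * e.1 + b * e.2)).2.2) ∧
      E'.f (F p).2.1 * ℓ (1, 0) = Real.exp (E'.n * (F p).2.2) *
        (E'.g (F p).2.1 * (w + E'.n * ℓ (0, 1) ^ 2) + deriv E'.g (F p).2.1 * ℓ (0, 1)) +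
          E'.h (F p).2.1 ∧
      ∀ e : ℝ × ℝ, baseProj (fderiv ℝ F p (e.1, e.2, a * e.1 + b * e.2)) = (0, 1) →
        w + ℓ (baseProj (fderiv ℝ (fderiv ℝ F) p (e.1, e.2, a * e.1 + b * e.2)
            (e.1, e.2, a * e.1 + b * e.2) + fderiv ℝ F p (0, 0, k * e.1 ^ 2 + c * e.2 ^ 2))) =
          (fderiv ℝ (fderiv ℝ F) p (e.1, e.2, a * e.1 + b * e.2)
            (e.1, e.2, a * e.1 + b * e.2) + fderiv ℝ F p (0, 0, k * e.1 ^ 2 + c * e.2 ^ 2)).2.2 := by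
  obtain ⟨hFs, hFb, -⟩ := hF
  have hFp : ContDiffAt ℝ ∞ F p := hFs.contDiffAt (E.isOpen_dom.mem_nhds hp)
  have hFd : HasFDerivAt F (fderiv ℝ F p) p := (hFp.differentiableAt (by simp)).hasFDerivAt
  set u := quadraticGraph p a b k c with hu
  have hus : ContDiff ℝ ∞ u := contDiff_quadraticGraph p a b k c
  have hup : ((p.1, p.2.1, u (p.1, p.2.1)) : ℝ × ℝ × ℝ) = p := by simp [hu]
  have hFd' : HasFDerivAt F (fderiv ℝ F p) (p.1, p.2.1, u (p.1, p.2.1)) := by rwa [hup]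
  have hgr := hasFDerivAt_quadraticGraph_prod p a b k c
  have hFu := HasFDerivAt.comp (p.1, p.2.1) hFd' hgr
  have hFus : ContDiffAt ℝ ∞ (fun r : ℝ × ℝ => F (r.1, r.2, u r)) (p.1, p.2.1) := by
    refine ContDiffAt.comp (g := F) (f := fun r : ℝ × ℝ => (r.1, r.2, u r)) _ ?_ ?_
    · rwa [hup]
    · exact (contDiff_fst.prodMk (contDiff_snd.prodMk hus)).contDiffAt
  have hAd := baseProj.hasFDerivAt.comp (p.1, p.2.1) hFu
  have hAs : ContDiffAt ℝ ∞ (fun r : ℝ × ℝ => baseProj (F (r.1, r.2, u r))) (p.1, p.2.1) :=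
    baseProj.contDiff.contDiffAt.comp _ hFus
  have hAe : ∀ e, fderiv ℝ (fun r : ℝ × ℝ => baseProj (F (r.1, r.2, u r))) (p.1, p.2.1) e =
      baseProj (fderiv ℝ F p (e.1, e.2, a * e.1 + b * e.2)) := by
    intro e
    exact congrArg (fun L : ℝ × ℝ →L[ℝ] ℝ × ℝ => L e) hAd.fderiv
  have hinj : Function.Injective
      (fderiv ℝ (fun r : ℝ × ℝ => baseProj (F (r.1, r.2, u r))) (p.1, p.2.1)) := by
    refine (injective_iff_map_eq_zero _).2 fun e he => hJ e ?_
    rw [← hAe, he]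
  -- By `hJ`, the map from the old base to the new base along the graph of `u` is a local
  -- diffeomorphism, so the image of this graph is locally the graph of a smooth `v`.
  obtain ⟨v, hv, hvA⟩ := hAs.exists_graph (B := fun r : ℝ × ℝ => (F (r.1, r.2, u r)).2.2) hinj
    (contDiff_snd.snd.contDiffAt.comp _ hFus)
  simp only [hup] at hv
  have hvp : v (baseProj (F p)) = (F p).2.2 := by
    have := hvA.self_of_nhds
    simpa only [hup] using this
  refine ⟨fderiv ℝ v (baseProj (F p)), jetXX v (baseProj (F p)), ?_, ?_, ?_⟩
  · intro e
    have h1 : HasFDerivAt v (fderiv ℝ v (baseProj (F p)))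
        (baseProj (F (p.1, p.2.1, u (p.1, p.2.1)))) := by
      rw [hup]
      exact (hv.differentiableAt (by simp)).hasFDerivAt
    have h2 := HasFDerivAt.comp (p.1, p.2.1) h1 hAd
    have h3 := (hasFDerivAt_snd (𝕜 := ℝ) (E := ℝ) (F := ℝ × ℝ)
      (p := F (p.1, p.2.1, u (p.1, p.2.1)))).snd.comp (p.1, p.2.1) hFu
    have h4 := (h3.congr_of_eventuallyEq hvA).unique h2
    exact (congrArg (fun L : ℝ × ℝ →L[ℝ] ℝ => L e) h4).symm
  · have h1 : E.SatisfiedAt u (p.1, p.2.1) ↔ E'.SatisfiedAt v (baseProj (F p)) :=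
      hTr p hp u v hus.contDiffAt hv (by simp [hu]) hvA
    have hFx : (F p).2.1 ∈ E'.xRange := ⟨F p, hFb.mapsTo hp, rfl⟩
    rw [E.satisfiedAt_iff ⟨p, hp, rfl⟩ hm hus.contDiffAt, E'.satisfiedAt_iff hFx hm' hv] at h1
    simp only [hu, jetT_quadraticGraph, jetX_quadraticGraph, jetXX_quadraticGraph,
      quadraticGraph_self] at h1
    have h2 := h1.1 hsol
    rw [fderiv_apply_eq_jets hv, fderiv_apply_eq_jets hv]
    simp only [baseProj_apply] at hvp ⊢
    simpa [hvp] using h2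
  · intro e he
    set ε : ℝ × ℝ × ℝ := (e.1, e.2, a * e.1 + b * e.2) with hε
    set κ := k * e.1 ^ 2 + c * e.2 ^ 2 with hκ
    -- The curve in the graph of `u` over the straight line in direction `e`; it is exactly a
    -- parabola, since `u` has no mixed quadratic term.
    set γ : ℝ → ℝ × ℝ × ℝ := fun τ => (p.1 + τ * e.1, p.2.1 + τ * e.2,
      p.2.2 + τ * (a * e.1 + b * e.2) + κ / 2 * τ ^ 2) with hγ
    have hγ0 : γ 0 = p := by simp [hγ]
    have hγd : ∀ τ, HasDerivAt γ (e.1, e.2, a * e.1 + b * e.2 + κ * τ) τ := by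
      intro τ
      have h0 := hasDerivAt_id τ
      have h1 := (h0.mul_const e.1).const_add p.1
      have h2 := (h0.mul_const e.2).const_add p.2.1
      have h3 := ((h0.mul_const (a * e.1 + b * e.2)).const_add p.2.2).add
        ((h0.pow 2).const_mul (κ / 2))
      refine (h1.prodMk (h2.prodMk h3)).congr_deriv ?_
      refine Prod.ext ?_ (Prod.ext ?_ ?_) <;> simp
      ring
    have hγdd : HasDerivAt (fun τ : ℝ => (e.1, e.2, a * e.1 + b * e.2 + κ * τ))
        ((0, 0, κ) : ℝ × ℝ × ℝ) 0 := by
      refine (hasDerivAt_const _ _).prodMk ((hasDerivAt_const _ _).prodMk ?_)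
      simpa using ((hasDerivAt_id (0 : ℝ)).const_mul κ).const_add (a * e.1 + b * e.2)
    have hG := deriv_deriv_comp_curve (S := F) (γ := γ) (τ := 0) (by rwa [hγ0])
      (Eventually.of_forall hγd) hγdd
    simp only [hγ0, mul_zero, add_zero] at hG
    have hGs : ContDiffAt ℝ ∞ (fun s => F (γ s)) 0 := by
      refine ContDiffAt.comp (g := F) _ (by rwa [hγ0]) ?_
      simp only [hγ]
      fun_prop
    set G := fun s => F (γ s) with hGdef
    have hG0 : G 0 = F p := by simp [hGdef, hγ0]
    have hGd : ∀ᶠ s in 𝓝 0, HasDerivAt G (deriv G s) s := by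
      filter_upwards [hGs.eventually_infty] with s hs using hs.hasDerivAt
    have hGdd : HasDerivAt (deriv G) (deriv (deriv G) 0) 0 := by
      have h : ContDiffAt ℝ (∞ : WithTop ℕ∞) (fderiv ℝ G) 0 := hGs.fderiv_right (by simp)
      have h' : ContDiffAt ℝ (∞ : WithTop ℕ∞) (deriv G) 0 := h.clm_apply contDiffAt_const
      exact (h'.differentiableAt (by simp)).hasDerivAt
    have hy := deriv_deriv_comp_curve (S := v) (γ := fun s => baseProj (G s))
      (γ' := fun s => baseProj (deriv G s)) (τ := 0) (by simp only [hG0]; exact hv)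
      (by
        filter_upwards [hGd] with s hs using baseProj.hasFDerivAt.comp_hasDerivAt s hs)
      (baseProj.hasFDerivAt.comp_hasDerivAt 0 hGdd)
    have hline : ∀ᶠ s in 𝓝 (0 : ℝ), v (baseProj (G s)) = (G s).2.2 := by
      have hc : ContinuousAt (fun s : ℝ => (p.1 + s * e.1, p.2.1 + s * e.2)) 0 := by fun_prop
      have h0 : (p.1 + 0 * e.1, p.2.1 + 0 * e.2) = (p.1, p.2.1) := by simp
      have h1 := hc.eventually (h0 ▸ hvA)
      filter_upwards [h1] with s hs
      have h2 : γ s = (p.1 + s * e.1, p.2.1 + s * e.2, u (p.1 + s * e.1, p.2.1 + s * e.2)) := by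
        simp only [hγ, hu, quadraticGraph, hκ]
        ext <;> simp
        ring
      rw [hGdef]
      simp only
      rw [h2]
      exact hs
    have hder : ∀ᶠ s in 𝓝 (0 : ℝ), HasDerivAt (fun s => (G s).2.2) (deriv G s).2.2 s := by
      filter_upwards [hGd] with s hs using hs.snd.snd
    -- Differentiating the relation `hline` twice at `0` gives the claim: the image curve has base
    -- velocity `(0, 1)`, so the Hessian of `v` contributes only `v_xx = w`.
    have h2 : deriv (fun s => v (baseProj (G s))) =ᶠ[𝓝 0] fun s => (deriv G s).2.2 := by
      filter_upwards [hline.eventually_nhds, hder] with s hs hs'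
      rw [EventuallyEq.deriv_eq hs, hs'.deriv]
    have h3 := hy.2
    have h4 : HasDerivAt (fun s => (deriv G s).2.2) (deriv (deriv G) 0).2.2 0 := hGdd.snd.snd
    rw [h2.deriv_eq, h4.deriv, hG.1.deriv, hG0, he, fderiv_fderiv_eq_jetXX hv, hG.2] at h3
    exact h3.symm

end RDEquation

theorem injective_fderiv_of_isPointTransformation {F : ℝ × ℝ × ℝ → ℝ × ℝ × ℝ}
    {E E' : RDEquation} (hF : E.IsPointTransformation F E') {p : ℝ × ℝ × ℝ} (hp : p ∈ E.dom) :
    Function.Injective (fderiv ℝ F p) :=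
  (ContinuousLinearMap.det_ne_zero_iff_injective _).1 (hF.2.2 p hp)

/-- A linear map into the plane has linearly independent components on some graph. -/
theorem exists_injective_on_graph {L : ℝ × ℝ × ℝ →L[ℝ] ℝ × ℝ × ℝ} (hL : Function.Injective L)
    (h : ∀ a b : ℝ, (∀ e : ℝ × ℝ, baseProj (L (e.1, e.2, a * e.1 + b * e.2)) = 0 → e = 0) →
      (L (0, 1, b)).1 = 0) :
    (L (0, 1, 0)).1 = 0 ∧ (L (0, 0, 1)).1 = 0 := by
  have hlin : ∀ x y z : ℝ, L (x, y, z) = x • L (1, 0, 0) + y • L (0, 1, 0) + z • L (0, 0, 1) := by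
    intro x y z
    rw [← map_smul, ← map_smul, ← map_smul, ← map_add, ← map_add]
    simp
  have hsurj : Function.Surjective L :=
    (LinearMap.injective_iff_surjective (f := (L : ℝ × ℝ × ℝ →ₗ[ℝ] ℝ × ℝ × ℝ))).1 hL
  obtain ⟨w₁, hw₁⟩ := hsurj (1, 0, 0)
  obtain ⟨w₂, hw₂⟩ := hsurj (0, 1, 0)
  have hw₁' : w₁ = (w₁.1, w₁.2.1, w₁.2.2) := rfl
  have hw₂' : w₂ = (w₂.1, w₂.2.1, w₂.2.2) := rfl
  rw [hw₁', hlin] at hw₁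
  rw [hw₂', hlin] at hw₂
  set Tt := (L (1, 0, 0)).1 with hTt
  set Tx := (L (0, 1, 0)).1 with hTx
  set Tu := (L (0, 0, 1)).1 with hTu
  set Xt := (L (1, 0, 0)).2.1 with hXt
  set Xx := (L (0, 1, 0)).2.1 with hXx
  set Xu := (L (0, 0, 1)).2.1 with hXu
  have e1 := congrArg (fun z : ℝ × ℝ × ℝ => z.1) hw₁
  have e2 := congrArg (fun z : ℝ × ℝ × ℝ => z.2.1) hw₁
  have e3 := congrArg (fun z : ℝ × ℝ × ℝ => z.1) hw₂
  have e4 := congrArg (fun z : ℝ × ℝ × ℝ => z.2.1) hw₂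
  simp only [Prod.fst_add, Prod.smul_fst, Prod.snd_add, Prod.smul_snd, smul_eq_mul,
    ← hTt, ← hTx, ← hTu, ← hXt, ← hXx, ← hXu] at e1 e2 e3 e4
  -- Surjectivity makes the `T` and `X` rows of `L` independent; the linear combination is the
  -- Cauchy–Binet expansion of the determinant of these rows paired with `w₁` and `w₂`.
  have hminor : ¬ (Tt * Xx - Tx * Xt = 0 ∧ Tu * Xx - Tx * Xu = 0 ∧ Tt * Xu - Tu * Xt = 0) := by
    rintro ⟨m1, m2, m3⟩
    have : (1 : ℝ) = 0 := by
      linear_combination (-1 : ℝ) * e4 - (w₂.1 * Xt + w₂.2.1 * Xx + w₂.2.2 * Xu) * e1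
        + (w₂.1 * Tt + w₂.2.1 * Tx + w₂.2.2 * Tu) * e2
        + (w₁.1 * w₂.2.1 - w₁.2.1 * w₂.1) * m1 + (w₁.2.2 * w₂.2.1 - w₁.2.1 * w₂.2.2) * m2
        + (w₁.1 * w₂.2.2 - w₁.2.2 * w₂.1) * m3
    exact one_ne_zero this
  -- The Jacobian of the base map along a graph with slopes `(a, b)` is affine in them, with the
  -- three minors as coefficients; the bilinear term cancels.
  have key : ∀ a b : ℝ, (Tt * Xx - Tx * Xt) + a * (Tu * Xx - Tx * Xu) +
      b * (Tt * Xu - Tu * Xt) ≠ 0 → Tx + b * Tu = 0 := by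
    intro a b hab
    have h1 := h a b ?_
    · rw [hlin] at h1
      simpa [← hTx, ← hTu] using h1
    · intro e he
      rw [hlin, baseProj_apply] at he
      have f1 := congrArg Prod.fst he
      have f2 := congrArg Prod.snd he
      simp only [Prod.fst_add, Prod.smul_fst, Prod.snd_add, Prod.smul_snd, smul_eq_mul,
        ← hTt, ← hTx, ← hTu, ← hXt, ← hXx, ← hXu, Prod.fst_zero, Prod.snd_zero] at f1 f2
      have g1 : ((Tt * Xx - Tx * Xt) + a * (Tu * Xx - Tx * Xu) + b * (Tt * Xu - Tu * Xt)) * e.1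
          = 0 := by
        linear_combination (Xx + b * Xu) * f1 - (Tx + b * Tu) * f2
      have g2 : ((Tt * Xx - Tx * Xt) + a * (Tu * Xx - Tx * Xu) + b * (Tt * Xu - Tu * Xt)) * e.2
          = 0 := by
        linear_combination (Tt + a * Tu) * f2 - (Xt + a * Xu) * f1
      exact Prod.ext ((mul_eq_zero.1 g1).resolve_left hab) ((mul_eq_zero.1 g2).resolve_left hab)
  -- Two distinct slopes `b` suffice to separate `Tx` from `Tu`. The parameters are chosen so that
  -- the Jacobian is a nonzero number such as `1` or `2`.
  have two : ∃ b₁ b₂ : ℝ, b₁ ≠ b₂ ∧ Tx + b₁ * Tu = 0 ∧ Tx + b₂ * Tu = 0 := by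
    by_cases m2 : Tu * Xx - Tx * Xu = 0
    · by_cases m3 : Tt * Xu - Tu * Xt = 0
      · have m1 : Tt * Xx - Tx * Xt ≠ 0 := fun m1 => hminor ⟨m1, m2, m3⟩
        exact ⟨0, 1, zero_ne_one, key 0 0 (by simpa using m1), key 0 1 (by simpa [m3] using m1)⟩
      · refine ⟨(1 - (Tt * Xx - Tx * Xt)) / (Tt * Xu - Tu * Xt),
          (2 - (Tt * Xx - Tx * Xt)) / (Tt * Xu - Tu * Xt), ?_, key 0 _ ?_, key 0 _ ?_⟩
        · intro hb
          have := (div_left_inj' m3).1 hb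
          linarith
        · rw [div_mul_cancel₀ _ m3]
          norm_num
        · rw [div_mul_cancel₀ _ m3]
          norm_num
    · have hb : ∀ b : ℝ, Tx + b * Tu = 0 := by
        intro b
        refine key ((1 - (Tt * Xx - Tx * Xt) - b * (Tt * Xu - Tu * Xt)) /
          (Tu * Xx - Tx * Xu)) b ?_
        rw [div_mul_cancel₀ _ m2]
        ring_nf
        norm_num
      exact ⟨0, 1, zero_ne_one, hb 0, hb 1⟩
  obtain ⟨b₁, b₂, hb, h1, h2⟩ := two
  have hu : Tu = 0 := by
    have : (b₁ - b₂) * Tu = 0 := by linear_combination h1 - h2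
    exact (mul_eq_zero.1 this).resolve_left (sub_ne_zero.2 hb)
  refine ⟨?_, hu⟩
  rw [hu] at h1
  simpa using h1

namespace RDEquation

variable {F : ℝ × ℝ × ℝ → ℝ × ℝ × ℝ} {E E' : RDEquation}

/-- The new time does not depend on `x` and `u`. -/
theorem fderiv_time_eq_zero (hm : E.m = 0)
    (hm' : E'.m = 0) (hF : IsPointTransformation F E E') (hTr : Transforms F E E')
    {p : ℝ × ℝ × ℝ} (hp : p ∈ E.dom) :
    (fderiv ℝ F p (0, 1, 0)).1 = 0 ∧ (fderiv ℝ F p (0, 0, 1)).1 = 0 := by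
  have hL := injective_fderiv_of_isPointTransformation hF hp
  refine exists_injective_on_graph hL fun a b hJ => ?_
  have hx : p.2.1 ∈ E.xRange := ⟨p, hp, rfl⟩
  have hx' : (F p).2.1 ∈ E'.xRange := ⟨F p, hF.2.1.mapsTo hp, rfl⟩
  have hg : E.g p.2.1 ≠ 0 := E.g_ne_zero _ hx
  have hg' : E'.g (F p).2.1 ≠ 0 := E'.g_ne_zero _ hx'
  obtain ⟨c, hc⟩ : ∃ c, E.f p.2.1 * a = Real.exp (E.n * p.2.2) *
      (E.g p.2.1 * (c + E.n * b ^ 2) + deriv E.g p.2.1 * b) + E.h p.2.1 := by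
    refine ⟨((E.f p.2.1 * a - E.h p.2.1) / Real.exp (E.n * p.2.2) - deriv E.g p.2.1 * b) /
      E.g p.2.1 - E.n * b ^ 2, ?_⟩
    have := (Real.exp_pos (E.n * p.2.2)).ne'
    field_simp
    ring
  -- Two jets that differ only in `u_tt`. The 1-jets of their images coincide, and the new equation
  -- then forces `w₀ = w₁`.
  obtain ⟨ℓ₀, w₀, hℓ₀, hE₀, hw₀⟩ := exists_image_jet hm hm' hF hTr hp 0 hc hJ
  obtain ⟨ℓ₁, w₁, hℓ₁, hE₁, hw₁⟩ := exists_image_jet hm hm' hF hTr hp 1 hc hJ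
  let ι : ℝ × ℝ →L[ℝ] ℝ × ℝ × ℝ := (ContinuousLinearMap.fst ℝ ℝ ℝ).prod
    ((ContinuousLinearMap.snd ℝ ℝ ℝ).prod
        (a • ContinuousLinearMap.fst ℝ ℝ ℝ + b • ContinuousLinearMap.snd ℝ ℝ ℝ))
  have hι : ∀ e, ι e = (e.1, e.2, a * e.1 + b * e.2) := fun e => by simp [ι]
  let M : ℝ × ℝ →L[ℝ] ℝ × ℝ := baseProj.comp ((fderiv ℝ F p).comp ι)
  have hM : ∀ e, M e = baseProj (fderiv ℝ F p (e.1, e.2, a * e.1 + b * e.2)) := fun e => by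
    rw [← hι]; rfl
  have hMinj : Function.Injective M :=
    (injective_iff_map_eq_zero M).2 fun e he => hJ e (by rw [← hM, he])
  have hMsurj : Function.Surjective M :=
    (LinearMap.injective_iff_surjective (f := (M : ℝ × ℝ →ₗ[ℝ] ℝ × ℝ))).1 hMinj
  have hℓ : ℓ₁ = ℓ₀ := by
    refine ContinuousLinearMap.ext fun y => ?_
    obtain ⟨e, rfl⟩ := hMsurj y
    rw [hM, hℓ₀, hℓ₁]
  subst hℓ
  have hw : w₀ = w₁ := by
    have h1 := hE₀.symm.trans hE₁
    have h2 := (Real.exp_pos (E'.n * (F p).2.2)).ne'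
    have h3 : Real.exp (E'.n * (F p).2.2) * E'.g (F p).2.1 * (w₀ - w₁) = 0 := by
      linear_combination h1
    exact sub_eq_zero.1 ((mul_eq_zero.1 h3).resolve_left (mul_ne_zero h2 hg'))
  subst hw
  obtain ⟨e, he⟩ := hMsurj (0, 1)
  rw [hM] at he
  have h0 := hw₀ e he
  have h1 := hw₁ e he
  have hsm : ∀ κ : ℝ, fderiv ℝ F p (0, 0, κ) = κ • fderiv ℝ F p (0, 0, 1) := by
    intro κ
    rw [← map_smul]
    simp
  rw [hsm] at h0 h1
  simp only [map_add, map_smul, Prod.snd_add, Prod.smul_snd, smul_eq_mul] at h0 h1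
  -- The effect of `u_tt` on the image jet must vanish. Either `e` has no `t`-component, so the
  -- `x`-direction of the graph keeps the new time fixed, or the image of the `u`-direction is
  -- tangent to the image graph, which contradicts injectivity.
  have h2 : e.1 ^ 2 * (ℓ₁ (baseProj (fderiv ℝ F p (0, 0, 1))) -
      (fderiv ℝ F p (0, 0, 1)).2.2) = 0 := by
    linear_combination h1 - h0
  rcases mul_eq_zero.1 h2 with h3 | h3
  · have he1 : e.1 = 0 := pow_eq_zero_iff (two_ne_zero) |>.1 h3
    have he' : ((e.1, e.2, a * e.1 + b * e.2) : ℝ × ℝ × ℝ) = e.2 • (0, 1, b) := by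
      simp [he1, mul_comm]
    rw [he', map_smul] at he
    have h4 := congrArg Prod.fst he
    have h5 := congrArg Prod.snd he
    simp only [baseProj_apply, Prod.smul_fst, Prod.smul_snd, smul_eq_mul] at h4 h5
    rcases mul_eq_zero.1 h4 with h6 | h6
    · rw [h6, zero_mul] at h5
      exact absurd h5 zero_ne_one
    · exact h6
  · exfalso
    obtain ⟨d, hd⟩ := hMsurj (baseProj (fderiv ℝ F p (0, 0, 1)))
    rw [hM] at hd
    have h4 : fderiv ℝ F p (d.1, d.2, a * d.1 + b * d.2) = fderiv ℝ F p (0, 0, 1) := by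
      have h5 := hℓ₁ d
      rw [hd, sub_eq_zero.1 h3] at h5
      simp only [baseProj_apply, Prod.mk.injEq] at hd
      exact Prod.ext hd.1 (Prod.ext hd.2 h5.symm)
    have h5 := hL h4
    simp only [Prod.mk.injEq] at h5
    obtain ⟨h6, h7, h8⟩ := h5
    simp [h6, h7] at h8

/-- The new space variable does not depend on `u`, and the coefficients of `u_xx` agree. -/
theorem fderiv_space_eq_zero (hm : E.m = 0)
    (hm' : E'.m = 0) (hF : IsPointTransformation F E E') (hTr : Transforms F E E')
    {p : ℝ × ℝ × ℝ} (hp : p ∈ E.dom) :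
    (fderiv ℝ F p (0, 0, 1)).2.1 = 0 ∧
    E'.f (F p).2.1 * Real.exp (E.n * p.2.2) * E.g p.2.1 * (fderiv ℝ F p (0, 1, 0)).2.1 ^ 2 =
      E.f p.2.1 * (fderiv ℝ F p (1, 0, 0)).1 * Real.exp (E'.n * (F p).2.2) * E'.g (F p).2.1 := by
  have hL := injective_fderiv_of_isPointTransformation hF hp
  have hFp : ContDiffAt ℝ ∞ F p := hF.1.contDiffAt (E.isOpen_dom.mem_nhds hp)
  have hx : p.2.1 ∈ E.xRange := ⟨p, hp, rfl⟩
  have hx' : (F p).2.1 ∈ E'.xRange := ⟨F p, hF.2.1.mapsTo hp, rfl⟩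
  have hg : E.g p.2.1 ≠ 0 := E.g_ne_zero _ hx
  have hf : E.f p.2.1 ≠ 0 := E.f_ne_zero _ hx
  have hg' : E'.g (F p).2.1 ≠ 0 := E'.g_ne_zero _ hx'
  have hf' : E'.f (F p).2.1 ≠ 0 := E'.f_ne_zero _ hx'
  have hlin : ∀ (q : ℝ × ℝ × ℝ) (x y z : ℝ), fderiv ℝ F q (x, y, z) = x • fderiv ℝ F q (1, 0, 0) +
      y • fderiv ℝ F q (0, 1, 0) + z • fderiv ℝ F q (0, 0, 1) := by
    intro q x y z
    rw [← map_smul, ← map_smul, ← map_smul, ← map_add, ← map_add]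
    simp
  obtain ⟨hTx, hTu⟩ := fderiv_time_eq_zero hm hm' hF hTr hp
  -- the second derivatives of the new time in the directions of `x` and `u` vanish
  have hQ : ∀ e : ℝ × ℝ × ℝ, e.1 = 0 → (fderiv ℝ (fderiv ℝ F) p e e).1 = 0 := by
    intro e he
    have h1 : (fun q => (fderiv ℝ F q e).1) =ᶠ[𝓝 p] fun _ => 0 := by
      filter_upwards [E.isOpen_dom.mem_nhds hp] with q hq
      obtain ⟨h1, h2⟩ := fderiv_time_eq_zero hm hm' hF hTr hq
      have : e = (e.1, e.2.1, e.2.2) := rfl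
      rw [this, hlin, he]
      simp [h1, h2]
    have h2 : ContDiffAt ℝ (∞ : WithTop ℕ∞) (fderiv ℝ F) p := hFp.fderiv_right (by simp)
    have h3 := ((h2.differentiableAt (by simp)).hasFDerivAt.clm_apply (hasFDerivAt_const e p)).fst
    have h4 := h3.unique ((hasFDerivAt_const (0 : ℝ) p).congr_of_eventuallyEq h1)
    simpa using congrArg (fun M : ℝ × ℝ × ℝ →L[ℝ] ℝ => M e) h4
  have hTt : (fderiv ℝ F p (1, 0, 0)).1 ≠ 0 := by
    intro h0
    have hsurj : Function.Surjective (fderiv ℝ F p) :=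
      (LinearMap.injective_iff_surjective
        (f := (fderiv ℝ F p : ℝ × ℝ × ℝ →ₗ[ℝ] ℝ × ℝ × ℝ))).1 hL
    obtain ⟨w, hw⟩ := hsurj (1, 0, 0)
    have hw' : w = (w.1, w.2.1, w.2.2) := rfl
    rw [hw', hlin] at hw
    have := congrArg Prod.fst hw
    simp [h0, hTx, hTu] at this
  set Tt := (fderiv ℝ F p (1, 0, 0)).1 with hTt'
  set Xx := (fderiv ℝ F p (0, 1, 0)).2.1 with hXx
  set Xu := (fderiv ℝ F p (0, 0, 1)).2.1 with hXu
  set Uu := (fderiv ℝ F p (0, 0, 1)).2.2 with hUu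
  set Xt := (fderiv ℝ F p (1, 0, 0)).2.1 with hXt
  -- With `T_x = T_u = 0`, the graph of slope `b` has a graph as its image once `X_x + b X_u ≠ 0`,
  -- whatever `a` is. So `c = u_xx` can be varied freely, with `a = u_t` adjusted to solve the old
  -- equation.
  have key : ∀ b : ℝ, Xx + b * Xu ≠ 0 → E'.f (F p).2.1 * Real.exp (E.n * p.2.2) * E.g p.2.1 *
      (Xx + b * Xu) ^ 2 =
      E.f p.2.1 * Tt * Real.exp (E'.n * (F p).2.2) * E'.g (F p).2.1 := by
    intro b hD
    have hJ : ∀ a : ℝ, ∀ e : ℝ × ℝ,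
        baseProj (fderiv ℝ F p (e.1, e.2, a * e.1 + b * e.2)) = 0 → e = 0 := by
      intro a e he
      rw [hlin, baseProj_apply] at he
      have f1 := congrArg Prod.fst he
      have f2 := congrArg Prod.snd he
      simp only [Prod.fst_add, Prod.smul_fst, Prod.snd_add, Prod.smul_snd, smul_eq_mul, hTx, hTu,
        ← hTt', ← hXx, ← hXu, ← hXt, Prod.fst_zero, Prod.snd_zero, mul_zero, add_zero] at f1 f2
      have g1 : e.1 = 0 := (mul_eq_zero.1 f1).resolve_right hTt
      have g2 : e.2 * (Xx + b * Xu) = 0 := by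
        rw [g1] at f2
        linear_combination f2
      exact Prod.ext g1 ((mul_eq_zero.1 g2).resolve_right hD)
    have jet : ∀ c : ℝ, ∃ a P V w : ℝ,
        E.f p.2.1 * a = Real.exp (E.n * p.2.2) * (E.g p.2.1 * (c + E.n * b ^ 2) +
          deriv E.g p.2.1 * b) + E.h p.2.1 ∧
        E'.f (F p).2.1 * P = Real.exp (E'.n * (F p).2.2) *
          (E'.g (F p).2.1 * (w + E'.n * V ^ 2) + deriv E'.g (F p).2.1 * V) + E'.h (F p).2.1 ∧
        Tt * P + (Xt + a * Xu) * V = (fderiv ℝ F p (1, 0, 0)).2.2 + a * Uu ∧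
        (Xx + b * Xu) * V = (fderiv ℝ F p (0, 1, 0)).2.2 + b * Uu ∧
        (Xx + b * Xu) ^ 2 * w + ((fderiv ℝ (fderiv ℝ F) p (0, 1, b) (0, 1, b)).2.1 + c * Xu) * V =
          (fderiv ℝ (fderiv ℝ F) p (0, 1, b) (0, 1, b)).2.2 + c * Uu := by
      intro c
      obtain ⟨a, ha⟩ : ∃ a, E.f p.2.1 * a = Real.exp (E.n * p.2.2) *
          (E.g p.2.1 * (c + E.n * b ^ 2) + deriv E.g p.2.1 * b) + E.h p.2.1 :=
        ⟨_ / E.f p.2.1, mul_div_cancel₀ _ hf⟩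
      obtain ⟨ℓ, w, hℓ, hE, hw⟩ := exists_image_jet hm hm' hF hTr hp 0 ha (hJ a)
      have hℓlin : ∀ y z : ℝ, ℓ (y, z) = y * ℓ (1, 0) + z * ℓ (0, 1) := by
        intro y z
        rw [← smul_eq_mul, ← smul_eq_mul, ← map_smul, ← map_smul, ← map_add]
        simp
      refine ⟨a, ℓ (1, 0), ℓ (0, 1), w, ha, hE, ?_, ?_, ?_⟩
      · have h1 := hℓ (1, 0)
        rw [hlin, baseProj_apply, hℓlin] at h1
        simp only [Prod.fst_add, Prod.smul_fst, Prod.snd_add, Prod.smul_snd, smul_eq_mul, hTx, hTu,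
          ← hTt', ← hXx, ← hXu, ← hXt, ← hUu] at h1
        linear_combination h1
      · have h1 := hℓ (0, 1)
        rw [hlin, baseProj_apply, hℓlin] at h1
        simp only [Prod.fst_add, Prod.smul_fst, Prod.snd_add, Prod.smul_snd, smul_eq_mul, hTx, hTu,
          ← hTt', ← hXx, ← hXu, ← hXt, ← hUu] at h1
        linear_combination h1
      -- The base direction mapped to `(0, 1)` has no `t`-component, and its length is fixed by the
      -- second coordinate.
      · have h1 := hw (0, (Xx + b * Xu)⁻¹) ?_
        · have h2 : ((((0 : ℝ), (Xx + b * Xu)⁻¹) : ℝ × ℝ).1, (((0 : ℝ), (Xx + b * Xu)⁻¹) : ℝ × ℝ).2,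
              a * (((0 : ℝ), (Xx + b * Xu)⁻¹) : ℝ × ℝ).1 +
              b * (((0 : ℝ), (Xx + b * Xu)⁻¹) : ℝ × ℝ).2) =
              (Xx + b * Xu)⁻¹ • ((0 : ℝ), (1 : ℝ), b) := by
            simp [mul_comm]
          have h3 := hQ (0, 1, b) rfl
          rw [h2, hlin p 0 0] at h1
          simp only [map_smul, smul_apply, baseProj_apply] at h1
          rw [hℓlin] at h1
          simp only [Prod.fst_add, Prod.smul_fst, Prod.snd_add, Prod.smul_snd, smul_eq_mul, hTu,
            ← hXu, ← hUu, h3, zero_mul, mul_zero, add_zero, zero_add] at h1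
          field_simp at h1
          linear_combination h1
        · rw [hlin, baseProj_apply]
          refine Prod.ext ?_ ?_
          · simp [hTx, hTu]
          · simp only [Prod.snd_add, Prod.smul_snd, Prod.fst_add, Prod.smul_fst, smul_eq_mul,
              ← hXx, ← hXu]
            field_simp
            ring
    obtain ⟨a₀, P₀, V, w₀, h1, h2, h3, h4, h5⟩ := jet 0
    obtain ⟨a₁, P₁, V', w₁, h1', h2', h3', h4', h5'⟩ := jet 1
    have hV : V' = V := mul_left_cancel₀ hD (h4'.trans h4.symm)
    subst hV
    -- If this vanished, the image of the `u`-direction would be tangent to the image graph, and the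
    -- vector in `h6` would lie in the kernel of the derivative of `F`.
    have hδ : Uu - Xu * V' ≠ 0 := by
      intro h0
      have h6 : fderiv ℝ F p ((Xx + b * Xu) • (0, 0, 1) - Xu • (0, 1, b)) = 0 := by
        rw [map_sub, map_smul, map_smul, hlin p 0 1 b]
        refine Prod.ext ?_ (Prod.ext ?_ ?_)
        · simp [hTx, hTu]
        · simp only [Prod.snd_sub, Prod.snd_add, Prod.smul_snd, Prod.fst_sub, Prod.fst_add,
            Prod.smul_fst, smul_eq_mul, ← hXx, ← hXu, Prod.fst_zero, Prod.snd_zero]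
          ring
        · simp only [Prod.snd_sub, Prod.snd_add, Prod.smul_snd, smul_eq_mul, ← hUu,
            Prod.snd_zero]
          linear_combination (Xx + b * Xu) * h0 + Xu * h4
      have h7 := hL (h6.trans (map_zero _).symm)
      have h8 := congrArg (fun z : ℝ × ℝ × ℝ => z.2.1) h7
      have h9 := congrArg (fun z : ℝ × ℝ × ℝ => z.2.2) h7
      simp only [Prod.snd_sub, Prod.smul_snd, Prod.fst_sub, Prod.smul_fst, smul_eq_mul,
        Prod.fst_zero, Prod.snd_zero] at h8 h9
      have h10 : Xu = 0 := by linear_combination -h8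
      refine hD ?_
      linear_combination h9 + b * h10
    -- Differences of the two jets isolate the coefficients of `u_xx`; all lower-order terms cancel.
    have r1 : E.f p.2.1 * (a₁ - a₀) = Real.exp (E.n * p.2.2) * E.g p.2.1 := by
      linear_combination h1' - h1
    have r2 : E'.f (F p).2.1 * (P₁ - P₀) =
        Real.exp (E'.n * (F p).2.2) * E'.g (F p).2.1 * (w₁ - w₀) := by
      linear_combination h2' - h2
    have r3 : Tt * (P₁ - P₀) = (a₁ - a₀) * (Uu - Xu * V') := by linear_combination h3' - h3
    have r4 : (Xx + b * Xu) ^ 2 * (w₁ - w₀) = Uu - Xu * V' := by linear_combination h5' - h5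
    refine mul_left_cancel₀ hδ ?_
    linear_combination (-(Uu - Xu * V') * E'.f (F p).2.1 * (Xx + b * Xu) ^ 2) * r1
      - E.f p.2.1 * E'.f (F p).2.1 * (Xx + b * Xu) ^ 2 * r3
      + E.f p.2.1 * Tt * (Xx + b * Xu) ^ 2 * r2
      + E.f p.2.1 * Tt * Real.exp (E'.n * (F p).2.2) * E'.g (F p).2.1 * r4
  -- Otherwise slopes can be chosen with `X_x + b X_u` equal to `1` and `2`; their squares differ,
  -- while the right-hand side of `key` is the same.
  have hXu0 : Xu = 0 := by
    by_contra hne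
    have k1 := key ((1 - Xx) / Xu) (by rw [div_mul_cancel₀ _ hne]; norm_num)
    have k2 := key ((2 - Xx) / Xu) (by rw [div_mul_cancel₀ _ hne]; norm_num)
    rw [div_mul_cancel₀ _ hne] at k1 k2
    have k3 : E'.f (F p).2.1 * Real.exp (E.n * p.2.2) * E.g p.2.1 = 0 := by
      linear_combination (k2 - k1) / 3
    exact mul_ne_zero (mul_ne_zero hf' (Real.exp_pos _).ne') hg k3
  refine ⟨hXu0, ?_⟩
  have hXx0 : Xx ≠ 0 := by
    intro h0
    have hsurj : Function.Surjective (fderiv ℝ F p) :=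
      (LinearMap.injective_iff_surjective
        (f := (fderiv ℝ F p : ℝ × ℝ × ℝ →ₗ[ℝ] ℝ × ℝ × ℝ))).1 hL
    obtain ⟨w, hw⟩ := hsurj (0, 1, 0)
    have hw' : w = (w.1, w.2.1, w.2.2) := rfl
    rw [hw', hlin] at hw
    have g1 := congrArg Prod.fst hw
    have g2 := congrArg (fun z : ℝ × ℝ × ℝ => z.2.1) hw
    simp only [Prod.snd_add, Prod.smul_snd, Prod.fst_add, Prod.smul_fst, smul_eq_mul, hTx, hTu,
      ← hXx, ← hXu, ← hTt', ← hXt, h0, hXu0, mul_zero, add_zero] at g1 g2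
    rw [(mul_eq_zero.1 g1).resolve_right hTt, zero_mul] at g2
    exact zero_ne_one g2
  have h := key 0 (by simpa using hXx0)
  simpa using h

end RDEquation

/-! ### Fibred form of the transformation and the determining equations. -/

namespace RDEquation

variable {F : ℝ × ℝ × ℝ → ℝ × ℝ × ℝ} {E E' : RDEquation}

theorem eventually_line_t_mem (E : RDEquation) {p : ℝ × ℝ × ℝ} (hp : p ∈ E.dom) :
    ∀ᶠ t in 𝓝 p.1, ((t, p.2.1, p.2.2) : ℝ × ℝ × ℝ) ∈ E.dom :=
  (show ContinuousAt (fun t => ((t, p.2.1, p.2.2) : ℝ × ℝ × ℝ)) p.1 by fun_prop).eventually_mem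
    (E.isOpen_dom.mem_nhds hp)

theorem eventually_line_x_mem (E : RDEquation) {p : ℝ × ℝ × ℝ} (hp : p ∈ E.dom) :
    ∀ᶠ x in 𝓝 p.2.1, ((p.1, x, p.2.2) : ℝ × ℝ × ℝ) ∈ E.dom :=
  (show ContinuousAt (fun x => ((p.1, x, p.2.2) : ℝ × ℝ × ℝ)) p.2.1 by fun_prop).eventually_mem
    (E.isOpen_dom.mem_nhds hp)

theorem isOpen_baseProj_image (E : RDEquation) : IsOpen (baseProj '' E.dom) :=
  baseProj.isOpenMap (fun y => ⟨(y.1, y.2, 0), rfl⟩) _ E.isOpen_dom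

/-- The vanishing derivatives descend to the base because sections of the domain are connected. The
form of `U` needs no further differentiation: it follows from the leading-coefficient identity by
comparing two values of `u` over the same `(t, x)`. -/
theorem exists_semifibered_form (hm : E.m = 0)
    (hm' : E'.m = 0) (hF : IsPointTransformation F E E') (hTr : Transforms F E E') :
    ∃ (T : ℝ → ℝ) (X ψ : ℝ × ℝ → ℝ), ContDiffOn ℝ ∞ T E.tRange ∧
      ContDiffOn ℝ ∞ X (baseProj '' E.dom) ∧ ContDiffOn ℝ ∞ ψ (baseProj '' E.dom) ∧
      ∀ p ∈ E.dom, F p = (T p.1, X (baseProj p), E.n / E'.n * p.2.2 + ψ (baseProj p)) ∧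
        deriv T p.1 ≠ 0 ∧ jetX X (baseProj p) ≠ 0 ∧
        (fderiv ℝ F p (1, 0, 0)).2.1 = jetT X (baseProj p) ∧
        (fderiv ℝ F p (0, 0, 1)).2.1 = 0 ∧
        E'.f (X (baseProj p)) * E.g p.2.1 * jetX X (baseProj p) ^ 2 =
          E.f p.2.1 * deriv T p.1 * Real.exp (E'.n * ψ (baseProj p)) * E'.g (X (baseProj p)) := by
  have hFs := hF.1
  have hFd : ∀ p ∈ E.dom, HasFDerivAt F (fderiv ℝ F p) p := fun p hp =>
    ((hFs.contDiffAt (E.isOpen_dom.mem_nhds hp)).differentiableAt (by simp)).hasFDerivAt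
  have hlin : ∀ (q : ℝ × ℝ × ℝ) (x y z : ℝ), fderiv ℝ F q (x, y, z) = x • fderiv ℝ F q (1, 0, 0) +
      y • fderiv ℝ F q (0, 1, 0) + z • fderiv ℝ F q (0, 0, 1) := by
    intro q x y z
    rw [← map_smul, ← map_smul, ← map_smul, ← map_add, ← map_add]
    simp
  obtain ⟨T, hTs, hT⟩ := exists_descend (S := fun p => (F p).1) E.isOpen_dom hFs.fst
    (ContinuousLinearMap.fst ℝ ℝ (ℝ × ℝ)) (ContinuousLinearMap.inl ℝ ℝ (ℝ × ℝ)) (fun _ => rfl)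
    (fun p hp q hq hpq => eq_of_preconnected_fiber E.isOpen_dom hFs.fst
      (ContinuousLinearMap.fst ℝ ℝ (ℝ × ℝ))
      (fun p hp v hv => by
        obtain ⟨h1, h2⟩ := fderiv_time_eq_zero hm hm' hF hTr hp
        have hv' : v = (v.1, v.2.1, v.2.2) := rfl
        have hv1 : v.1 = 0 := hv
        rw [(hFd p hp).fst.fderiv]
        change (fderiv ℝ F p v).1 = 0
        rw [hv', hlin, hv1]
        simp [h1, h2]) E.section_t hp hq hpq)
  obtain ⟨X, hXs, hX⟩ := exists_descend (S := fun p => (F p).2.1) E.isOpen_dom hFs.snd.fst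
    baseProj ((ContinuousLinearMap.fst ℝ ℝ ℝ).prod ((ContinuousLinearMap.snd ℝ ℝ ℝ).prod 0))
    (fun _ => rfl)
    (fun p hp q hq hpq => eq_of_preconnected_fiber E.isOpen_dom hFs.snd.fst baseProj
      (fun p hp v hv => by
        obtain ⟨h1, -⟩ := fderiv_space_eq_zero hm hm' hF hTr hp
        have hv' : v = (v.1, v.2.1, v.2.2) := rfl
        have hv1 : v.1 = 0 := congrArg Prod.fst hv
        have hv2 : v.2.1 = 0 := congrArg Prod.snd hv
        rw [(hFd p hp).snd.fst.fderiv]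
        change (fderiv ℝ F p v).2.1 = 0
        rw [hv', hlin, hv1, hv2]
        simp [h1])
      (fun w => by
        have h : {p ∈ E.dom | baseProj p = w} = {p ∈ E.dom | p.1 = w.1 ∧ p.2.1 = w.2} := by
          ext p
          simp [Prod.ext_iff]
        rw [h]
        exact E.section_tx w.1 w.2) hp hq hpq)
  simp only [ContinuousLinearMap.coe_fst'] at hT
  have hTd : ∀ p ∈ E.dom, (fderiv ℝ F p (1, 0, 0)).1 = deriv T p.1 := by
    intro p hp
    have h1 : HasDerivAt (fun t => F (t, p.2.1, p.2.2)) (fderiv ℝ F p (1, 0, 0)) p.1 :=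
      HasFDerivAt.comp_hasDerivAt (l := F) (f := fun t => (t, p.2.1, p.2.2)) p.1 (hFd p hp)
        ((hasDerivAt_id p.1).prodMk (hasDerivAt_const _ _))
    have h2 : HasDerivAt (fun t => (F (t, p.2.1, p.2.2)).1) (fderiv ℝ F p (1, 0, 0)).1 p.1 := h1.fst
    have h3 : T =ᶠ[𝓝 p.1] fun t => (F (t, p.2.1, p.2.2)).1 := by
      filter_upwards [E.eventually_line_t_mem hp] with t ht using (hT _ ht).symm
    rw [h3.deriv_eq, h2.deriv]
  have hXt : ∀ p ∈ E.dom, (fderiv ℝ F p (1, 0, 0)).2.1 = jetT X (baseProj p) := by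
    intro p hp
    have h1 : HasDerivAt (fun t => F (t, p.2.1, p.2.2)) (fderiv ℝ F p (1, 0, 0)) p.1 :=
      HasFDerivAt.comp_hasDerivAt (l := F) (f := fun t => (t, p.2.1, p.2.2)) p.1 (hFd p hp)
        ((hasDerivAt_id p.1).prodMk (hasDerivAt_const _ _))
    have h2 : HasDerivAt (fun t => (F (t, p.2.1, p.2.2)).2.1) (fderiv ℝ F p (1, 0, 0)).2.1 p.1 :=
      h1.snd.fst
    have h3 : (fun t => X (t, p.2.1)) =ᶠ[𝓝 p.1] fun t => (F (t, p.2.1, p.2.2)).2.1 := by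
      filter_upwards [E.eventually_line_t_mem hp] with t ht using (hX _ ht).symm
    exact (h3.deriv_eq.trans h2.deriv).symm
  have hXx : ∀ p ∈ E.dom, (fderiv ℝ F p (0, 1, 0)).2.1 = jetX X (baseProj p) := by
    intro p hp
    have h1 : HasDerivAt (fun x => F (p.1, x, p.2.2)) (fderiv ℝ F p (0, 1, 0)) p.2.1 :=
      HasFDerivAt.comp_hasDerivAt (l := F) (f := fun x => (p.1, x, p.2.2)) p.2.1 (hFd p hp)
        ((hasDerivAt_const _ _).prodMk ((hasDerivAt_id p.2.1).prodMk (hasDerivAt_const _ _)))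
    have h2 : HasDerivAt (fun x => (F (p.1, x, p.2.2)).2.1) (fderiv ℝ F p (0, 1, 0)).2.1 p.2.1 :=
      h1.snd.fst
    have h3 : (fun x => X (p.1, x)) =ᶠ[𝓝 p.2.1] fun x => (F (p.1, x, p.2.2)).2.1 := by
      filter_upwards [E.eventually_line_x_mem hp] with x hx using (hX _ hx).symm
    exact (h3.deriv_eq.trans h2.deriv).symm
  have hid : ∀ p ∈ E.dom, E'.f (X (baseProj p)) * Real.exp (E.n * p.2.2) * E.g p.2.1 *
      jetX X (baseProj p) ^ 2 =
      E.f p.2.1 * deriv T p.1 * Real.exp (E'.n * (F p).2.2) * E'.g (X (baseProj p)) := by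
    intro p hp
    have h := (fderiv_space_eq_zero hm hm' hF hTr hp).2
    rwa [hTd p hp, hXx p hp, hX p hp] at h
  have hsurj : ∀ p ∈ E.dom, Function.Surjective (fderiv ℝ F p) := fun p hp =>
    (LinearMap.injective_iff_surjective
      (f := (fderiv ℝ F p : ℝ × ℝ × ℝ →ₗ[ℝ] ℝ × ℝ × ℝ))).1
      (injective_fderiv_of_isPointTransformation hF hp)
  have hT0 : ∀ p ∈ E.dom, deriv T p.1 ≠ 0 := by
    intro p hp h0
    obtain ⟨h1, h2⟩ := fderiv_time_eq_zero hm hm' hF hTr hp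
    obtain ⟨w, hw⟩ := hsurj p hp (1, 0, 0)
    have hw' : w = (w.1, w.2.1, w.2.2) := rfl
    rw [hw', hlin] at hw
    have := congrArg Prod.fst hw
    simp [hTd p hp, h0, h1, h2] at this
  have hx : ∀ p ∈ E.dom, p.2.1 ∈ E.xRange := fun p hp => ⟨p, hp, rfl⟩
  have hx' : ∀ p ∈ E.dom, X (baseProj p) ∈ E'.xRange := fun p hp =>
    ⟨F p, hF.2.1.mapsTo hp, hX p hp⟩
  have hX0 : ∀ p ∈ E.dom, jetX X (baseProj p) ≠ 0 := by
    intro p hp h0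
    have h1 := hid p hp
    rw [h0] at h1
    have h2 := mul_ne_zero (mul_ne_zero (mul_ne_zero (E.f_ne_zero _ (hx p hp)) (hT0 p hp))
      (Real.exp_pos (E'.n * (F p).2.2)).ne') (E'.g_ne_zero _ (hx' p hp))
    exact h2 (by rw [← h1]; ring)
  have hn' := E'.n_ne_zero
  obtain ⟨ψ, hψs, hψ⟩ := exists_descend (S := fun p => (F p).2.2 - E.n / E'.n * p.2.2) E.isOpen_dom
    (hFs.snd.snd.sub (by fun_prop))
    baseProj ((ContinuousLinearMap.fst ℝ ℝ ℝ).prod ((ContinuousLinearMap.snd ℝ ℝ ℝ).prod 0))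
    (fun _ => rfl)
    (fun p hp q hq hpq => by
      have h1 := hid p hp
      have h2 := hid q hq
      have hx1 : q.2.1 = p.2.1 := (congrArg Prod.snd hpq).symm
      have ht1 : q.1 = p.1 := (congrArg Prod.fst hpq).symm
      rw [← hpq, hx1, ht1] at h2
      have hA : E'.f (X (baseProj p)) * E.g p.2.1 * jetX X (baseProj p) ^ 2 ≠ 0 :=
        mul_ne_zero (mul_ne_zero (E'.f_ne_zero _ (hx' p hp)) (E.g_ne_zero _ (hx p hp)))
          (pow_ne_zero 2 (hX0 p hp))
      have hB : E.f p.2.1 * deriv T p.1 * E'.g (X (baseProj p)) ≠ 0 :=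
        mul_ne_zero (mul_ne_zero (E.f_ne_zero _ (hx p hp)) (hT0 p hp)) (E'.g_ne_zero _ (hx' p hp))
      -- Over one base point the identity `hid` has the same coefficients at `p` and `q`, so
      -- crossing the two instances leaves only exponentials, and `n' U - n u` is the same at both
      -- points.
      have h3 : Real.exp (E.n * p.2.2 + E'.n * (F q).2.2) =
          Real.exp (E.n * q.2.2 + E'.n * (F p).2.2) := by
        rw [Real.exp_add, Real.exp_add]
        refine mul_left_cancel₀ (mul_ne_zero hA hB) ?_
        linear_combination
          (E.f p.2.1 * deriv T p.1 * Real.exp (E'.n * (F q).2.2) * E'.g (X (baseProj p))) * h1 -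
          (E.f p.2.1 * deriv T p.1 * Real.exp (E'.n * (F p).2.2) * E'.g (X (baseProj p))) * h2
      have h4 := Real.exp_injective h3
      field_simp
      linear_combination -h4)
  refine ⟨T, X, ψ, hTs, hXs, hψs, fun p hp => ⟨?_, hT0 p hp, hX0 p hp, hXt p hp,
    (fderiv_space_eq_zero hm hm' hF hTr hp).1, ?_⟩⟩
  · refine Prod.ext (hT p hp) (Prod.ext (hX p hp) ?_)
    have := hψ p hp
    simp only at this ⊢
    linear_combination this
  · have h1 := hid p hp
    have h2 : E'.n * (F p).2.2 = E.n * p.2.2 + E'.n * ψ (baseProj p) := by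
      rw [← hψ p hp]
      field_simp
      ring
    rw [h2, Real.exp_add] at h1
    refine mul_left_cancel₀ (Real.exp_pos (E.n * p.2.2)).ne' ?_
    linear_combination h1

/-- The transformation of the equation at a point, for the 2-jets of quadratic functions. -/
theorem jet_relation (hm : E.m = 0) (hm' : E'.m = 0) (hFb : Set.BijOn F E.dom E'.dom)
    (hTr : Transforms F E E')
    {T : ℝ → ℝ} {X ψ : ℝ × ℝ → ℝ} {δ : ℝ} (hF : ∀ p ∈ E.dom,
      F p = (T p.1, X (baseProj p), δ * p.2.2 + ψ (baseProj p)))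
    {p : ℝ × ℝ × ℝ} (hp : p ∈ E.dom)
    (hT : ContDiffAt ℝ ∞ T p.1) (hX : ContDiffAt ℝ ∞ X (baseProj p))
    (hψ : ContDiffAt ℝ ∞ ψ (baseProj p)) (hT0 : deriv T p.1 ≠ 0)
    (hX0 : jetX X (baseProj p) ≠ 0) (a b c : ℝ)
    (hsol : E.f p.2.1 * a = Real.exp (E.n * p.2.2) * (E.g p.2.1 * (c + E.n * b ^ 2) +
      deriv E.g p.2.1 * b) + E.h p.2.1) :
    ∃ P V W : ℝ, P * deriv T p.1 + V * jetT X (baseProj p) = δ * a + jetT ψ (baseProj p) ∧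
      V * jetX X (baseProj p) = δ * b + jetX ψ (baseProj p) ∧
      W * jetX X (baseProj p) ^ 2 + V * jetXX X (baseProj p) = δ * c + jetXX ψ (baseProj p) ∧
      E'.f (X (baseProj p)) * P = Real.exp (E'.n * (δ * p.2.2 + ψ (baseProj p))) *
        (E'.g (X (baseProj p)) * (W + E'.n * V ^ 2) + deriv E'.g (X (baseProj p)) * V) +
        E'.h (X (baseProj p)) := by
  set u := quadraticGraph p a b 0 c with hu
  set q := baseProj p with hq
  have hus : ContDiff ℝ ∞ u := contDiff_quadraticGraph p a b 0 c
  obtain ⟨hA, hinj⟩ := injective_fderiv_triangular (q := q) hT hX hT0 hX0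
  have hUs : ContDiffAt ℝ ∞ (fun r => δ * u r + ψ r) q :=
    (contDiffAt_const.mul hus.contDiffAt).add hψ
  obtain ⟨v, hv, hvA⟩ := hA.exists_graph hinj hUs
  obtain ⟨h1, h2, h3⟩ := jets_of_comp_eq hT hX hv hvA
  obtain ⟨hUt, hUx, hUxx⟩ := jets_const_mul_add δ (hus.contDiffAt (x := q)) hψ
  rw [hUt, hu, hq, baseProj_apply, jetT_quadraticGraph] at h1
  rw [hUx, hu, hq, baseProj_apply, jetX_quadraticGraph] at h2
  rw [hUxx, hu, hq, baseProj_apply, jetXX_quadraticGraph] at h3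
  refine ⟨jetT v (T q.1, X q), jetX v (T q.1, X q), jetXX v (T q.1, X q), h1, h2, h3, ?_⟩
  have hev : ∀ᶠ r in 𝓝 q, ((r.1, r.2, u r) : ℝ × ℝ × ℝ) ∈ E.dom := by
    have hc : ContinuousAt (fun r : ℝ × ℝ => ((r.1, r.2, u r) : ℝ × ℝ × ℝ)) q :=
      continuousAt_fst.prodMk (continuousAt_snd.prodMk hus.continuous.continuousAt)
    refine hc.eventually_mem (E.isOpen_dom.mem_nhds ?_)
    simpa [hu, hq] using hp
  have hFq : ((F p).1, (F p).2.1) = (T q.1, X q) := by rw [hF p hp]; rfl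
  have h4 : E.SatisfiedAt u q ↔ E'.SatisfiedAt v (T q.1, X q) := by
    have := hTr p hp u v hus.contDiffAt (by rw [hFq]; exact hv) (by simp [hu]) ?_
    · rwa [hFq] at this
    · filter_upwards [hvA, hev] with r hr hr'
      rw [hF _ hr']
      exact hr
  have hxr : X q ∈ E'.xRange := ⟨F p, hFb.mapsTo hp, by rw [hF p hp]⟩
  rw [E.satisfiedAt_iff ⟨p, hp, rfl⟩ hm hus.contDiffAt, E'.satisfiedAt_iff hxr hm' hv] at h4
  have hvq : v (T q.1, X q) = δ * p.2.2 + ψ q := by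
    have := hvA.self_of_nhds
    rw [this, hu, hq, baseProj_apply, quadraticGraph_self]
  rw [hvq] at h4
  refine h4.1 ?_
  simp only [hu, hq, baseProj_apply, jetT_quadraticGraph, jetX_quadraticGraph,
    jetXX_quadraticGraph, quadraticGraph_self]
  exact hsol

/-- Splitting the transformed equation with respect to `u_x` and `e^{nu}`. -/
theorem determining_equations {f g gx h f' g' gx' h' n n' δ Tt Xt Xx Xxx ψt ψx ψxx μ ε₀ ε₁ : ℝ}
    (hf : f ≠ 0) (hf' : f' ≠ 0) (hδ : δ ≠ 0) (hT : Tt ≠ 0) (hX : Xx ≠ 0) (hμ : μ ≠ 0)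
    (hε : ε₀ ≠ ε₁)
    (H : ∀ ε, (ε = ε₀ ∨ ε = ε₁) → ∀ a b : ℝ, f * a = ε * (g * (0 + n * b ^ 2) + gx * b) + h →
      ∃ P V W : ℝ, P * Tt + V * Xt = δ * a + ψt ∧ V * Xx = δ * b + ψx ∧
        W * Xx ^ 2 + V * Xxx = δ * 0 + ψxx ∧
        f' * P = ε * μ * (g' * (W + n' * V ^ 2) + gx' * V) + h') :
    Xt = 0 ∧ f' * gx * Xx ^ 3 =
      f * Tt * μ * (g' * (2 * n' * ψx * Xx - Xxx) + gx' * Xx ^ 2) ∧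
    g' * (ψxx * Xx - ψx * Xxx + n' * ψx ^ 2 * Xx) + gx' * ψx * Xx ^ 2 = 0 ∧
    f' * (δ * h + f * ψt) = Tt * f * h' := by
  -- Eliminating `a`, `P`, `V`, `W` gives an identity that is quadratic in the slope `b` and affine
  -- in `ε = e^{nu}`. Taking `u_xx = 0` is enough, since its coefficient has already been matched.
  have R : ∀ ε, (ε = ε₀ ∨ ε = ε₁) → ∀ b : ℝ,
      f' * Xx ^ 2 * (Xx * (δ * (ε * (g * (n * b ^ 2) + gx * b) + h) + f * ψt) -
        f * (δ * b + ψx) * Xt) = Tt * f * (ε * μ * (g' * (ψxx * Xx - (δ * b + ψx) * Xxx +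
          n' * (δ * b + ψx) ^ 2 * Xx) + gx' * (δ * b + ψx) * Xx ^ 2) + h' * Xx ^ 3) := by
    intro ε hε b
    obtain ⟨P, V, W, e1, e2, e3, e4⟩ :=
      H ε hε ((ε * (g * (0 + n * b ^ 2) + gx * b) + h) / f) b (mul_div_cancel₀ _ hf)
    have e5 : f * ((ε * (g * (0 + n * b ^ 2) + gx * b) + h) / f) =
      ε * (g * (0 + n * b ^ 2) + gx * b) + h := mul_div_cancel₀ _ hf
    generalize (ε * (g * (0 + n * b ^ 2) + gx * b) + h) / f = a at e1 e5
    have e6 : W * Xx ^ 3 = ψxx * Xx - (δ * b + ψx) * Xxx := by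
      linear_combination Xx * e3 - Xxx * e2
    have e7 : V ^ 2 * Xx ^ 3 = (δ * b + ψx) ^ 2 * Xx := by
      linear_combination Xx * (V * Xx + δ * b + ψx) * e2
    have e8 : V * Xx ^ 3 = (δ * b + ψx) * Xx ^ 2 := by
      linear_combination Xx ^ 2 * e2
    linear_combination Tt * f * Xx ^ 3 * e4 - f' * f * Xx ^ 3 * e1 - f' * Xx ^ 3 * δ * e5
      + Tt * f * ε * μ * g' * e6 + Tt * f * ε * μ * g' * n' * e7 + Tt * f * ε * μ * gx' * e8
      + f' * f * Xx ^ 2 * Xt * e2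
  -- The odd part in `b`, that is, the coefficient of `b`.
  have D : ∀ ε, (ε = ε₀ ∨ ε = ε₁) → f' * Xx ^ 2 * (Xx * ε * gx - f * Xt) =
      Tt * f * ε * μ * (g' * (2 * n' * ψx * Xx - Xxx) + gx' * Xx ^ 2) := by
    intro ε hε
    refine mul_left_cancel₀ hδ ?_
    linear_combination (R ε hε 1 - R ε hε (-1)) / 2
  have hε' : ε₀ - ε₁ ≠ 0 := sub_ne_zero.2 hε
  have d0 := D ε₀ (Or.inl rfl)
  have d1 := D ε₁ (Or.inr rfl)
  have c1 : f' * gx * Xx ^ 3 = f * Tt * μ * (g' * (2 * n' * ψx * Xx - Xxx) + gx' * Xx ^ 2) := by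
    refine mul_left_cancel₀ hε' ?_
    linear_combination d0 - d1
  have hXt : Xt = 0 := by
    refine mul_left_cancel₀ (mul_ne_zero (mul_ne_zero hf' (pow_ne_zero 2 hX)) hf) ?_
    linear_combination ε₀ * c1 - d0
  have r0 := R ε₀ (Or.inl rfl) 0
  have r1 := R ε₁ (Or.inr rfl) 0
  have c2 : g' * (ψxx * Xx - ψx * Xxx + n' * ψx ^ 2 * Xx) + gx' * ψx * Xx ^ 2 = 0 := by
    refine mul_left_cancel₀ (mul_ne_zero hε' (mul_ne_zero (mul_ne_zero hT hf) hμ)) ?_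
    linear_combination r1 - r0
  refine ⟨hXt, c1, c2, ?_⟩
  refine mul_left_cancel₀ (pow_ne_zero 3 hX) ?_
  linear_combination r0 + Tt * f * ε₀ * μ * c2 + f' * Xx ^ 2 * f * ψx * hXt

/-- The determining equations give `X_t = 0`, so `X` descends once more, now along the connected
sections `x = const`; the remaining equations are restated for `φ`. -/
theorem exists_fibered_form (hm : E.m = 0)
    (hm' : E'.m = 0) (hF : IsPointTransformation F E E') (hTr : Transforms F E E') :
    ∃ (T φ : ℝ → ℝ) (ψ : ℝ × ℝ → ℝ), ContDiffOn ℝ ∞ T E.tRange ∧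
      ContDiffOn ℝ ∞ φ E.xRange ∧ ContDiffOn ℝ ∞ ψ (baseProj '' E.dom) ∧
      ∀ p ∈ E.dom, F p = (T p.1, φ p.2.1, E.n / E'.n * p.2.2 + ψ (baseProj p)) ∧
        deriv T p.1 ≠ 0 ∧ deriv φ p.2.1 ≠ 0 ∧
        E'.f (φ p.2.1) * E.g p.2.1 * deriv φ p.2.1 ^ 2 =
          E.f p.2.1 * deriv T p.1 * Real.exp (E'.n * ψ (baseProj p)) * E'.g (φ p.2.1) ∧
        E'.f (φ p.2.1) * deriv E.g p.2.1 * deriv φ p.2.1 ^ 3 =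
          E.f p.2.1 * deriv T p.1 * Real.exp (E'.n * ψ (baseProj p)) *
            (E'.g (φ p.2.1) * (2 * E'.n * jetX ψ (baseProj p) * deriv φ p.2.1 -
              deriv (deriv φ) p.2.1) + deriv E'.g (φ p.2.1) * deriv φ p.2.1 ^ 2) ∧
        E'.g (φ p.2.1) * (jetXX ψ (baseProj p) * deriv φ p.2.1 -
          jetX ψ (baseProj p) * deriv (deriv φ) p.2.1 + E'.n * jetX ψ (baseProj p) ^ 2 *
          deriv φ p.2.1) + deriv E'.g (φ p.2.1) * jetX ψ (baseProj p) * deriv φ p.2.1 ^ 2 = 0 ∧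
        E'.f (φ p.2.1) * (E.n / E'.n * E.h p.2.1 + E.f p.2.1 * jetT ψ (baseProj p)) =
          deriv T p.1 * E.f p.2.1 * E'.h (φ p.2.1) := by
  obtain ⟨T, X, ψ, hT, hX, hψ, hform⟩ := exists_semifibered_form hm hm' hF hTr
  have hn := E.n_ne_zero
  have hn' := E'.n_ne_zero
  have hδ : E.n / E'.n ≠ 0 := div_ne_zero hn hn'
  have hdet : ∀ p ∈ E.dom, jetT X (baseProj p) = 0 ∧
      E'.f (X (baseProj p)) * deriv E.g p.2.1 * jetX X (baseProj p) ^ 3 =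
        E.f p.2.1 * deriv T p.1 * Real.exp (E'.n * ψ (baseProj p)) *
          (E'.g (X (baseProj p)) * (2 * E'.n * jetX ψ (baseProj p) * jetX X (baseProj p) -
            jetXX X (baseProj p)) + deriv E'.g (X (baseProj p)) * jetX X (baseProj p) ^ 2) ∧
      E'.g (X (baseProj p)) * (jetXX ψ (baseProj p) * jetX X (baseProj p) -
        jetX ψ (baseProj p) * jetXX X (baseProj p) + E'.n * jetX ψ (baseProj p) ^ 2 *
        jetX X (baseProj p)) + deriv E'.g (X (baseProj p)) * jetX ψ (baseProj p) *
        jetX X (baseProj p) ^ 2 = 0 ∧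
      E'.f (X (baseProj p)) * (E.n / E'.n * E.h p.2.1 + E.f p.2.1 * jetT ψ (baseProj p)) =
        deriv T p.1 * E.f p.2.1 * E'.h (X (baseProj p)) := by
    intro p hp
    obtain ⟨h1, h2, h3, -, -, -⟩ := hform p hp
    have hx : p.2.1 ∈ E.xRange := ⟨p, hp, rfl⟩
    have hx' : X (baseProj p) ∈ E'.xRange := ⟨F p, hF.2.1.mapsTo hp, by rw [h1]⟩
    -- A second value of `u` over the same `(t, x)`, so that `e^{nu}` takes two values and the
    -- equation splits in it.
    obtain ⟨u₁, hu₁, hp₁⟩ : ∃ u₁, u₁ ≠ p.2.2 ∧ ((p.1, p.2.1, u₁) : ℝ × ℝ × ℝ) ∈ E.dom := by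
      have hev : ∀ᶠ u in 𝓝 p.2.2, ((p.1, p.2.1, u) : ℝ × ℝ × ℝ) ∈ E.dom :=
        (show ContinuousAt (fun u => ((p.1, p.2.1, u) : ℝ × ℝ × ℝ)) p.2.2 by
          fun_prop).eventually_mem (E.isOpen_dom.mem_nhds hp)
      obtain ⟨ε, hε, hb⟩ := Metric.eventually_nhds_iff.1 hev
      refine ⟨p.2.2 + ε / 2, by linarith, hb ?_⟩
      rw [Real.dist_eq, add_sub_cancel_left, abs_of_pos (by linarith)]
      linarith
    have hexp : ∀ u, Real.exp (E'.n * (E.n / E'.n * u + ψ (baseProj p))) =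
        Real.exp (E.n * u) * Real.exp (E'.n * ψ (baseProj p)) := by
      intro u
      rw [← Real.exp_add]
      congr 1
      field_simp
    have hTp := hT.contDiffAt (E.isOpen_tRange.mem_nhds ⟨p, hp, rfl⟩)
    have hXp := hX.contDiffAt (E.isOpen_baseProj_image.mem_nhds ⟨p, hp, rfl⟩)
    have hψp := hψ.contDiffAt (E.isOpen_baseProj_image.mem_nhds ⟨p, hp, rfl⟩)
    refine determining_equations (f := E.f p.2.1) (g := E.g p.2.1) (gx := deriv E.g p.2.1)
      (h := E.h p.2.1) (f' := E'.f (X (baseProj p))) (g' := E'.g (X (baseProj p)))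
      (gx' := deriv E'.g (X (baseProj p))) (h' := E'.h (X (baseProj p))) (n := E.n) (n' := E'.n)
      (δ := E.n / E'.n) (Tt := deriv T p.1) (Xt := jetT X (baseProj p))
      (Xx := jetX X (baseProj p)) (Xxx := jetXX X (baseProj p)) (ψt := jetT ψ (baseProj p))
      (ψx := jetX ψ (baseProj p)) (ψxx := jetXX ψ (baseProj p))
      (μ := Real.exp (E'.n * ψ (baseProj p))) (ε₀ := Real.exp (E.n * p.2.2))
      (ε₁ := Real.exp (E.n * u₁)) (E.f_ne_zero _ hx) (E'.f_ne_zero _ hx') hδ h2 h3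
      (Real.exp_pos _).ne' ?_ ?_
    · intro h
      exact hu₁ (mul_left_cancel₀ hn (Real.exp_injective h)).symm
    · rintro ε (rfl | rfl) a b hab
      · have := jet_relation hm hm' hF.2.1 hTr (fun p hp => (hform p hp).1) hp hTp hXp hψp h2 h3
          a b 0 hab
        rwa [hexp] at this
      · have := jet_relation hm hm' hF.2.1 hTr (fun p hp => (hform p hp).1) hp₁ hTp hXp hψp h2 h3
          a b 0 hab
        rw [show baseProj (p.1, p.2.1, u₁) = baseProj p from rfl] at this
        rwa [hexp] at this
  have hFd : ∀ p ∈ E.dom, HasFDerivAt F (fderiv ℝ F p) p := fun p hp =>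
    ((hF.1.contDiffAt (E.isOpen_dom.mem_nhds hp)).differentiableAt (by simp)).hasFDerivAt
  obtain ⟨φ, hφs, hφ⟩ := exists_descend (S := fun p => (F p).2.1) E.isOpen_dom hF.1.snd.fst
    ((ContinuousLinearMap.fst ℝ ℝ ℝ).comp (ContinuousLinearMap.snd ℝ ℝ (ℝ × ℝ)))
    ((ContinuousLinearMap.inr ℝ ℝ (ℝ × ℝ)).comp (ContinuousLinearMap.inl ℝ ℝ ℝ)) (fun _ => rfl)
    (fun p hp q hq hpq => eq_of_preconnected_fiber E.isOpen_dom hF.1.snd.fst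
      ((ContinuousLinearMap.fst ℝ ℝ ℝ).comp (ContinuousLinearMap.snd ℝ ℝ (ℝ × ℝ)))
      (fun p hp v hv => by
        obtain ⟨-, -, -, h4, h5, -⟩ := hform p hp
        rw [(hdet p hp).1] at h4
        have hv1 : v.2.1 = 0 := hv
        have hv' : v = v.1 • (1, 0, 0) + v.2.2 • (0, 0, 1) := by
          refine Prod.ext ?_ (Prod.ext ?_ ?_) <;> simp [hv1]
        rw [(hFd p hp).snd.fst.fderiv]
        change (fderiv ℝ F p v).2.1 = 0
        rw [hv', map_add, map_smul, map_smul]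
        simp [h4, h5]) E.section_x hp hq hpq)
  have hφ' : ∀ p ∈ E.dom, X (baseProj p) = φ p.2.1 := by
    intro p hp
    have h1 : (F p).2.1 = φ p.2.1 := hφ p hp
    rw [← h1, (hform p hp).1]
  refine ⟨T, φ, ψ, hT, ?_, hψ, fun p hp => ?_⟩
  · have : ((ContinuousLinearMap.fst ℝ ℝ ℝ).comp (ContinuousLinearMap.snd ℝ ℝ (ℝ × ℝ))) '' E.dom =
      E.xRange := rfl
    rwa [this] at hφs
  have hev : (fun x => X (p.1, x)) =ᶠ[𝓝 p.2.1] φ := by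
    filter_upwards [E.eventually_line_x_mem hp] with x hx using hφ' _ hx
  have hXx : jetX X (baseProj p) = deriv φ p.2.1 := hev.deriv_eq
  have hXxx : jetXX X (baseProj p) = deriv (deriv φ) p.2.1 := hev.deriv.deriv_eq
  obtain ⟨h1, h2, h3, -, -, h6⟩ := hform p hp
  obtain ⟨-, d2, d3, d4⟩ := hdet p hp
  simp only [hXx, hXxx, hφ' p hp] at h1 h3 h6 d2 d3 d4
  exact ⟨h1, h2, h3, h6, d2, d3, d4⟩

end RDEquation

/-! ### Integration of the determining equations. -/

/-- The derivative has one formula whether or not `α` vanishes, so the four cases for `T` are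
treated as one. -/
theorem hasDerivAt_expTime {n : ℝ} (hn : n ≠ 0) (α t : ℝ) :
    HasDerivAt (expTime n α) (Real.exp (n * α * t)) t := by
  by_cases hα : α = 0
  · have h : expTime n α = fun t => t := by
      ext t
      simp [expTime, hα]
    rw [h, hα]
    simpa using hasDerivAt_id' t
  · have h : expTime n α = fun t => (Real.exp (n * α * t) - 1) / (n * α) := by
      ext t
      simp [expTime, hα]
    rw [h]
    have h1 : HasDerivAt (fun t => n * α * t) (n * α) t := by
      simpa using (hasDerivAt_id t).const_mul (n * α)
    have h2 := (h1.exp.sub_const 1).div_const (n * α)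
    rwa [mul_div_cancel_right₀ _ (mul_ne_zero hn hα)] at h2

namespace RDEquation

variable {F : ℝ × ℝ × ℝ → ℝ × ℝ × ℝ} {E E' : RDEquation}

theorem InSubclass.exists_ratio (hE : E.InSubclass) : ∃ α, ∀ x ∈ E.xRange, E.h x / E.f x = α := by
  refine E.isPreconnected_xRange.exists_eq_const_of_hasDerivAt_zero E.isOpen_xRange
    (f := fun x => E.h x / E.f x) fun x hx => ?_
  have h1 := (E.contDiffAt_h hx).differentiableAt (by simp)
  have h2 := (E.contDiffAt_f hx).differentiableAt (by simp)
  have h3 : DifferentiableAt ℝ (fun x => E.h x / E.f x) x := h1.div h2 (E.f_ne_zero x hx)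
  rw [← hE.2 x hx]
  exact h3.hasDerivAt

/-- Each parameter is a first integral: some expression has zero derivative on a connected range and
hence is constant there. -/
theorem exists_params (hE : E.InSubclass) (hE' : E'.InSubclass)
    (hF : IsPointTransformation F E E') (hTr : Transforms F E E') :
    ∃ P : RDParams, P.Admissible E ∧ P.Target E E' ∧ ∀ p ∈ E.dom, F p = P.map E.n p := by
  obtain ⟨T, φ, ψ, hT, hφ, hψ, hform⟩ := exists_fibered_form hE.1 hE'.1 hF hTr
  obtain ⟨α, hα⟩ := hE.exists_ratio
  obtain ⟨α', hα'⟩ := hE'.exists_ratio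
  obtain ⟨G, hG⟩ := E.isPreconnected_xRange.exists_antideriv E.isOpen_xRange
    (f := fun x => 1 / E.g x)
    (continuousOn_const.div E.smooth_g.continuousOn E.g_ne_zero)
  have hn := E.n_ne_zero
  have hn' := E'.n_ne_zero
  have hTs : ∀ t ∈ E.tRange, ContDiffAt ℝ ∞ T t := fun t ht =>
    hT.contDiffAt (E.isOpen_tRange.mem_nhds ht)
  have hφs : ∀ x ∈ E.xRange, ContDiffAt ℝ ∞ φ x := fun x hx =>
    hφ.contDiffAt (E.isOpen_xRange.mem_nhds hx)
  have hψs : ∀ p ∈ E.dom, ContDiffAt ℝ ∞ ψ (baseProj p) := fun p hp =>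
    hψ.contDiffAt (E.isOpen_baseProj_image.mem_nhds ⟨p, hp, rfl⟩)
  have hT0 : ∀ t ∈ E.tRange, deriv T t ≠ 0 := by
    rintro _ ⟨p, hp, rfl⟩
    exact (hform p hp).2.1
  have hφ0 : ∀ x ∈ E.xRange, deriv φ x ≠ 0 := by
    rintro _ ⟨p, hp, rfl⟩
    exact (hform p hp).2.2.1
  have hφE : ∀ x ∈ E.xRange, φ x ∈ E'.xRange := by
    rintro _ ⟨p, hp, rfl⟩
    exact ⟨F p, hF.2.1.mapsTo hp, by rw [(hform p hp).1]⟩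
  have hg : ∀ x ∈ E.xRange, E.g x ≠ 0 := E.g_ne_zero
  have hf : ∀ x ∈ E.xRange, E.f x ≠ 0 := E.f_ne_zero
  have hg' : ∀ x ∈ E.xRange, E'.g (φ x) ≠ 0 := fun x hx => E'.g_ne_zero _ (hφE x hx)
  have hf' : ∀ x ∈ E.xRange, E'.f (φ x) ≠ 0 := fun x hx => E'.f_ne_zero _ (hφE x hx)
  -- Chosen so that the leading-coefficient identity becomes `T_t Ψ = e^{-n'ψ}`, which separates the
  -- variables of `e^{-n'ψ}`.
  set Ψ : ℝ → ℝ := fun x => E.f x * E'.g (φ x) / (E'.f (φ x) * E.g x * deriv φ x ^ 2) with hΨ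
  have hden : ∀ x ∈ E.xRange, E'.f (φ x) * E.g x * deriv φ x ^ 2 ≠ 0 := fun x hx =>
    mul_ne_zero (mul_ne_zero (hf' x hx) (hg x hx)) (pow_ne_zero 2 (hφ0 x hx))
  have hg's : ∀ x ∈ E.xRange, ContDiffAt ℝ ∞ (fun x => E'.g (φ x)) x := fun x hx =>
    (E'.contDiffAt_g (hφE x hx)).comp x (hφs x hx)
  have hf's : ∀ x ∈ E.xRange, ContDiffAt ℝ ∞ (fun x => E'.f (φ x)) x := fun x hx =>
    (E'.contDiffAt_f (hφE x hx)).comp x (hφs x hx)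
  have hΨs : ∀ x ∈ E.xRange, ContDiffAt ℝ ∞ Ψ x := by
    intro x hx
    exact ((E.contDiffAt_f hx).mul (hg's x hx)).div
      (((hf's x hx).mul (E.contDiffAt_g hx)).mul ((hφs x hx).deriv_infty.pow 2)) (hden x hx)
  have hΨ0 : ∀ x ∈ E.xRange, Ψ x ≠ 0 := fun x hx =>
    div_ne_zero (mul_ne_zero (hf x hx) (hg' x hx)) (hden x hx)
  -- `ψ` in terms of `T` and `Ψ`
  have hrel : ∀ p ∈ E.dom, deriv T p.1 * Ψ p.2.1 = Real.exp (-E'.n * ψ (baseProj p)) := by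
    intro p hp
    have hx : p.2.1 ∈ E.xRange := ⟨p, hp, rfl⟩
    have h := (hform p hp).2.2.2.1
    have h1 : Real.exp (E'.n * ψ (baseProj p)) ≠ 0 := (Real.exp_pos _).ne'
    rw [neg_mul, Real.exp_neg, ← one_div, eq_div_iff h1]
    simp only [hΨ]
    rw [mul_div_assoc', div_mul_eq_mul_div, div_eq_one_iff_eq (hden _ hx), h]
    ring
  have hΨx : ∀ p ∈ E.dom, deriv Ψ p.2.1 = -E'.n * jetX ψ (baseProj p) * Ψ p.2.1 ∧
      deriv (deriv Ψ) p.2.1 = Ψ p.2.1 * (E'.n ^ 2 * jetX ψ (baseProj p) ^ 2 -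
        E'.n * jetXX ψ (baseProj p)) := by
    intro p hp
    have hx : p.2.1 ∈ E.xRange := ⟨p, hp, rfl⟩
    have hTp : deriv T p.1 ≠ 0 := hT0 _ ⟨p, hp, rfl⟩
    have hl := (hψs p hp).line_x
    have e1 : (fun x => deriv T p.1 * Ψ x) =ᶠ[𝓝 p.2.1]
        fun x => Real.exp (-E'.n * ψ (p.1, x)) := by
      filter_upwards [E.eventually_line_x_mem hp] with x hx using hrel _ hx
    have e2 : (fun x => deriv T p.1 * deriv Ψ x) =ᶠ[𝓝 p.2.1]
        fun x => Real.exp (-E'.n * ψ (p.1, x)) * (-E'.n * deriv (fun x => ψ (p.1, x)) x) := by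
      filter_upwards [e1.eventually_nhds, hl.eventually_infty, (hΨs _ hx).eventually_infty]
        with x h1 h2 h3
      have h4 := (h3.hasDerivAt.const_mul (deriv T p.1)).deriv
      have h5 := (h2.hasDerivAt.const_mul (-E'.n)).exp.deriv
      exact h4.symm.trans ((EventuallyEq.deriv_eq h1).trans h5)
    have d1 : deriv T p.1 * deriv Ψ p.2.1 =
        Real.exp (-E'.n * ψ (baseProj p)) * (-E'.n * jetX ψ (baseProj p)) := e2.self_of_nhds
    have d2 : deriv T p.1 * deriv (deriv Ψ) p.2.1 =
        Real.exp (-E'.n * ψ (baseProj p)) * (-E'.n * jetX ψ (baseProj p)) *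
          (-E'.n * jetX ψ (baseProj p)) +
        Real.exp (-E'.n * ψ (baseProj p)) * (-E'.n * jetXX ψ (baseProj p)) := by
      have h4 := ((hΨs _ hx).deriv_infty.hasDerivAt'.const_mul (deriv T p.1)).deriv
      have h5 := ((hl.hasDerivAt'.const_mul (-E'.n)).exp.mul
        (hl.deriv_infty.hasDerivAt'.const_mul (-E'.n))).deriv
      exact h4.symm.trans (e2.deriv_eq.trans h5)
    rw [← hrel p hp] at d1 d2
    constructor
    · refine mul_left_cancel₀ hTp ?_
      linear_combination d1
    · refine mul_left_cancel₀ hTp ?_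
      linear_combination d2
  have hTt : ∀ p ∈ E.dom, deriv (deriv T) p.1 = -E'.n * jetT ψ (baseProj p) * deriv T p.1 := by
    intro p hp
    have hx : p.2.1 ∈ E.xRange := ⟨p, hp, rfl⟩
    have ht : p.1 ∈ E.tRange := ⟨p, hp, rfl⟩
    have e1 : (fun t => deriv T t * Ψ p.2.1) =ᶠ[𝓝 p.1]
        fun t => Real.exp (-E'.n * ψ (t, p.2.1)) := by
      filter_upwards [E.eventually_line_t_mem hp] with t ht using hrel _ ht
    have h4 := ((hTs _ ht).deriv_infty.hasDerivAt'.mul_const (Ψ p.2.1)).deriv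
    have h5 := ((hψs p hp).line_t.hasDerivAt'.const_mul (-E'.n)).exp.deriv
    have h6 : deriv (deriv T) p.1 * Ψ p.2.1 =
        Real.exp (-E'.n * ψ (baseProj p)) * (-E'.n * jetT ψ (baseProj p)) :=
      h4.symm.trans (e1.deriv_eq.trans h5)
    rw [← hrel p hp] at h6
    refine mul_right_cancel₀ (hΨ0 _ hx) ?_
    linear_combination h6
  -- The second determining equation with `f`, `f'` and `T_t` eliminated by the first; it is the
  -- vanishing of the logarithmic derivative of `g' / (φ_x g Ψ²)`.
  have hi : ∀ p ∈ E.dom, deriv E.g p.2.1 * deriv φ p.2.1 * E'.g (φ p.2.1) = E.g p.2.1 *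
      (E'.g (φ p.2.1) * (2 * E'.n * jetX ψ (baseProj p) * deriv φ p.2.1 -
        deriv (deriv φ) p.2.1) + deriv E'.g (φ p.2.1) * deriv φ p.2.1 ^ 2) := by
    intro p hp
    have hx : p.2.1 ∈ E.xRange := ⟨p, hp, rfl⟩
    obtain ⟨-, -, -, h4, h5, -, -⟩ := hform p hp
    refine mul_left_cancel₀ (mul_ne_zero (hf' _ hx) (pow_ne_zero 2 (hφ0 _ hx))) ?_
    linear_combination E'.g (φ p.2.1) * h5 - (E'.g (φ p.2.1) * (2 * E'.n * jetX ψ (baseProj p) *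
      deriv φ p.2.1 - deriv (deriv φ) p.2.1) + deriv E'.g (φ p.2.1) * deriv φ p.2.1 ^ 2) * h4
  obtain ⟨δ₀, hδ₀⟩ : ∃ δ₀, ∀ x ∈ E.xRange, E'.g (φ x) / (deriv φ x * E.g x * Ψ x ^ 2) = δ₀ := by
    refine E.isPreconnected_xRange.exists_eq_const_of_hasDerivAt_zero E.isOpen_xRange
      (f := fun x => E'.g (φ x) / (deriv φ x * E.g x * Ψ x ^ 2)) ?_
    rintro _ ⟨p, hp, rfl⟩
    have hx : p.2.1 ∈ E.xRange := ⟨p, hp, rfl⟩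
    change HasDerivAt _ 0 p.2.1
    have h1 : HasDerivAt (fun x => E'.g (φ x)) (deriv E'.g (φ p.2.1) * deriv φ p.2.1) p.2.1 :=
      (E'.contDiffAt_g (hφE _ hx)).hasDerivAt'.comp _ (hφs _ hx).hasDerivAt'
    have h2 := ((hφs _ hx).deriv_infty.hasDerivAt'.mul (E.contDiffAt_g hx).hasDerivAt').mul
      ((hΨs _ hx).hasDerivAt'.pow 2)
    refine (h1.div h2 (mul_ne_zero (mul_ne_zero (hφ0 _ hx) (hg _ hx))
      (pow_ne_zero 2 (hΨ0 _ hx)))).congr_deriv ?_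
    rw [div_eq_zero_iff]
    left
    simp only [Pi.mul_apply, Pi.pow_apply]
    rw [(hΨx p hp).1]
    push_cast
    linear_combination (-(Ψ p.2.1) ^ 2) * hi p hp
  obtain ⟨δ₄, hδ₄⟩ : ∃ δ₄, ∀ x ∈ E.xRange, E.g x * deriv Ψ x = δ₄ := by
    refine E.isPreconnected_xRange.exists_eq_const_of_hasDerivAt_zero E.isOpen_xRange
      (f := fun x => E.g x * deriv Ψ x) ?_
    rintro _ ⟨p, hp, rfl⟩
    have hx : p.2.1 ∈ E.xRange := ⟨p, hp, rfl⟩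
    refine ((E.contDiffAt_g hx).hasDerivAt'.mul
      (hΨs _ hx).deriv_infty.hasDerivAt').congr_deriv ?_
    obtain ⟨-, -, -, -, -, h6, -⟩ := hform p hp
    rw [(hΨx p hp).1, (hΨx p hp).2]
    refine mul_left_cancel₀ (mul_ne_zero (hg' _ hx) (hφ0 _ hx)) ?_
    -- The third determining equation, with the derivative of `g'` eliminated by `hi`, is `(g Ψ_x)_x
    -- = 0`.
    linear_combination (-(E'.n * Ψ p.2.1 * E.g p.2.1)) * h6 -
      E'.n * Ψ p.2.1 * jetX ψ (baseProj p) * hi p hp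
  obtain ⟨δ₅, hδ₅⟩ : ∃ δ₅, ∀ x ∈ E.xRange, Ψ x - δ₄ * G x = δ₅ := by
    refine E.isPreconnected_xRange.exists_eq_const_of_hasDerivAt_zero E.isOpen_xRange
      (f := fun x => Ψ x - δ₄ * G x) fun x hx => ?_
    refine ((hΨs x hx).hasDerivAt'.sub ((hG x hx).const_mul δ₄)).congr_deriv ?_
    rw [← hδ₄ x hx]
    field_simp [hg x hx]
    ring
  have hode : ∀ t ∈ E.tRange, deriv (deriv T) t =
      deriv T t * (E.n * α - E'.n * α' * deriv T t) := by
    rintro _ ⟨p, hp, rfl⟩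
    have hx : p.2.1 ∈ E.xRange := ⟨p, hp, rfl⟩
    obtain ⟨-, -, -, -, -, -, h7⟩ := hform p hp
    have a1 : E.h p.2.1 = α * E.f p.2.1 := (div_eq_iff (hf _ hx)).1 (hα _ hx)
    have a2 : E'.h (φ p.2.1) = α' * E'.f (φ p.2.1) := (div_eq_iff (hf' _ hx)).1 (hα' _ (hφE _ hx))
    rw [a1, a2] at h7
    have h8 : E.n * α + E'.n * jetT ψ (baseProj p) = E'.n * deriv T p.1 * α' := by
      refine mul_left_cancel₀ (mul_ne_zero (hf _ hx) (hf' _ hx)) ?_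
      field_simp at h7
      linear_combination h7
    simp only
    rw [hTt p hp]
    linear_combination (-deriv T p.1) * h8
  -- The integrating factor of `hode`. The result is the derivative of the relation between
  -- `expTime` of `T` and `expTime` of `t`, and integrating it gives `δ₂`.
  obtain ⟨δ₁, hδ₁⟩ : ∃ δ₁, ∀ t ∈ E.tRange,
      Real.exp (E'.n * α' * T t - E.n * α * t) * deriv T t = δ₁ := by
    refine E.isPreconnected_tRange.exists_eq_const_of_hasDerivAt_zero E.isOpen_tRange
      (f := fun t => Real.exp (E'.n * α' * T t - E.n * α * t) * deriv T t) fun t ht => ?_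
    have h1 := (((hTs t ht).hasDerivAt'.const_mul (E'.n * α')).sub
      ((hasDerivAt_id t).const_mul (E.n * α))).exp.mul (hTs t ht).deriv_infty.hasDerivAt'
    refine h1.congr_deriv ?_
    rw [hode t ht]
    simp only [Pi.sub_apply, id]
    ring
  obtain ⟨δ₂, hδ₂⟩ : ∃ δ₂, ∀ t ∈ E.tRange,
      expTime E'.n α' (T t) - δ₁ * expTime E.n α t = δ₂ := by
    refine E.isPreconnected_tRange.exists_eq_const_of_hasDerivAt_zero E.isOpen_tRange
      (f := fun t => expTime E'.n α' (T t) - δ₁ * expTime E.n α t) fun t ht => ?_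
    refine (((hasDerivAt_expTime hn' α' (T t)).comp t (hTs t ht).hasDerivAt').sub
      ((hasDerivAt_expTime hn α t).const_mul δ₁)).congr_deriv ?_
    rw [← hδ₁ t ht, Real.exp_sub]
    field_simp
    ring
  obtain ⟨p₀, hp₀⟩ := E.isConnected_dom.nonempty
  have hx₀ : p₀.2.1 ∈ E.xRange := ⟨p₀, hp₀, rfl⟩
  have ht₀ : p₀.1 ∈ E.tRange := ⟨p₀, hp₀, rfl⟩
  have hδ₀' : δ₀ ≠ 0 := by
    rw [← hδ₀ _ hx₀]
    exact div_ne_zero (hg' _ hx₀) (mul_ne_zero (mul_ne_zero (hφ0 _ hx₀) (hg _ hx₀))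
      (pow_ne_zero 2 (hΨ0 _ hx₀)))
  have hδ₁' : δ₁ ≠ 0 := by
    rw [← hδ₁ _ ht₀]
    exact mul_ne_zero (Real.exp_pos _).ne' (hT0 _ ht₀)
  have hnn : E.n / (E.n / E'.n) = E'.n := by field_simp
  let P : RDParams := ⟨δ₀, δ₁, δ₂, E.n / E'.n, δ₄, δ₅, α, α', T, φ, G⟩
  have hPΨ : ∀ x ∈ E.xRange, P.Ψ x = Ψ x := by
    intro x hx
    change δ₄ * G x + δ₅ = Ψ x
    rw [← hδ₅ x hx]
    ring
  refine ⟨P, ?_, ?_, ?_⟩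
  · refine ⟨mul_ne_zero (mul_ne_zero hδ₀' hδ₁') (div_ne_zero hn hn'), ?_, hα, hG, hφ, hφ0, hT, hT0,
      ?_, ?_⟩
    · intro h
      have h1 : δ₄ = 0 := congrArg Prod.fst h
      have h2 : δ₅ = 0 := congrArg Prod.snd h
      have h3 := hPΨ _ hx₀
      have h4 : P.Ψ p₀.2.1 = δ₄ * G p₀.2.1 + δ₅ := rfl
      rw [h4, h1, h2, zero_mul, add_zero] at h3
      exact hΨ0 _ hx₀ h3.symm
    · intro t ht
      change expTime (E.n / (E.n / E'.n)) α' (T t) = δ₁ * expTime E.n α t + δ₂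
      rw [hnn, ← hδ₂ t ht]
      ring
    · intro t ht x hx
      rw [hPΨ x hx]
      -- `(t, x)` need not lie under the domain, only in the product of the two ranges. So the sign
      -- at one base point is propagated separately through `T_t` and `Ψ`, each of constant sign.
      have h1 : 0 < deriv T t * deriv T p₀.1 := E.isPreconnected_tRange.mul_pos_of_ne_zero
        (fun t ht => (hTs t ht).deriv_infty.continuousAt.continuousWithinAt) hT0 ht ht₀
      have h2 : 0 < Ψ x * Ψ p₀.2.1 := E.isPreconnected_xRange.mul_pos_of_ne_zero
        (fun x hx => (hΨs x hx).continuousAt.continuousWithinAt) hΨ0 hx hx₀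
      have h3 : 0 < deriv T p₀.1 * Ψ p₀.2.1 := by
        rw [hrel p₀ hp₀]
        exact Real.exp_pos _
      have h4 : 0 < deriv T t * Ψ x * (deriv T p₀.1 * Ψ p₀.2.1) := by
        have := mul_pos h1 h2
        linarith
      exact pos_of_mul_pos_left h4 h3.le
  · refine ⟨fun x hx => ?_, fun x hx => ?_, hnn.symm, hα'⟩
    · rw [hPΨ x hx]
      change E'.f (φ x) = δ₀ / deriv φ x * Ψ x * E.f x
      rw [← hδ₀ x hx]
      have h1 : Ψ x * (E'.f (φ x) * E.g x * deriv φ x ^ 2) = E.f x * E'.g (φ x) :=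
        div_mul_cancel₀ _ (hden x hx)
      have := hΨ0 x hx
      have := hφ0 x hx
      have := hg x hx
      field_simp
      linear_combination h1
    · rw [hPΨ x hx]
      change E'.g (φ x) = δ₀ * deriv φ x * Ψ x ^ 2 * E.g x
      rw [← hδ₀ x hx]
      have := hΨ0 x hx
      have := hφ0 x hx
      have := hg x hx
      field_simp
  · intro p hp
    have hx : p.2.1 ∈ E.xRange := ⟨p, hp, rfl⟩
    rw [(hform p hp).1]
    refine Prod.ext rfl (Prod.ext rfl ?_)
    change E.n / E'.n * p.2.2 + ψ (baseProj p) = E.n / E'.n * p.2.2 +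
      -(E.n / E'.n / E.n) * Real.log |deriv T p.1 * P.Ψ p.2.1|
    rw [hPΨ _ hx, hrel p hp, abs_of_pos (Real.exp_pos _), Real.log_exp]
    field_simp

end RDEquation

/-! ### Composition and inversion of transformations. -/

namespace RDEquation

variable {F G : ℝ × ℝ × ℝ → ℝ × ℝ × ℝ} {E E' E'' : RDEquation} {T φ : ℝ → ℝ}

/-- The transformation `F` is of the form `(T(t), φ(x), U(t, x, u))` with `T_t φ_x ≠ 0`. -/
structure Fibered (F : ℝ × ℝ × ℝ → ℝ × ℝ × ℝ) (E : RDEquation) (T φ : ℝ → ℝ) : Prop where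
  time : ∀ p ∈ E.dom, (F p).1 = T p.1
  space : ∀ p ∈ E.dom, (F p).2.1 = φ p.2.1
  smooth_T : ContDiffOn ℝ ∞ T E.tRange
  smooth_φ : ContDiffOn ℝ ∞ φ E.xRange
  T_ne_zero : ∀ t ∈ E.tRange, deriv T t ≠ 0
  φ_ne_zero : ∀ x ∈ E.xRange, deriv φ x ≠ 0

namespace Fibered

theorem contDiffAt_T (h : Fibered F E T φ) {p : ℝ × ℝ × ℝ} (hp : p ∈ E.dom) :
    ContDiffAt ℝ ∞ T p.1 :=
  h.smooth_T.contDiffAt (E.isOpen_tRange.mem_nhds ⟨p, hp, rfl⟩)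

theorem contDiffAt_φ (h : Fibered F E T φ) {p : ℝ × ℝ × ℝ} (hp : p ∈ E.dom) :
    ContDiffAt ℝ ∞ φ p.2.1 :=
  h.smooth_φ.contDiffAt (E.isOpen_xRange.mem_nhds ⟨p, hp, rfl⟩)

theorem injOn_T (h : Fibered F E T φ) : Set.InjOn T E.tRange :=
  E.isPreconnected_tRange.injOn_of_deriv_ne_zero h.smooth_T h.T_ne_zero

theorem injOn_φ (h : Fibered F E T φ) : Set.InjOn φ E.xRange :=
  E.isPreconnected_xRange.injOn_of_deriv_ne_zero h.smooth_φ h.φ_ne_zero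

theorem base (h : Fibered F E T φ) {p : ℝ × ℝ × ℝ} (hp : p ∈ E.dom) :
    ContDiffAt ℝ ∞ (fun r : ℝ × ℝ => (T r.1, φ r.2)) (p.1, p.2.1) ∧
      Function.Injective (fderiv ℝ (fun r : ℝ × ℝ => (T r.1, φ r.2)) (p.1, p.2.1)) := by
  refine injective_fderiv_triangular (q := (p.1, p.2.1)) (X := fun r => φ r.2)
    (h.contDiffAt_T hp) ?_ (h.T_ne_zero _ ⟨p, hp, rfl⟩) (h.φ_ne_zero _ ⟨p, hp, rfl⟩)
  exact ContDiffAt.comp (g := φ) (p.1, p.2.1) (h.contDiffAt_φ hp) contDiffAt_snd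

end Fibered

theorem eventually_graph_mem {p : ℝ × ℝ × ℝ} (hp : p ∈ E.dom) {u : ℝ × ℝ → ℝ}
    (hu : ContinuousAt u (p.1, p.2.1)) (hup : u (p.1, p.2.1) = p.2.2) :
    ∀ᶠ r in 𝓝 (p.1, p.2.1), ((r.1, r.2, u r) : ℝ × ℝ × ℝ) ∈ E.dom := by
  have hc : ContinuousAt (fun r : ℝ × ℝ => ((r.1, r.2, u r) : ℝ × ℝ × ℝ)) (p.1, p.2.1) :=
    continuousAt_fst.prodMk (continuousAt_snd.prodMk hu)
  refine hc.eventually_mem (E.isOpen_dom.mem_nhds ?_)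
  simpa [hup] using hp

theorem IsPointTransformation.comp (hG : IsPointTransformation G E' E'')
    (hF : IsPointTransformation F E E') : IsPointTransformation (G ∘ F) E E'' := by
  refine ⟨hG.1.comp hF.1 hF.2.1.mapsTo, hG.2.1.comp hF.2.1, fun p hp => ?_⟩
  have hFp := hF.2.1.mapsTo hp
  have h1 := ((hF.1.contDiffAt (E.isOpen_dom.mem_nhds hp)).differentiableAt (by simp)).hasFDerivAt
  have h2 := ((hG.1.contDiffAt (E'.isOpen_dom.mem_nhds hFp)).differentiableAt
    (by simp)).hasFDerivAt
  rw [ContinuousLinearMap.det_ne_zero_iff_injective, (h2.comp p h1).fderiv]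
  exact (injective_fderiv_of_isPointTransformation hG hFp).comp
    (injective_fderiv_of_isPointTransformation hF hp)

theorem IsPointTransformation.invFunOn (hF : IsPointTransformation F E E') :
    IsPointTransformation (Function.invFunOn F E.dom) E' E := by
  have hinv : Set.InvOn (Function.invFunOn F E.dom) F E.dom E'.dom := hF.2.1.invOn_invFunOn
  have hs := (hF.2.1.injOn.isOpen_image_contDiffOn_invFunOn E.isOpen_dom hF.1
    (fun p hp => injective_fderiv_of_isPointTransformation hF hp)).2
  rw [hF.2.1.image_eq] at hs
  have hb := Set.BijOn.symm hinv.symm hF.2.1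
  refine ⟨hs, hb, fun p' hp' => ?_⟩
  have hp := hb.mapsTo hp'
  have h1 := ((hF.1.contDiffAt (E.isOpen_dom.mem_nhds hp)).differentiableAt (by simp)).hasFDerivAt
  have h2 := ((hs.contDiffAt (E'.isOpen_dom.mem_nhds hp')).differentiableAt (by simp)).hasFDerivAt
  have h3 := h1.comp p' h2
  have h4 : HasFDerivAt (F ∘ Function.invFunOn F E.dom)
      (ContinuousLinearMap.id ℝ (ℝ × ℝ × ℝ)) p' := by
    refine (hasFDerivAt_id p').congr_of_eventuallyEq ?_
    filter_upwards [E'.isOpen_dom.mem_nhds hp'] with y hy using hinv.2 hy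
  rw [ContinuousLinearMap.det_ne_zero_iff_injective]
  refine Function.Injective.of_comp (f := fderiv ℝ F (Function.invFunOn F E.dom p')) ?_
  have h5 := h3.unique h4
  rw [← ContinuousLinearMap.coe_comp, h5]
  exact Function.injective_id

/-- The condition on 2-jets needs an intermediate function. It exists because `F` is fibred: its
base map is a local diffeomorphism independent of `u`, so the image of a graph is a graph. -/
theorem Transforms.comp (hfib : Fibered F E T φ) (hF : IsPointTransformation F E E')
    (hFT : Transforms F E E') (hGT : Transforms G E' E'') : Transforms (G ∘ F) E E'' := by
  intro p hp u w hu hw hup hrel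
  obtain ⟨hA, hinj⟩ := hfib.base hp
  have hFp : ContDiffAt ℝ ∞ F p := hF.1.contDiffAt (E.isOpen_dom.mem_nhds hp)
  have hpu : ((p.1, p.2.1, u (p.1, p.2.1)) : ℝ × ℝ × ℝ) = p := by rw [hup]
  have hB : ContDiffAt ℝ ∞ (fun r : ℝ × ℝ => (F (r.1, r.2, u r)).2.2) (p.1, p.2.1) := by
    refine contDiff_snd.snd.contDiffAt.comp _ (ContDiffAt.comp (g := F)
      (f := fun r : ℝ × ℝ => (r.1, r.2, u r)) _ (by rwa [hpu]) ?_)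
    exact contDiffAt_fst.prodMk (contDiffAt_snd.prodMk hu)
  obtain ⟨v, hv, hvA⟩ := hA.exists_graph hinj hB
  obtain ⟨-, -, -, -, -, hmap⟩ := hA.exists_localInverse hinj
  have hbase : ((F p).1, (F p).2.1) = (T p.1, φ p.2.1) := by
    rw [hfib.time p hp, hfib.space p hp]
  have hmem := eventually_graph_mem hp hu.continuousAt hup
  have h1 := hFT p hp u v hu (by rwa [hbase]) hup (by
    filter_upwards [hvA, hmem] with r hr hr'
    rw [hfib.time _ hr', hfib.space _ hr']
    exact hr)
  have h2 := hGT (F p) (hF.2.1.mapsTo hp) v w (by rwa [hbase]) hw (by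
      rw [hbase]
      have := hvA.self_of_nhds
      simpa only [hpu] using this) (by
    rw [hbase, ← hmap, eventually_map]
    filter_upwards [hvA, hmem, hrel] with r hr hr' hr''
    have h3 : ((T r.1, φ r.2, v (T r.1, φ r.2)) : ℝ × ℝ × ℝ) = F (r.1, r.2, u r) := by
      refine Prod.ext (hfib.time _ hr').symm (Prod.ext (hfib.space _ hr').symm hr)
    rw [h3]
    exact hr'')
  exact h1.trans h2

/-- The equivalence for `F` is read backwards. Injectivity of `T` and `φ` on the whole ranges
identifies the base point of the global preimage. -/
theorem Transforms.invFunOn (hfib : Fibered F E T φ) (hF : IsPointTransformation F E E')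
    (hFT : Transforms F E E') : Transforms (Function.invFunOn F E.dom) E' E := by
  intro p' hp' u v hu hv hup hrel
  have hinv : Set.InvOn (Function.invFunOn F E.dom) F E.dom E'.dom := hF.2.1.invOn_invFunOn
  have hb := Set.BijOn.symm hinv.symm hF.2.1
  set p := Function.invFunOn F E.dom p' with hpdef
  have hp : p ∈ E.dom := hb.mapsTo hp'
  have hFp : F p = p' := hinv.2 hp'
  have hbase : (p'.1, p'.2.1) = (T p.1, φ p.2.1) := by
    rw [← hFp, hfib.time p hp, hfib.space p hp]
  obtain ⟨hA, -⟩ := hfib.base hp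
  have hmem' := eventually_graph_mem hp' hu.continuousAt hup
  rw [hbase] at hrel hmem'
  have hvp : v (p.1, p.2.1) = p.2.2 := by
    have := hrel.self_of_nhds
    rw [← hbase] at this
    simpa only [hup] using this
  have ht : ∀ᶠ r in 𝓝 (p.1, p.2.1), r.1 ∈ E.tRange :=
    continuousAt_fst.eventually_mem (E.isOpen_tRange.mem_nhds ⟨p, hp, rfl⟩)
  have hx : ∀ᶠ r in 𝓝 (p.1, p.2.1), r.2 ∈ E.xRange :=
    continuousAt_snd.eventually_mem (E.isOpen_xRange.mem_nhds ⟨p, hp, rfl⟩)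
  have h1 := hFT p hp v u hv (by rwa [hFp]) hvp (by
    filter_upwards [hA.continuousAt.eventually hrel, hA.continuousAt.eventually hmem', ht, hx]
      with r hr hr' hrt hrx
    set s := Function.invFunOn F E.dom (T r.1, φ r.2, u (T r.1, φ r.2)) with hs
    have hsE : s ∈ E.dom := hb.mapsTo hr'
    have hFs : F s = (T r.1, φ r.2, u (T r.1, φ r.2)) := hinv.2 hr'
    have hs1 : s.1 = r.1 := hfib.injOn_T ⟨s, hsE, rfl⟩ hrt (by
      rw [← hfib.time s hsE, hFs])
    have hs2 : s.2.1 = r.2 := hfib.injOn_φ ⟨s, hsE, rfl⟩ hrx (by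
      rw [← hfib.space s hsE, hFs])
    rw [hs1, hs2] at hr
    have hs3 : ((r.1, r.2, v r) : ℝ × ℝ × ℝ) = s :=
      Prod.ext hs1.symm (Prod.ext hs2.symm hr)
    rw [hs3, hFs])
  rw [hFp] at h1
  exact h1.symm

theorem isPointTransformation_id : IsPointTransformation id E E := by
  refine ⟨contDiffOn_id, Set.bijOn_id _, fun p _ => ?_⟩
  rw [ContinuousLinearMap.det_ne_zero_iff_injective, fderiv_id]
  exact Function.injective_id

theorem transforms_id (hm : E.m = 0) : Transforms id E E := by
  intro p hp u v hu hv hup hrel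
  change ContDiffAt ℝ ∞ v (p.1, p.2.1) at hv
  have h : v =ᶠ[𝓝 (p.1, p.2.1)] u := hrel
  obtain ⟨h1, h2, h3⟩ := h.jets
  change E.SatisfiedAt u (p.1, p.2.1) ↔ E.SatisfiedAt v (p.1, p.2.1)
  rw [E.satisfiedAt_iff ⟨p, hp, rfl⟩ hm hu, E.satisfiedAt_iff ⟨p, hp, rfl⟩ hm hv, h1, h2, h3,
    h.self_of_nhds]

end RDEquation

/-! ### Sufficiency: the stated formulas transform the equation. -/

namespace RDParams

variable {P : RDParams} {E E' : RDEquation}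

namespace Admissible

theorem δ₀_ne_zero (hP : P.Admissible E) : P.δ₀ ≠ 0 :=
  left_ne_zero_of_mul (left_ne_zero_of_mul hP.const_ne_zero)

theorem δ₃_ne_zero (hP : P.Admissible E) : P.δ₃ ≠ 0 :=
  right_ne_zero_of_mul hP.const_ne_zero

theorem fibered (hP : P.Admissible E) : RDEquation.Fibered (P.map E.n) E P.T P.φ :=
  ⟨fun _ _ => rfl, fun _ _ => rfl, hP.smooth_T, hP.smooth_φ, hP.T_t_ne_zero, hP.φ_x_ne_zero⟩

theorem hasDerivAt_Ψ (hP : P.Admissible E) {x : ℝ} (hx : x ∈ E.xRange) :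
    HasDerivAt P.Ψ (P.δ₄ * (1 / E.g x)) x :=
  ((hP.antideriv x hx).const_mul P.δ₄).add_const P.δ₅

theorem smooth_Ψ (hP : P.Admissible E) : ContDiffOn ℝ ∞ P.Ψ E.xRange := by
  have hG : ContDiffOn ℝ ∞ P.G E.xRange := by
    rw [contDiffOn_infty_iff_deriv_of_isOpen E.isOpen_xRange]
    refine ⟨fun x hx => (hP.antideriv x hx).differentiableAt.differentiableWithinAt, ?_⟩
    have h : ContDiffOn ℝ ∞ (fun x => 1 / E.g x) E.xRange :=
      contDiffOn_const.div E.smooth_g E.g_ne_zero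
    exact h.congr fun x hx => (hP.antideriv x hx).deriv
  exact (contDiffOn_const.mul hG).add contDiffOn_const

theorem Ψ_ne_zero (hP : P.Admissible E) {x : ℝ} (hx : x ∈ E.xRange) : P.Ψ x ≠ 0 := by
  obtain ⟨p, hp, -⟩ := id hx
  exact right_ne_zero_of_mul (hP.sign p.1 ⟨p, hp, rfl⟩ x hx).ne'

theorem contDiffAt_ψ (hP : P.Admissible E) {q : ℝ × ℝ} (ht : q.1 ∈ E.tRange)
    (hx : q.2 ∈ E.xRange) : ContDiffAt ℝ ∞ (fun r : ℝ × ℝ => P.ψ E.n r.1 r.2) q := by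
  have hT : ContDiffAt ℝ ∞ (deriv P.T) q.1 :=
    (hP.smooth_T.contDiffAt (E.isOpen_tRange.mem_nhds ht)).deriv_infty
  have hΨ : ContDiffAt ℝ ∞ P.Ψ q.2 := hP.smooth_Ψ.contDiffAt (E.isOpen_xRange.mem_nhds hx)
  have h1 : ContDiffAt ℝ ∞ (fun r : ℝ × ℝ => deriv P.T r.1) q := hT.comp q contDiffAt_fst
  have h2 : ContDiffAt ℝ ∞ (fun r : ℝ × ℝ => P.Ψ r.2) q := hΨ.comp q contDiffAt_snd
  have h3 := contDiffAt_const (c := -(P.δ₃ / E.n)).mul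
    ((h1.mul h2).log (hP.sign _ ht _ hx).ne')
  simpa only [ψ, Real.log_abs] using h3

theorem contDiffOn_map (hP : P.Admissible E) : ContDiffOn ℝ ∞ (P.map E.n) E.dom := by
  intro p hp
  have ht : p.1 ∈ E.tRange := ⟨p, hp, rfl⟩
  have hx : p.2.1 ∈ E.xRange := ⟨p, hp, rfl⟩
  have h1 : ContDiffAt ℝ ∞ (fun p : ℝ × ℝ × ℝ => P.T p.1) p :=
    (hP.fibered.contDiffAt_T hp).comp p contDiffAt_fst
  have h2 : ContDiffAt ℝ ∞ (fun p : ℝ × ℝ × ℝ => P.φ p.2.1) p :=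
    (hP.fibered.contDiffAt_φ hp).comp p contDiffAt_snd.fst
  have h3 : ContDiffAt ℝ ∞ (fun p : ℝ × ℝ × ℝ => P.ψ E.n p.1 p.2.1) p :=
    ContDiffAt.comp (g := fun r : ℝ × ℝ => P.ψ E.n r.1 r.2) p
      (hP.contDiffAt_ψ (q := baseProj p) ht hx) baseProj.contDiff.contDiffAt
  exact (h1.prodMk (h2.prodMk ((contDiffAt_const.mul
    contDiffAt_snd.snd).add h3))).contDiffWithinAt

theorem injOn_map (hP : P.Admissible E) : Set.InjOn (P.map E.n) E.dom := by
  intro p hp q hq h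
  have h1 : p.1 = q.1 := hP.fibered.injOn_T ⟨p, hp, rfl⟩ ⟨q, hq, rfl⟩ (congrArg Prod.fst h)
  have h2 : p.2.1 = q.2.1 := hP.fibered.injOn_φ ⟨p, hp, rfl⟩ ⟨q, hq, rfl⟩
    (congrArg (fun z => z.2.1) h)
  have h3 : P.δ₃ * p.2.2 + P.ψ E.n p.1 p.2.1 = P.δ₃ * q.2.2 + P.ψ E.n q.1 q.2.1 :=
    congrArg (fun z => z.2.2) h
  rw [h1, h2] at h3
  exact Prod.ext h1 (Prod.ext h2 (mul_left_cancel₀ hP.δ₃_ne_zero (add_right_cancel h3)))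

theorem injective_fderiv_map (hP : P.Admissible E) {p : ℝ × ℝ × ℝ} (hp : p ∈ E.dom) :
    Function.Injective (fderiv ℝ (P.map E.n) p) := by
  have ht : p.1 ∈ E.tRange := ⟨p, hp, rfl⟩
  have hx : p.2.1 ∈ E.xRange := ⟨p, hp, rfl⟩
  have h1 : HasFDerivAt (fun p : ℝ × ℝ × ℝ => P.T p.1) _ p :=
    (hP.fibered.contDiffAt_T hp).hasDerivAt'.hasFDerivAt.comp p hasFDerivAt_fst
  have h2 : HasFDerivAt (fun p : ℝ × ℝ × ℝ => P.φ p.2.1) _ p :=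
    (hP.fibered.contDiffAt_φ hp).hasDerivAt'.hasFDerivAt.comp p hasFDerivAt_snd.fst
  have h3 : HasFDerivAt (fun p : ℝ × ℝ × ℝ => P.ψ E.n p.1 p.2.1) _ p :=
    HasFDerivAt.comp (g := fun r : ℝ × ℝ => P.ψ E.n r.1 r.2) p
      ((hP.contDiffAt_ψ (q := baseProj p) ht hx).differentiableAt (by simp)).hasFDerivAt
      baseProj.hasFDerivAt
  have h4 : HasFDerivAt (P.map E.n) _ p := h1.prodMk (h2.prodMk
    ((hasFDerivAt_snd.snd.const_mul P.δ₃).add h3))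
  rw [h4.fderiv]
  refine (injective_iff_map_eq_zero _).2 fun e he => ?_
  have g1 := congrArg Prod.fst he
  have g2 := congrArg (fun z : ℝ × ℝ × ℝ => z.2.1) he
  have g3 := congrArg (fun z : ℝ × ℝ × ℝ => z.2.2) he
  simp at g1 g2 g3
  have e1 : e.1 = 0 := g1.resolve_right (hP.T_t_ne_zero _ ht)
  have e2 : e.2.1 = 0 := g2.resolve_right (hP.φ_x_ne_zero _ hx)
  rw [e1, e2] at g3
  have e3 : P.δ₃ * e.2.2 = 0 := by
    have h0 : ((0 : ℝ), (0 : ℝ)) = 0 := rfl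
    rw [h0, map_zero, add_zero] at g3
    exact g3
  exact Prod.ext e1 (Prod.ext e2 ((mul_eq_zero.1 e3).resolve_left hP.δ₃_ne_zero))

theorem isPointTransformation (hP : P.Admissible E) (hb : Set.BijOn (P.map E.n) E.dom E'.dom) :
    E.IsPointTransformation (P.map E.n) E' :=
  ⟨hP.contDiffOn_map, hb, fun _ hp =>
    (ContinuousLinearMap.det_ne_zero_iff_injective _).2 (hP.injective_fderiv_map hp)⟩

theorem jets_ψ (hP : P.Admissible E) {q : ℝ × ℝ} (ht : q.1 ∈ E.tRange) (hx : q.2 ∈ E.xRange) :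
    jetT (fun r : ℝ × ℝ => P.ψ E.n r.1 r.2) q =
      -(P.δ₃ / E.n) * (deriv (deriv P.T) q.1 / deriv P.T q.1) ∧
    jetX (fun r : ℝ × ℝ => P.ψ E.n r.1 r.2) q = -(P.δ₃ / E.n) * (deriv P.Ψ q.2 / P.Ψ q.2) ∧
    jetXX (fun r : ℝ × ℝ => P.ψ E.n r.1 r.2) q = -(P.δ₃ / E.n) *
      ((deriv (deriv P.Ψ) q.2 * P.Ψ q.2 - deriv P.Ψ q.2 * deriv P.Ψ q.2) / P.Ψ q.2 ^ 2) := by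
  have hT : ContDiffAt ℝ ∞ P.T q.1 := hP.smooth_T.contDiffAt (E.isOpen_tRange.mem_nhds ht)
  have hΨ : ∀ x ∈ E.xRange, ContDiffAt ℝ ∞ P.Ψ x := fun x hx =>
    hP.smooth_Ψ.contDiffAt (E.isOpen_xRange.mem_nhds hx)
  have hT0 := hP.T_t_ne_zero _ ht
  have hΨ0 := hP.Ψ_ne_zero hx
  have key : ∀ x ∈ E.xRange, HasDerivAt (fun x => P.ψ E.n q.1 x)
      (-(P.δ₃ / E.n) * (deriv P.Ψ x / P.Ψ x)) x := by
    intro x hx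
    have h := ((((hΨ x hx).hasDerivAt'.const_mul (deriv P.T q.1)).log
      (hP.sign _ ht _ hx).ne')).const_mul (-(P.δ₃ / E.n))
    rw [mul_div_mul_left _ _ hT0] at h
    simpa only [ψ, Real.log_abs] using h
  refine ⟨?_, (key _ hx).deriv, ?_⟩
  · have h := ((hT.deriv_infty.hasDerivAt'.mul_const (P.Ψ q.2)).log
      (hP.sign _ ht _ hx).ne').const_mul (-(P.δ₃ / E.n))
    rw [mul_div_mul_right _ _ hΨ0] at h
    have h' : HasDerivAt (fun t => P.ψ E.n t q.2)
        (-(P.δ₃ / E.n) * (deriv (deriv P.T) q.1 / deriv P.T q.1)) q.1 := by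
      simpa only [ψ, Real.log_abs] using h
    exact h'.deriv
  · have h : deriv (fun x => P.ψ E.n q.1 x) =ᶠ[𝓝 q.2]
        fun x => -(P.δ₃ / E.n) * (deriv P.Ψ x / P.Ψ x) := by
      filter_upwards [E.isOpen_xRange.mem_nhds hx] with x hx using (key x hx).deriv
    exact h.deriv_eq.trans (((hΨ _ hx).deriv_infty.hasDerivAt'.div (hΨ _ hx).hasDerivAt'
      hΨ0).const_mul _).deriv

/-- Differentiating the implicit relation for `T` once gives `e^{n'α'T} T_t = δ₁ e^{nαt}`; a second
differentiation eliminates `δ₁`. -/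
theorem deriv_deriv_T (hP : P.Admissible E) {t : ℝ} (ht : t ∈ E.tRange) :
    deriv (deriv P.T) t = deriv P.T t * (E.n * P.α - E.n / P.δ₃ * P.α' * deriv P.T t) := by
  have hn := E.n_ne_zero
  have hn' : E.n / P.δ₃ ≠ 0 := div_ne_zero hn hP.δ₃_ne_zero
  have hT : ∀ t ∈ E.tRange, ContDiffAt ℝ ∞ P.T t := fun t ht =>
    hP.smooth_T.contDiffAt (E.isOpen_tRange.mem_nhds ht)
  have h1 : ∀ t ∈ E.tRange, Real.exp (E.n / P.δ₃ * P.α' * P.T t) * deriv P.T t =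
      P.δ₁ * Real.exp (E.n * P.α * t) := by
    intro t ht
    have h2 := ((hasDerivAt_expTime hn' P.α' (P.T t)).comp t (hT t ht).hasDerivAt').deriv
    have h3 := (((hasDerivAt_expTime hn P.α t).const_mul P.δ₁).add_const P.δ₂).deriv
    rw [← h2, ← h3]
    refine EventuallyEq.deriv_eq ?_
    filter_upwards [E.isOpen_tRange.mem_nhds ht] with s hs using hP.T_eq s hs
  have h2 := (((hT t ht).hasDerivAt'.const_mul (E.n / P.δ₃ * P.α')).exp.mul
    (hT t ht).deriv_infty.hasDerivAt').deriv
  have h3 := (((hasDerivAt_id' t).const_mul (E.n * P.α)).exp.const_mul P.δ₁).deriv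
  have h4 : (fun t => Real.exp (E.n / P.δ₃ * P.α' * P.T t) * deriv P.T t) =ᶠ[𝓝 t]
      fun t => P.δ₁ * Real.exp (E.n * P.α * t) := by
    filter_upwards [E.isOpen_tRange.mem_nhds ht] with s hs using h1 s hs
  have h5 := h2.symm.trans (h4.deriv_eq.trans h3)
  refine mul_left_cancel₀ (Real.exp_pos (E.n / P.δ₃ * P.α' * P.T t)).ne' ?_
  linear_combination h5 - E.n * P.α * h1 t ht

theorem transforms (hP : P.Admissible E) (hm : E.m = 0) (hm' : E'.m = 0)
    (hT : P.Target E E') (hb : Set.BijOn (P.map E.n) E.dom E'.dom) :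
    E.Transforms (P.map E.n) E' := by
  intro p hp u v hu hv hup hrel
  have ht : p.1 ∈ E.tRange := ⟨p, hp, rfl⟩
  have hx : p.2.1 ∈ E.xRange := ⟨p, hp, rfl⟩
  have hφE : ∀ x ∈ E.xRange, P.φ x ∈ E'.xRange := by
    rintro _ ⟨p, hp, rfl⟩
    exact ⟨P.map E.n p, hb.mapsTo hp, rfl⟩
  have hx' := hφE _ hx
  have hTs := hP.fibered.contDiffAt_T hp
  have hφs := hP.fibered.contDiffAt_φ hp
  have hΨs : ContDiffAt ℝ ∞ P.Ψ p.2.1 := hP.smooth_Ψ.contDiffAt (E.isOpen_xRange.mem_nhds hx)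
  set q : ℝ × ℝ := (p.1, p.2.1) with hq
  change ContDiffAt ℝ ∞ v (P.T p.1, P.φ p.2.1) at hv
  change E.SatisfiedAt u q ↔ E'.SatisfiedAt v (P.T p.1, P.φ p.2.1)
  have hrel' : ∀ᶠ r in 𝓝 q, v (P.T r.1, (fun r : ℝ × ℝ => P.φ r.2) r) =
      P.δ₃ * u r + P.ψ E.n r.1 r.2 := hrel
  have hX : ContDiffAt ℝ ∞ (fun r : ℝ × ℝ => P.φ r.2) q :=
    ContDiffAt.comp (g := P.φ) q hφs contDiffAt_snd
  obtain ⟨j1, j2, j3⟩ := jets_of_comp_eq (q := q) (U := fun r => P.δ₃ * u r + P.ψ E.n r.1 r.2)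
    hTs hX hv hrel'
  obtain ⟨k1, k2, k3⟩ := jets_const_mul_add P.δ₃ hu (hP.contDiffAt_ψ (q := q) ht hx)
  obtain ⟨l1, l2, l3⟩ := hP.jets_ψ (q := q) ht hx
  rw [k1, show jetT (fun r : ℝ × ℝ => P.φ r.2) q = 0 from
    deriv_const q.1 (P.φ q.2), mul_zero, add_zero] at j1
  rw [k2, show jetX (fun r : ℝ × ℝ => P.φ r.2) q = deriv P.φ p.2.1 from rfl] at j2
  rw [k3, show jetX (fun r : ℝ × ℝ => P.φ r.2) q = deriv P.φ p.2.1 from rfl,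
    show jetXX (fun r : ℝ × ℝ => P.φ r.2) q = deriv (deriv P.φ) p.2.1 from rfl] at j3
  have hvq : v (P.T p.1, P.φ p.2.1) = P.δ₃ * u q + P.ψ E.n p.1 p.2.1 := hrel'.self_of_nhds
  -- The purpose of `ψ`: the logarithm turns `e^{n'v}` into `e^{nu}` divided by `T_t Ψ`.
  have hexp : Real.exp (E'.n * v (P.T p.1, P.φ p.2.1)) * (deriv P.T p.1 * P.Ψ p.2.1) =
      Real.exp (E.n * u q) := by
    have hpos := hP.sign _ ht _ hx
    have h3 := hP.δ₃_ne_zero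
    have hn := E.n_ne_zero
    rw [hvq, hT.n_eq]
    conv_lhs => rw [← Real.exp_log hpos]
    rw [← Real.exp_add]
    congr 1
    simp only [ψ, Real.log_abs]
    field_simp
    ring
  have hd : deriv E'.g (P.φ p.2.1) * deriv P.φ p.2.1 = P.δ₀ *
      (deriv (deriv P.φ) p.2.1 * P.Ψ p.2.1 ^ 2 * E.g p.2.1 +
        2 * deriv P.φ p.2.1 * P.Ψ p.2.1 * deriv P.Ψ p.2.1 * E.g p.2.1 +
        deriv P.φ p.2.1 * P.Ψ p.2.1 ^ 2 * deriv E.g p.2.1) := by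
    have h1 := ((E'.contDiffAt_g hx').hasDerivAt'.comp _ hφs.hasDerivAt').deriv
    have h2 := (((hφs.deriv_infty.hasDerivAt'.const_mul P.δ₀).mul (hΨs.hasDerivAt'.pow 2)).mul
      (E.contDiffAt_g hx).hasDerivAt').deriv
    have h3 : (E'.g ∘ P.φ) =ᶠ[𝓝 p.2.1]
        ((fun x => P.δ₀ * deriv P.φ x) * (P.Ψ ^ 2)) * E.g := by
      filter_upwards [E.isOpen_xRange.mem_nhds hx] with x hx using hT.g_eq x hx
    rw [← h1, h3.deriv_eq, h2]
    simp only [Pi.mul_apply, Pi.pow_apply]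
    push_cast
    ring
  have hΨxx : E.g p.2.1 * deriv (deriv P.Ψ) p.2.1 + deriv E.g p.2.1 * deriv P.Ψ p.2.1 = 0 := by
    have h1 := ((E.contDiffAt_g hx).hasDerivAt'.mul hΨs.deriv_infty.hasDerivAt').deriv
    have h2 : E.g * deriv P.Ψ =ᶠ[𝓝 p.2.1] fun _ => P.δ₄ := by
      filter_upwards [E.isOpen_xRange.mem_nhds hx] with x hx
      have := E.g_ne_zero x hx
      rw [Pi.mul_apply, (hP.hasDerivAt_Ψ hx).deriv]
      field_simp
    rw [h2.deriv_eq, deriv_const] at h1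
    linear_combination -h1
  have hh : E.h p.2.1 = P.α * E.f p.2.1 := (div_eq_iff (E.f_ne_zero _ hx)).1 (hP.ratio _ hx)
  have hh' : E'.h (P.φ p.2.1) = P.α' * E'.f (P.φ p.2.1) :=
    (div_eq_iff (E'.f_ne_zero _ hx')).1 (hT.ratio _ hx')
  have hf' := hT.f_eq _ hx
  have hg' := hT.g_eq _ hx
  have hTtt := hP.deriv_deriv_T ht
  have h3 := hP.δ₃_ne_zero
  have h0 := hP.δ₀_ne_zero
  have hn := E.n_ne_zero
  have hφ0 := hP.φ_x_ne_zero _ hx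
  have hT0 := hP.T_t_ne_zero _ ht
  have hΨ0 := hP.Ψ_ne_zero hx
  have hn' := hT.n_eq
  rw [E.satisfiedAt_iff (q := q) hx hm hu, E'.satisfiedAt_iff hx' hm' hv, hh, hh']
  simp only [hq] at *
  generalize jetT v (P.T p.1, P.φ p.2.1) = v₁ at *
  generalize jetX v (P.T p.1, P.φ p.2.1) = v₂ at *
  generalize jetXX v (P.T p.1, P.φ p.2.1) = v₃ at *
  generalize jetT u (p.1, p.2.1) = u₁ at *
  generalize jetX u (p.1, p.2.1) = u₂ at *
  generalize jetXX u (p.1, p.2.1) = u₃ at *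
  generalize jetT (fun r : ℝ × ℝ => P.ψ E.n r.1 r.2) (p.1, p.2.1) = ψ₁ at *
  generalize jetX (fun r : ℝ × ℝ => P.ψ E.n r.1 r.2) (p.1, p.2.1) = ψ₂ at *
  generalize jetXX (fun r : ℝ × ℝ => P.ψ E.n r.1 r.2) (p.1, p.2.1) = ψ₃ at *
  generalize Real.exp (E'.n * v (P.T p.1, P.φ p.2.1)) = ε' at *
  generalize Real.exp (E.n * u (p.1, p.2.1)) = ε at *
  have s0 : v₁ * deriv P.T p.1 = P.δ₃ * (u₁ - P.α) + P.α' * deriv P.T p.1 := by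
    rw [j1, l1, hTtt]
    field_simp
    ring
  have s1 : E'.n * P.Ψ p.2.1 * ψ₂ = -deriv P.Ψ p.2.1 := by
    rw [l2, hn']
    field_simp
  have s2 : E'.n * P.Ψ p.2.1 ^ 2 * ψ₃ = deriv P.Ψ p.2.1 ^ 2 -
      P.Ψ p.2.1 * deriv (deriv P.Ψ) p.2.1 := by
    rw [l3, hn']
    field_simp
    ring
  have s3 : E'.n * P.δ₃ = E.n := by
    rw [hn']
    field_simp
  have hn0 : E'.n ≠ 0 := E'.n_ne_zero
  -- The zeroth-order and first-order contributions of `ψ` cancel because `g Ψ_x` is constant and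
  -- `g'` carries the factor `φ_x Ψ²`.
  have flux : deriv P.φ p.2.1 * (E'.g (P.φ p.2.1) * (v₃ + E'.n * v₂ ^ 2) +
      deriv E'.g (P.φ p.2.1) * v₂) = P.δ₀ * P.δ₃ * P.Ψ p.2.1 ^ 2 *
        (E.g p.2.1 * (u₃ + E.n * u₂ ^ 2) + deriv E.g p.2.1 * u₂) := by
    have f1 : deriv P.φ p.2.1 * (E'.g (P.φ p.2.1) * (v₃ + E'.n * v₂ ^ 2) +
        deriv E'.g (P.φ p.2.1) * v₂) = P.δ₀ * (P.Ψ p.2.1 ^ 2 * E.g p.2.1 *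
          ((P.δ₃ * u₃ + ψ₃) + E'.n * (P.δ₃ * u₂ + ψ₂) ^ 2) +
          (2 * P.Ψ p.2.1 * deriv P.Ψ p.2.1 * E.g p.2.1 + P.Ψ p.2.1 ^ 2 * deriv E.g p.2.1) *
          (P.δ₃ * u₂ + ψ₂)) := by
      rw [hg', ← j2, ← j3]
      linear_combination v₂ * hd
    rw [f1]
    refine mul_left_cancel₀ hn0 ?_
    linear_combination P.δ₀ * (E.g p.2.1 * s2 + (E.g p.2.1 * (E'.n * P.Ψ p.2.1 * ψ₂ -
      deriv P.Ψ p.2.1) + 2 * deriv P.Ψ p.2.1 * E.g p.2.1 + P.Ψ p.2.1 * deriv E.g p.2.1) * s1 -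
      P.Ψ p.2.1 * hΨxx + 2 * E'.n * P.δ₃ * u₂ * E.g p.2.1 * P.Ψ p.2.1 * s1 +
      E'.n * E.g p.2.1 * P.Ψ p.2.1 ^ 2 * P.δ₃ * u₂ ^ 2 * s3)
  -- The residuals of the two equations are proportional with nonzero factors, which gives both
  -- directions of the equivalence.
  have main : deriv P.φ p.2.1 * deriv P.T p.1 * (E'.f (P.φ p.2.1) * v₁ -
      (ε' * (E'.g (P.φ p.2.1) * (v₃ + E'.n * v₂ ^ 2) + deriv E'.g (P.φ p.2.1) * v₂) +
        P.α' * E'.f (P.φ p.2.1))) = P.δ₀ * P.δ₃ * P.Ψ p.2.1 * (E.f p.2.1 * u₁ -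
      (ε * (E.g p.2.1 * (u₃ + E.n * u₂ ^ 2) + deriv E.g p.2.1 * u₂) + P.α * E.f p.2.1)) := by
    have hf'' : deriv P.φ p.2.1 * E'.f (P.φ p.2.1) = P.δ₀ * P.Ψ p.2.1 * E.f p.2.1 := by
      rw [hf']
      field_simp
    linear_combination deriv P.φ p.2.1 * E'.f (P.φ p.2.1) * s0 +
      P.δ₃ * (u₁ - P.α) * hf'' - deriv P.T p.1 * ε' * flux -
      P.δ₀ * P.δ₃ * P.Ψ p.2.1 *
        (E.g p.2.1 * (u₃ + E.n * u₂ ^ 2) + deriv E.g p.2.1 * u₂) * hexp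
  rw [← sub_eq_zero, ← sub_eq_zero (a := E'.f (P.φ p.2.1) * v₁)]
  constructor
  · intro h
    rw [h, mul_zero] at main
    exact (mul_eq_zero.1 main).resolve_left (mul_ne_zero hφ0 hT0)
  · intro h
    rw [h, mul_zero] at main
    exact (mul_eq_zero.1 main.symm).resolve_left (mul_ne_zero (mul_ne_zero h0 h3) hΨ0)

end Admissible

end RDParams

/-! ### Construction of the target equation. -/

/-- A nonempty section of the image is the image of a section of `s`. This transports the
connectedness conditions, since `T` and `φ` are injective. -/
theorem IsPreconnected.sep_image {V : Type*} [TopologicalSpace V] {F : V → V} {s : Set V}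
    (hF : ContinuousOn F s) {c : V → Prop} {d : V → V → Prop}
    (hd : ∀ p ∈ s, IsPreconnected {q ∈ s | d p q})
    (h : ∀ p ∈ s, c (F p) → ∀ q ∈ s, (c (F q) ↔ d p q)) :
    IsPreconnected {p' ∈ F '' s | c p'} := by
  rcases Set.eq_empty_or_nonempty {p' ∈ F '' s | c p'} with h0 | ⟨_, ⟨p, hp, rfl⟩, hc⟩
  · rw [h0]
    exact isPreconnected_empty
  · have h1 : {p' ∈ F '' s | c p'} = F '' {q ∈ s | d p q} := by
      ext p'
      constructor
      · rintro ⟨⟨q, hq, rfl⟩, hcq⟩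
        exact ⟨q, ⟨hq, (h p hp hc q hq).1 hcq⟩, rfl⟩
      · rintro ⟨q, ⟨hq, hdq⟩, rfl⟩
        exact ⟨⟨q, hq, rfl⟩, (h p hp hc q hq).2 hdq⟩
    rw [h1]
    exact (hd p hp).image F (hF.mono (Set.sep_subset _ _))

theorem RDParams.Admissible.exists_target {P : RDParams} {E : RDEquation} (hP : P.Admissible E) :
    ∃ E' : RDSubclass, P.Target E E'.1 ∧ E'.1.dom = P.map E.n '' E.dom := by
  have hinj : Set.InjOn P.φ E.xRange := hP.fibered.injOn_φ
  have hinjT : Set.InjOn P.T E.tRange := hP.fibered.injOn_T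
  obtain ⟨hopen, hχs⟩ := hinj.isOpen_image_contDiffOn_invFunOn E.isOpen_xRange hP.smooth_φ
    (fun x hx => by
      refine (injective_iff_map_eq_zero _).2 fun e he => ?_
      rw [fderiv_eq_smul_deriv, smul_eq_mul] at he
      exact (mul_eq_zero.1 he).resolve_right (hP.φ_x_ne_zero x hx))
  set χ := Function.invFunOn P.φ E.xRange with hχ
  have hχφ : ∀ x ∈ E.xRange, χ (P.φ x) = x := fun x hx => hinj.leftInvOn_invFunOn hx
  have hχm : Set.MapsTo χ (P.φ '' E.xRange) E.xRange := by
    rintro _ ⟨x, hx, rfl⟩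
    rw [hχφ x hx]
    exact hx
  have hxr : (fun p : ℝ × ℝ × ℝ => p.2.1) '' (P.map E.n '' E.dom) = P.φ '' E.xRange := by
    simp only [RDEquation.xRange, Set.image_image, map]
  have hφd : ContDiffOn ℝ ∞ (deriv P.φ) E.xRange := fun x hx =>
    ((hP.smooth_φ.contDiffAt (E.isOpen_xRange.mem_nhds hx)).deriv_infty).contDiffWithinAt
  have hf : ContDiffOn ℝ ∞ (fun y => P.δ₀ / deriv P.φ y * P.Ψ y * E.f y) E.xRange :=
    ((contDiffOn_const.div hφd hP.φ_x_ne_zero).mul hP.smooth_Ψ).mul E.smooth_f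
  have hg : ContDiffOn ℝ ∞ (fun y => P.δ₀ * deriv P.φ y * P.Ψ y ^ 2 * E.g y) E.xRange :=
    ((contDiffOn_const.mul hφd).mul (hP.smooth_Ψ.pow 2)).mul E.smooth_g
  -- The new coefficients are transported by the inverse of `φ` and cut off by an indicator to meet
  -- the convention of vanishing outside the range of `x`.
  set f' : ℝ → ℝ := (P.φ '' E.xRange).indicator
    ((fun y => P.δ₀ / deriv P.φ y * P.Ψ y * E.f y) ∘ χ) with hf'
  set g' : ℝ → ℝ := (P.φ '' E.xRange).indicator
    ((fun y => P.δ₀ * deriv P.φ y * P.Ψ y ^ 2 * E.g y) ∘ χ) with hg'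
  have hf's : ContDiffOn ℝ ∞ f' (P.φ '' E.xRange) :=
    (hf.comp hχs hχm).congr fun y hy => Set.indicator_of_mem hy _
  have hg's : ContDiffOn ℝ ∞ g' (P.φ '' E.xRange) :=
    (hg.comp hχs hχm).congr fun y hy => Set.indicator_of_mem hy _
  have hf'φ : ∀ x ∈ E.xRange, f' (P.φ x) = P.δ₀ / deriv P.φ x * P.Ψ x * E.f x := by
    intro x hx
    rw [hf', Set.indicator_of_mem (Set.mem_image_of_mem P.φ hx), Function.comp_apply, hχφ x hx]
  have hg'φ : ∀ x ∈ E.xRange, g' (P.φ x) = P.δ₀ * deriv P.φ x * P.Ψ x ^ 2 * E.g x := by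
    intro x hx
    rw [hg', Set.indicator_of_mem (Set.mem_image_of_mem P.φ hx), Function.comp_apply, hχφ x hx]
  have hf'0 : ∀ y ∈ P.φ '' E.xRange, f' y ≠ 0 := by
    rintro _ ⟨x, hx, rfl⟩
    rw [hf'φ x hx]
    exact mul_ne_zero (mul_ne_zero (div_ne_zero hP.δ₀_ne_zero (hP.φ_x_ne_zero x hx))
      (hP.Ψ_ne_zero hx)) (E.f_ne_zero x hx)
  have hg'0 : ∀ y ∈ P.φ '' E.xRange, g' y ≠ 0 := by
    rintro _ ⟨x, hx, rfl⟩
    rw [hg'φ x hx]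
    exact mul_ne_zero (mul_ne_zero (mul_ne_zero hP.δ₀_ne_zero (hP.φ_x_ne_zero x hx))
      (pow_ne_zero 2 (hP.Ψ_ne_zero hx))) (E.g_ne_zero x hx)
  have hc := hP.contDiffOn_map.continuousOn
  have hT : ∀ p ∈ E.dom, ∀ q ∈ E.dom, (P.T q.1 = P.T p.1 ↔ q.1 = p.1) := fun p hp q hq =>
    hinjT.eq_iff ⟨q, hq, rfl⟩ ⟨p, hp, rfl⟩
  have hφ : ∀ p ∈ E.dom, ∀ q ∈ E.dom, (P.φ q.2.1 = P.φ p.2.1 ↔ q.2.1 = p.2.1) := fun p hp q hq =>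
    hinj.eq_iff ⟨q, hq, rfl⟩ ⟨p, hp, rfl⟩
  let E' : RDEquation :=
    { dom := P.map E.n '' E.dom
      isOpen_dom := (hP.injOn_map.isOpen_image_contDiffOn_invFunOn E.isOpen_dom
        hP.contDiffOn_map fun _ hp => hP.injective_fderiv_map hp).1
      isConnected_dom := E.isConnected_dom.image _ hc
      section_t := fun t => IsPreconnected.sep_image (c := fun p => p.1 = t)
        (d := fun p q => q.1 = p.1) hc (fun p _ => E.section_t p.1)
        (fun p hp hpt q hq => by subst hpt; exact hT p hp q hq)
      section_x := fun x => IsPreconnected.sep_image (c := fun p => p.2.1 = x)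
        (d := fun p q => q.2.1 = p.2.1) hc (fun p _ => E.section_x p.2.1)
        (fun p hp hpx q hq => by subst hpx; exact hφ p hp q hq)
      section_tx := fun t x => IsPreconnected.sep_image (c := fun p => p.1 = t ∧ p.2.1 = x)
        (d := fun p q => q.1 = p.1 ∧ q.2.1 = p.2.1) hc (fun p _ => E.section_tx p.1 p.2.1)
        (fun p hp hpx q hq => by
          obtain ⟨rfl, rfl⟩ := hpx
          exact and_congr (hT p hp q hq) (hφ p hp q hq))
      f := f'
      g := g'
      h := fun y => P.α' * f' y
      n := E.n / P.δ₃
      m := 0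
      smooth_f := by rwa [hxr]
      smooth_g := by rwa [hxr]
      smooth_h := by
        rw [hxr]
        exact contDiffOn_const.mul hf's
      f_ne_zero := by rwa [hxr]
      g_ne_zero := by rwa [hxr]
      n_ne_zero := div_ne_zero E.n_ne_zero hP.δ₃_ne_zero
      zero_outside := by
        rw [hxr]
        intro y hy
        have h1 : f' y = 0 := Set.indicator_of_notMem hy _
        exact ⟨h1, Set.indicator_of_notMem hy _, by simp [h1]⟩ }
  have hE'x : E'.xRange = P.φ '' E.xRange := hxr
  have hratio : ∀ y ∈ E'.xRange, E'.h y / E'.f y = P.α' := by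
    intro y hy
    rw [hE'x] at hy
    exact mul_div_cancel_right₀ _ (hf'0 y hy)
  refine ⟨⟨E', rfl, fun y hy => ?_⟩, ⟨hf'φ, hg'φ, rfl, hratio⟩, rfl⟩
  have h : (fun y => E'.h y / E'.f y) =ᶠ[𝓝 y] fun _ => P.α' := by
    filter_upwards [E'.isOpen_xRange.mem_nhds hy] with z hz using hratio z hz
  rw [h.deriv_eq, deriv_const]

/-! ### The group and the realization of all parameter values. -/

namespace RDTotal

variable {Φ : Equiv.Perm RDTotal} {E E' : RDSubclass} {F : ℝ × ℝ × ℝ → ℝ × ℝ × ℝ}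

theorem ext' {X Y : RDTotal} (h1 : X.1 = Y.1) (h2 : (X.2 : ℝ × ℝ × ℝ) = Y.2) : X = Y := by
  obtain ⟨E, p⟩ := X
  obtain ⟨E', p'⟩ := Y
  simp only at h1
  subst h1
  exact congrArg (Sigma.mk E) (Subtype.ext h2)

theorem ActsBy.apply (h : ActsBy Φ E E' F) {X : RDTotal} (hX : X.1 = E) :
    (Φ X).1 = E' ∧ ((Φ X).2 : ℝ × ℝ × ℝ) = F X.2 := by
  obtain ⟨E, p⟩ := X
  simp only at hX
  subst hX
  exact h p

/-- `Φ` is a bijection of the total space covering the bijection `e`, so it restricts to a bijection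
between corresponding fibres. -/
theorem ActsBy.bijOn {e : Equiv.Perm RDSubclass} (he : ∀ X, (Φ X).1 = e X.1)
    (h : ActsBy Φ E (e E) F) : Set.BijOn F E.1.dom (e E).1.dom := by
  refine ⟨fun p hp => ?_, fun p hp q hq hpq => ?_, fun p' hp' => ?_⟩
  · obtain ⟨h1, h2⟩ := h ⟨p, hp⟩
    rw [← h2, ← h1]
    exact (Φ ⟨E, ⟨p, hp⟩⟩).2.2
  · obtain ⟨h1, h2⟩ := h ⟨p, hp⟩
    obtain ⟨h3, h4⟩ := h ⟨q, hq⟩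
    have h5 : Φ ⟨E, ⟨p, hp⟩⟩ = Φ ⟨E, ⟨q, hq⟩⟩ :=
      ext' (h1.trans h3.symm) (h2.trans (hpq.trans h4.symm))
    have h6 := Φ.injective h5
    simpa using h6
  · obtain ⟨X, hX⟩ := Φ.surjective ⟨e E, ⟨p', hp'⟩⟩
    have h1 : X.1 = E := e.injective (by rw [← he X, hX])
    have h2 := (h.apply h1).2
    rw [hX] at h2
    refine ⟨X.2, ?_, h2.symm⟩
    rw [← h1]
    exact X.2.2

end RDTotal

/-- A transformation between two equations extends to an element of the group. -/
theorem exists_isGenExtEquivTransformation {E E' : RDSubclass} {F : ℝ × ℝ × ℝ → ℝ × ℝ × ℝ}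
    {T φ : ℝ → ℝ} (hfib : RDEquation.Fibered F E.1 T φ)
    (hF : RDEquation.IsPointTransformation F E.1 E'.1) (hT : RDEquation.Transforms F E.1 E'.1) :
    ∃ Φ, IsGenExtEquivTransformation Φ ∧ RDTotal.ActsBy Φ E E' F := by
  classical
  have key : ∀ D : RDSubclass, ∃ H : ℝ × ℝ × ℝ → ℝ × ℝ × ℝ,
      RDEquation.IsPointTransformation H D.1 (Equiv.swap E E' D).1 ∧
      RDEquation.Transforms H D.1 (Equiv.swap E E' D).1 ∧ (D = E → H = F) := by
    -- The swap of `E` and `E'` is covered by `F`, its inverse, and the identity elsewhere. The case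
    -- `D = E` comes first, so `F` is used even when `E' = E`.
    intro D
    by_cases h1 : D = E
    · subst h1
      rw [Equiv.swap_apply_left]
      exact ⟨F, hF, hT, fun _ => rfl⟩
    · by_cases h2 : D = E'
      · subst h2
        rw [Equiv.swap_apply_right]
        exact ⟨_, hF.invFunOn, hT.invFunOn hfib hF, fun h => absurd h h1⟩
      · rw [Equiv.swap_apply_of_ne_of_ne h1 h2]
        exact ⟨id, RDEquation.isPointTransformation_id, RDEquation.transforms_id D.2.1,
          fun h => absurd h h1⟩
  choose H hH using key
  refine ⟨Equiv.sigmaCongr (Equiv.swap E E') fun D => (hH D).1.2.1.equiv (H D),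
    ⟨Equiv.swap E E', fun D => ⟨H D, fun p => ⟨rfl, rfl⟩, (hH D).1, (hH D).2.1⟩⟩, fun p => ?_⟩
  refine ⟨Equiv.swap_apply_left E E', ?_⟩
  exact congrFun ((hH E).2.2 rfl) p

/-- In the converse direction the formulas alone do not say that the map is onto the new domain;
this comes from bijectivity of `Φ`. -/
theorem isGenExtEquivTransformation_iff (Φ : Equiv.Perm RDTotal) :
    IsGenExtEquivTransformation Φ ↔
      ∃ e : Equiv.Perm RDSubclass, ∀ E : RDSubclass, ∃ P : RDParams,
        P.Admissible E.1 ∧ P.Target E.1 (e E).1 ∧ RDTotal.ActsBy Φ E (e E) (P.map E.1.n) := by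
  constructor
  · rintro ⟨e, he⟩
    refine ⟨e, fun E => ?_⟩
    obtain ⟨F, hΦ, hF, hT⟩ := he E
    obtain ⟨P, hP, hPT, hPF⟩ := RDEquation.exists_params E.2 (e E).2 hF hT
    refine ⟨P, hP, hPT, fun p => ⟨(hΦ p).1, ?_⟩⟩
    rw [← hPF p p.2]
    exact (hΦ p).2
  · rintro ⟨e, he⟩
    have he' : ∀ X, (Φ X).1 = e X.1 := fun X => by
      obtain ⟨P, -, -, h⟩ := he X.1
      exact (h.apply rfl).1
    refine ⟨e, fun E => ?_⟩
    obtain ⟨P, hP, hPT, hΦ⟩ := he E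
    have hb := hΦ.bijOn he'
    exact ⟨_, hΦ, hP.isPointTransformation hb, hP.transforms E.2.1 (e E).2.1 hPT hb⟩

/-- The form of a transformation together with its analytic properties. -/
theorem IsGenExtEquivTransformation.exists_fibered {Φ : Equiv.Perm RDTotal}
    (hΦ : IsGenExtEquivTransformation Φ) :
    ∃ e : Equiv.Perm RDSubclass, (∀ X, (Φ X).1 = e X.1) ∧ ∀ E : RDSubclass,
      ∃ (F : ℝ × ℝ × ℝ → ℝ × ℝ × ℝ) (T φ : ℝ → ℝ), RDTotal.ActsBy Φ E (e E) F ∧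
        RDEquation.IsPointTransformation F E.1 (e E).1 ∧
        RDEquation.Transforms F E.1 (e E).1 ∧ RDEquation.Fibered F E.1 T φ := by
  obtain ⟨e, he⟩ := (isGenExtEquivTransformation_iff Φ).1 hΦ
  have he' : ∀ X, (Φ X).1 = e X.1 := fun X => by
    obtain ⟨P, -, -, h⟩ := he X.1
    exact (h.apply rfl).1
  refine ⟨e, he', fun E => ?_⟩
  obtain ⟨P, hP, hPT, h⟩ := he E
  have hb := h.bijOn he'
  exact ⟨_, _, _, h, hP.isPointTransformation hb, hP.transforms E.2.1 (e E).2.1 hPT hb, hP.fibered⟩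

/-- The group of generalized extended equivalence transformations of the subclass. -/
def genExtEquivGroup : Subgroup (Equiv.Perm RDTotal) where
  carrier := {Φ | IsGenExtEquivTransformation Φ}
  one_mem' := ⟨1, fun E => ⟨id, fun _ => ⟨rfl, rfl⟩, RDEquation.isPointTransformation_id,
    RDEquation.transforms_id E.2.1⟩⟩
  mul_mem' := by
    rintro Φ₂ Φ₁ ⟨e₂, he₂⟩ hΦ₁
    obtain ⟨e₁, -, he₁⟩ := hΦ₁.exists_fibered
    refine ⟨e₂ * e₁, fun E => ?_⟩
    obtain ⟨F₁, T, φ, hΦ₁, hF₁, hT₁, hfib⟩ := he₁ E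
    obtain ⟨F₂, hΦ₂, hF₂, hT₂⟩ := he₂ (e₁ E)
    refine ⟨F₂ ∘ F₁, fun p => ?_, hF₂.comp hF₁, hT₁.comp hfib hF₁ hT₂⟩
    obtain ⟨h1, h2⟩ := hΦ₁ p
    obtain ⟨h3, h4⟩ := hΦ₂.apply h1
    exact ⟨h3, by rw [Function.comp_apply, ← h2]; exact h4⟩
  inv_mem' := by
    intro Φ hΦ
    obtain ⟨e, he', he⟩ := IsGenExtEquivTransformation.exists_fibered hΦ
    refine ⟨e⁻¹, fun E' => ?_⟩
    obtain ⟨E, rfl⟩ := e.surjective E'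
    rw [show e⁻¹ (e E) = E from e.symm_apply_apply E]
    obtain ⟨F, T, φ, h, hF, hT, hfib⟩ := he E
    refine ⟨_, fun p' => ?_, hF.invFunOn, hT.invFunOn hfib hF⟩
    obtain ⟨X, hX⟩ := Φ.surjective ⟨e E, p'⟩
    have h1 : X.1 = E := e.injective (by rw [← he' X, hX])
    have h2 := (h.apply h1).2
    rw [hX] at h2
    have h3 : Φ⁻¹ ⟨e E, p'⟩ = X := by rw [← hX]; exact Φ.symm_apply_apply X
    rw [h3]
    refine ⟨h1, ?_⟩
    have h4 : (X.2 : ℝ × ℝ × ℝ) ∈ E.1.dom := by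
      rw [← h1]
      exact X.2.2
    simp only at h2
    rw [h2, hF.2.1.injOn.leftInvOn_invFunOn h4]

theorem mem_genExtEquivGroup (Φ : Equiv.Perm RDTotal) :
    Φ ∈ genExtEquivGroup ↔ IsGenExtEquivTransformation Φ :=
  Iff.rfl

theorem RDParams.Admissible.exists_realization {E : RDSubclass} {P : RDParams}
    (hP : P.Admissible E.1) :
    ∃ Φ ∈ genExtEquivGroup, ∃ E' : RDSubclass,
      P.Target E.1 E'.1 ∧ RDTotal.ActsBy Φ E E' (P.map E.1.n) := by
  obtain ⟨E', hT, hdom⟩ := hP.exists_target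
  have hb : Set.BijOn (P.map E.1.n) E.1.dom E'.1.dom := by
    rw [hdom]
    exact hP.injOn_map.bijOn_image
  obtain ⟨Φ, h1, h2⟩ := exists_isGenExtEquivTransformation hP.fibered
    (hP.isPointTransformation hb) (hP.transforms E.2.1 E'.2.1 hT hb)
  exact ⟨Φ, h1, E', hT, h2⟩

/-! ### A transformation not affine in `t`, and the theorem. -/

/-- The equation `u_t = (e^u u_x)_x + 1` on the whole space. -/
def RDSubclass.unit : RDSubclass where
  val :=
    { dom := Set.univ
      isOpen_dom := isOpen_univ
      isConnected_dom := isConnected_univ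
      section_t := fun t => by
        have h : {p ∈ (Set.univ : Set (ℝ × ℝ × ℝ)) | p.1 = t} = {t} ×ˢ Set.univ := by
          ext p
          simp
        rw [h]
        exact isPreconnected_singleton.prod isPreconnected_univ
      section_x := fun x => by
        have h : {p ∈ (Set.univ : Set (ℝ × ℝ × ℝ)) | p.2.1 = x} =
            Set.univ ×ˢ ({x} ×ˢ Set.univ) := by
          ext p
          simp
        rw [h]
        exact isPreconnected_univ.prod (isPreconnected_singleton.prod isPreconnected_univ)
      section_tx := fun t x => by
        have h : {p ∈ (Set.univ : Set (ℝ × ℝ × ℝ)) | p.1 = t ∧ p.2.1 = x} =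
            {t} ×ˢ ({x} ×ˢ Set.univ) := by
          ext p
          simp
        rw [h]
        exact isPreconnected_singleton.prod (isPreconnected_singleton.prod isPreconnected_univ)
      f := fun _ => 1
      g := fun _ => 1
      h := fun _ => 1
      n := 1
      m := 0
      smooth_f := contDiffOn_const
      smooth_g := contDiffOn_const
      smooth_h := contDiffOn_const
      f_ne_zero := fun _ _ => one_ne_zero
      g_ne_zero := fun _ _ => one_ne_zero
      n_ne_zero := one_ne_zero
      zero_outside := fun x hx => absurd ⟨(0, x, 0), trivial, rfl⟩ hx }
  property := ⟨rfl, fun x _ => deriv_const x ((1 : ℝ) / 1)⟩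

/-- The parameters of the transformation `t ↦ e^t - 1`, `u ↦ u - t`. -/
noncomputable def RDParams.expTimeChange : RDParams where
  δ₀ := 1
  δ₁ := 1
  δ₂ := 0
  δ₃ := 1
  δ₄ := 0
  δ₅ := 1
  α := 1
  α' := 0
  T := fun t => Real.exp t - 1
  φ := id
  G := id

theorem RDParams.deriv_expTimeChange_T (t : ℝ) :
    deriv RDParams.expTimeChange.T t = Real.exp t :=
  ((Real.hasDerivAt_exp t).sub_const 1).deriv

theorem RDParams.admissible_expTimeChange :
    RDParams.expTimeChange.Admissible RDSubclass.unit.1 where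
  const_ne_zero := by norm_num [expTimeChange]
  pair_ne_zero := by simp [expTimeChange]
  ratio := fun x _ => div_one (1 : ℝ)
  antideriv := fun x _ => by
    change HasDerivAt id (1 / 1) x
    rw [div_one]
    exact hasDerivAt_id x
  smooth_φ := contDiffOn_id
  φ_x_ne_zero := fun x _ => by
    change deriv id x ≠ 0
    rw [deriv_id]
    exact one_ne_zero
  smooth_T := (Real.contDiff_exp.sub contDiff_const).contDiffOn
  T_t_ne_zero := fun t _ => by
    rw [deriv_expTimeChange_T]
    exact (Real.exp_pos t).ne'
  T_eq := fun t _ => by simp [expTime, expTimeChange, RDSubclass.unit]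
  sign := fun t _ x _ => by
    rw [deriv_expTimeChange_T]
    simpa [Ψ, expTimeChange] using Real.exp_pos t

/-- The values at `0`, `1`, `2` would give `(e - 1)² = 0`. -/
theorem exp_sub_one_not_affine : ¬ ∃ a b : ℝ, ∀ t : ℝ, Real.exp t - 1 = a * t + b := by
  rintro ⟨a, b, h⟩
  have h0 := h 0
  have h1 := h 1
  have h2 := h 2
  have h3 : Real.exp 2 = Real.exp 1 ^ 2 := by
    rw [← Real.exp_nat_mul]
    norm_num
  have h4 : (1 : ℝ) < Real.exp 1 := Real.one_lt_exp_iff.2 one_pos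
  rw [Real.exp_zero] at h0
  rw [h3] at h2
  nlinarith

theorem theorem8 :
    ∃ 𝒢 : Subgroup (Equiv.Perm RDTotal),
      -- the generalized extended equivalence transformations form a group
      (∀ Φ : Equiv.Perm RDTotal, Φ ∈ 𝒢 ↔ IsGenExtEquivTransformation Φ) ∧
      -- it consists of the transformations of the stated form
      (∀ Φ : Equiv.Perm RDTotal, Φ ∈ 𝒢 ↔
        ∃ e : Equiv.Perm RDSubclass, ∀ E : RDSubclass, ∃ P : RDParams,
          P.Admissible E.1 ∧ P.Target E.1 (e E).1 ∧
          RDTotal.ActsBy Φ E (e E) (P.map E.1.n)) ∧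
      -- all values of the parameters are realized, for every equation
      (∀ (E : RDSubclass) (P : RDParams), P.Admissible E.1 →
        ∃ Φ ∈ 𝒢, ∃ E' : RDSubclass,
          P.Target E.1 E'.1 ∧ RDTotal.ActsBy Φ E E' (P.map E.1.n)) ∧
      -- the group contains transformations that are not affine in `t`
      (∃ Φ ∈ 𝒢, ∃ E : RDSubclass, ¬ ∃ a b : ℝ, ∀ p : E.1.dom,
        ((Φ ⟨E, p⟩).2 : ℝ × ℝ × ℝ).1 = a * (p : ℝ × ℝ × ℝ).1 + b) := by
  refine ⟨genExtEquivGroup, mem_genExtEquivGroup, isGenExtEquivTransformation_iff,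
    fun _ _ hP => hP.exists_realization, ?_⟩
  obtain ⟨Φ, hΦ, E', -, hact⟩ := RDParams.admissible_expTimeChange.exists_realization
  refine ⟨Φ, hΦ, RDSubclass.unit, ?_⟩
  rintro ⟨a, b, h⟩
  refine exp_sub_one_not_affine ⟨a, b, fun t => ?_⟩
  have h1 := h ⟨(t, 0, 0), trivial⟩
  rw [(hact ⟨(t, 0, 0), trivial⟩).2] at h1
  exact h1
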